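/- Consider the Nash welfare problem for asymmetric agents with identical additive valuations. An instance consists of $n\ge 1$ agents with positive rational weights $\eta_1,\dots,\eta_n$ and $m\ge 0$ indivisible goods, where good $j$ has the same nonnegative rational value $u_j$ for all agents. An allocation $x=(x_1,\dots,x_n)$ is a partition of the goods into $n$ (possibly empty) bundles, one per agent, and its Nash welfare is $$\mathrm{NW}(x)=\Big(\prod_{i=1}^n\Big(\sum_{j\in x_i}u_j\Big)^{\eta_i}\Big)^{1/\sum_{i=1}^n\eta_i}.$$ This problem admits a polynomial-time approximation scheme. Precisely, let $L$ denote the bit length of an instance (all numbers written in binary, each rational as a numerator and a denominator in lowest terms), and measure running time on a random access machine with logarithmic (bit) cost. There is an absolute constant $K$ such that for every $\varepsilon\in(0,1)$ there is an algorithm that, on every instance, outputs within time $$K\cdot L^{K}\cdot (m+1)^{K/\varepsilon^2}$$ an allocation $x$ with $\mathrm{NW}(x)\ge(1-\varepsilon)\,\mathrm{NW}(y)$ for every allocation $y$, i.e. with Nash welfare at least $(1-\varepsilon)\cdot\mathrm{OPT}$. -/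

import Mathlib

namespace NashWelfare

/-! ### Allocations and Nash welfare -/

/-- An allocation of the goods `Fin m` among the agents `Fin n`: every good is given to exactly
one agent. This is the same thing as an ordered partition of the goods into `n` (possibly empty)
bundles. -/
abbrev Allocation (n m : ℕ) : Type := Fin m → Fin n

/-- The set of goods that agent `i` receives. -/
def bundle {n m : ℕ} (x : Allocation n m) (i : Fin n) : Finset (Fin m) :=
  Finset.univ.filter (fun j => x j = i)

/-- The Nash welfare of an allocation for valuations `v` and weights `η`: the weighted geometric
mean of the utilities of the agents. -/
noncomputable def nashWelfare {n m : ℕ} (v : Fin n → Finset (Fin m) → ℝ) (η : Fin n → ℝ)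
    (x : Allocation n m) : ℝ :=
  (∏ i, v i (bundle x i) ^ η i) ^ (1 / ∑ i, η i)

/-- `x` is an `α`-approximation: its Nash welfare is at least `α` times that of any allocation,
hence at least `α` times the optimum. -/
def IsApprox {n m : ℕ} (v : Fin n → Finset (Fin m) → ℝ) (η : Fin n → ℝ) (α : ℝ)
    (x : Allocation n m) : Prop :=
  ∀ y : Allocation n m, α * nashWelfare v η y ≤ nashWelfare v η x

/-- An instance of the Nash welfare problem for asymmetric agents with identical additive
valuations: at least one agent, finitely many goods, the nonnegative common value of every good
and the positive weight of every agent. The numbers are rational, since they are the input of an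
algorithm. -/
structure Inst where
  /-- number of agents -/
  n : ℕ
  n_pos : 0 < n
  /-- number of goods -/
  m : ℕ
  /-- common value of each good -/
  value : Fin m → ℚ≥0
  /-- weight (entitlement) of each agent -/
  weight : Fin n → ℚ≥0
  weight_pos : ∀ i, 0 < weight i

/-- The valuations of the agents: additive, and the same for all of them. -/
noncomputable def Inst.valuation (I : Inst) : Fin I.n → Finset (Fin I.m) → ℝ :=
  fun _ S => ∑ j ∈ S, (I.value j : ℝ)

/-- The weights of the agents as real numbers. -/
noncomputable def Inst.realWeight (I : Inst) : Fin I.n → ℝ :=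
  fun i => (I.weight i : ℝ)

/-! ### Random access machines with logarithmic cost

Programs work on finitely many one-dimensional arrays of natural numbers (only the arrays that
occur in the text of the program can be touched), with the usual arithmetic, indirect addressing,
tests and loops. Every use of a number, also as an address, is charged with its bit length
(and multiplication and division with the product of the bit lengths), so that the total cost is
polynomially related to the running time of a Turing machine. -/

/-- The charge for handling a number: its number of binary digits plus one. -/
def bitLen (a : ℕ) : ℕ := Nat.size a + 1

/-- The contents of the arrays: `s a i` is the cell `i` of the array `a`. -/
abbrev State : Type := ℕ → ℕ → ℕ

/-- The arithmetic operations: addition, truncated subtraction, multiplication, and division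
with rounding down (division by zero gives zero). -/
inductive BinOp where
  | add
  | sub
  | mul
  | div

/-- The value of an operation. -/
def BinOp.eval : BinOp → ℕ → ℕ → ℕ
  | .add, a, b => a + b
  | .sub, a, b => a - b
  | .mul, a, b => a * b
  | .div, a, b => a / b

/-- The cost of an operation. -/
def BinOp.cost : BinOp → ℕ → ℕ → ℕ
  | .add, a, b => bitLen a + bitLen b
  | .sub, a, b => bitLen a + bitLen b
  | .mul, a, b => bitLen a * bitLen b
  | .div, a, b => bitLen a * bitLen b

/-- Expressions: constants, the cell of a given array at a computed index, and arithmetic. -/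
inductive Expr where
  | lit (c : ℕ)
  | get (a : ℕ) (i : Expr)
  | bin (o : BinOp) (e f : Expr)

/-- The value of an expression. -/
def Expr.eval (s : State) : Expr → ℕ
  | .lit c => c
  | .get a i => s a (i.eval s)
  | .bin o e f => o.eval (e.eval s) (f.eval s)

/-- The cost of evaluating an expression. -/
def Expr.cost (s : State) : Expr → ℕ
  | .lit c => bitLen c
  | .get a i => i.cost s + bitLen (i.eval s) + bitLen (s a (i.eval s))
  | .bin o e f => e.cost s + f.cost s + o.cost (e.eval s) (f.eval s)

/-- Programs. -/
inductive Prog where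
  /-- do nothing -/
  | skip
  /-- write the value of `e` into the cell of the array `a` whose index is the value of `i` -/
  | set (a : ℕ) (i e : Expr)
  /-- `p`, then `q` -/
  | seq (p q : Prog)
  /-- `p` if the value of `e` is not zero, and `q` otherwise -/
  | ite (e : Expr) (p q : Prog)
  /-- repeat `p` as long as the value of `e` is not zero -/
  | loop (e : Expr) (p : Prog)

/-- Change of one cell of one array. -/
def State.write (s : State) (a i c : ℕ) : State :=
  fun a' i' => if a' = a ∧ i' = i then c else s a' i'

/-- `Exec p s s' t`: started in `s`, the program `p` halts in `s'`, with total cost `t`. -/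
inductive Exec : Prog → State → State → ℕ → Prop where
  | skip (s : State) : Exec .skip s s 1
  | set (s : State) (a : ℕ) (i e : Expr) :
      Exec (.set a i e) s (s.write a (i.eval s) (e.eval s))
        (i.cost s + e.cost s + bitLen (i.eval s) + bitLen (e.eval s))
  | seq {p q : Prog} {s s' s'' : State} {t t' : ℕ} :
      Exec p s s' t → Exec q s' s'' t' → Exec (.seq p q) s s'' (t + t')
  | ite_true {e : Expr} {p q : Prog} {s s' : State} {t : ℕ} :
      e.eval s ≠ 0 → Exec p s s' t →
      Exec (.ite e p q) s s' (e.cost s + bitLen (e.eval s) + t)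
  | ite_false {e : Expr} {p q : Prog} {s s' : State} {t : ℕ} :
      e.eval s = 0 → Exec q s s' t →
      Exec (.ite e p q) s s' (e.cost s + bitLen (e.eval s) + t)
  | loop_true {e : Expr} {p : Prog} {s s' s'' : State} {t t' : ℕ} :
      e.eval s ≠ 0 → Exec p s s' t → Exec (.loop e p) s' s'' t' →
      Exec (.loop e p) s s'' (e.cost s + bitLen (e.eval s) + t + t')
  | loop_false {e : Expr} {p : Prog} {s : State} :
      e.eval s = 0 → Exec (.loop e p) s s (e.cost s + bitLen (e.eval s))

/-! ### Input and output -/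

/-- The input word: the numbers of agents and goods, then numerator and denominator of the value
of each good, then numerator and denominator of the weight of each agent. -/
def Inst.input (I : Inst) : List ℕ :=
  [I.n, I.m]
    ++ (List.ofFn fun j => [(I.value j).num, (I.value j).den]).flatten
    ++ (List.ofFn fun i => [(I.weight i).num, (I.weight i).den]).flatten

/-- The size of an instance: the bit length of the input. -/
def Inst.size (I : Inst) : ℕ := (I.input.map bitLen).sum

/-- The initial state: the input is in array 0, and all other cells are zero. -/
def Inst.init (I : Inst) : State :=
  fun a i => if a = 0 then I.input.getD i 0 else 0

/-- The output of a halted program is `x`: for each good `j`, cell `j` of array 1 holds the agent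
that receives `j`. -/
def Outputs {n m : ℕ} (s : State) (x : Allocation n m) : Prop :=
  ∀ j : Fin m, s 1 j = x j

/-- On the instance `I`, the program `p` halts at cost at most `T` and outputs an allocation
that is a `(1 - ε)`-approximation. -/
def SolvesWithin (p : Prog) (I : Inst) (ε T : ℝ) : Prop :=
  ∃ (s : State) (t : ℕ) (x : Allocation I.n I.m),
    Exec p I.init s t ∧ (t : ℝ) ≤ T ∧ Outputs s x ∧
      IsApprox I.valuation I.realWeight (1 - ε) x

end NashWelfare

/-! With `k` about `8 / ε`, loads and sizes are rounded to relative precision of order `1 / k`, and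
the rounded problem is solved exactly by a dynamic program that sweeps over powers of two.

By the rearrangement inequality, permuting the bundles so that heavier agents get larger loads does
not decrease the Nash welfare. So agents can be served in order of weight with nondecreasing loads.
An agent with load in `[k² 2^ℓ, 2k² 2^ℓ)` is served at level `ℓ`, and levels only go up. At level
`ℓ` a good of size `b` is seen as its class `⌊b / 2^ℓ⌋`. A class above `k` determines the size up to
a fraction `1 / k`. Goods of class at most `k` are so small against the load that only their total
matters, counted in chunks of `k 2^ℓ`. Goods of class `2k²` or more fit into no bundle of this level
and are all still unassigned. A vector of `D = 2k²` counts therefore describes the remaining goods,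
and the vector for level `ℓ + 1` can be computed from it. This gives `(2m+2)^(2k²)` vectors, times
levels, agents and nominal loads. The objective is the sum of `w (kℓ + ⌊log₂ N^k⌋)`, an integer
approximation of `k w log₂(N 2^ℓ)` with error at most `w` per agent.

Two simulations compare the table with real allocations. In one direction, any allocation with
increasing loads is followed by a legal path (`path_le_val`): the invariant `Room` says that the
counts leave room for its remaining goods, and its agents lose a factor of at most `1 - 4/k`
(`le_nominal_mul`). In the other direction, the best path is turned greedily into an allocation: the
invariant `Covers` says that the unassigned goods really cover the counts, and an agent gets at
least `1 - 3/k` of its nominal load (`Covers.held_ge`). Rounding the logarithm costs `2^(-1/k) ≥ 1 -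
1/k`. The product of the three factors is at least `1 - 8/k` (`le_ratio`), and
`Inst.isApprox_of_table` concludes.

For the running time, programs are analysed in unit steps with a bound `X` on the bits of every
number written. `Steps.exec` converts this into logarithmic cost, and `time_le` absorbs all powers
of `k` into `(m+1)^(25k²)`, which requires at least one good; the case `m = 0` is treated
separately. -/

namespace NashWelfare

/-! ### Machine steps and their cost -/

/-- The number of nodes of an expression. -/
def Expr.nodes : Expr → ℕ
  | .lit _ => 1
  | .get _ i => i.nodes + 1
  | .bin _ e f => e.nodes + f.nodes + 1

/-- All literals of the expression are below `M`. -/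
def Expr.LitsBelow (M : ℕ) : Expr → Prop
  | .lit c => c < M
  | .get _ i => i.LitsBelow M
  | .bin _ e f => e.LitsBelow M ∧ f.LitsBelow M

/-- An expression with at most `Z` nodes and with literals of at most `X` bits. -/
def Expr.Fits (Z X : ℕ) (e : Expr) : Prop := e.nodes ≤ Z ∧ e.LitsBelow (2 ^ X)

/-- All expressions of the program have at most `Z` nodes and literals of at most `X` bits. -/
def Prog.Fits (Z X : ℕ) : Prog → Prop
  | .skip => True
  | .set _ i e => i.Fits Z X ∧ e.Fits Z X
  | .seq p q => p.Fits Z X ∧ q.Fits Z X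
  | .ite e p q => e.Fits Z X ∧ p.Fits Z X ∧ q.Fits Z X
  | .loop e p => e.Fits Z X ∧ p.Fits Z X

/-- All cells hold numbers of at most `X` bits. -/
def State.Below (X : ℕ) (s : State) : Prop := ∀ a i, s a i < 2 ^ X

theorem bitLen_le {a X : ℕ} (h : a < 2 ^ X) : bitLen a ≤ X + 1 :=
  Nat.succ_le_succ (Nat.size_le.2 h)

theorem Expr.one_le_nodes (e : Expr) : 1 ≤ e.nodes := by
  cases e <;> simp [Expr.nodes]

theorem BinOp.eval_lt {o : BinOp} {a b p q : ℕ} (ha : a < 2 ^ p) (hb : b < 2 ^ q) (hp : 1 ≤ p)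
    (hq : 1 ≤ q) : o.eval a b < 2 ^ (p + q) := by
  have h1 : 2 ^ 1 ≤ 2 ^ p := Nat.pow_le_pow_right (by norm_num) hp
  have h2 : 2 ^ 1 ≤ 2 ^ q := Nat.pow_le_pow_right (by norm_num) hq
  rw [pow_add]
  cases o <;> simp only [BinOp.eval]
  · nlinarith
  · have := Nat.sub_le a b
    nlinarith
  · exact Nat.mul_lt_mul'' ha hb
  · have := Nat.div_le_self a b
    nlinarith

/-- The bit length of a result is at most the sum of those of the operands, multiplication being the
extreme case. So bits grow at most linearly with the number of nodes. -/
theorem Expr.eval_lt {X : ℕ} (hX : 1 ≤ X) {s : State} (hs : s.Below X) (e : Expr)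
    (he : e.LitsBelow (2 ^ X)) : e.eval s < 2 ^ (X * e.nodes) := by
  induction e with
  | lit c => simpa [Expr.nodes, Expr.eval, Expr.LitsBelow] using he
  | get a i _ =>
    refine (hs a _).trans_le (Nat.pow_le_pow_right (by norm_num) ?_)
    simp only [Expr.nodes]
    nlinarith
  | bin o e f ihe ihf =>
    refine (BinOp.eval_lt (ihe he.1) (ihf he.2) ?_ ?_).trans_le
      (Nat.pow_le_pow_right (by norm_num) ?_)
    · exact Nat.mul_pos hX e.one_le_nodes
    · exact Nat.mul_pos hX f.one_le_nodes
    · simp only [Expr.nodes]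
      nlinarith

theorem Expr.bitLen_eval_le {Z X : ℕ} (hX : 1 ≤ X) {s : State} (hs : s.Below X) {e : Expr}
    (he : e.Fits Z X) : bitLen (e.eval s) ≤ X * Z + 1 :=
  bitLen_le ((e.eval_lt hX hs he.2).trans_le
    (Nat.pow_le_pow_right (by norm_num) (Nat.mul_le_mul_left _ he.1)))

theorem BinOp.cost_le {o : BinOp} {a b Y : ℕ} (hY : 2 ≤ Y) (ha : bitLen a ≤ Y)
    (hb : bitLen b ≤ Y) : o.cost a b ≤ Y ^ 2 := by
  have := Nat.mul_le_mul ha hb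
  cases o <;> simp only [BinOp.cost] <;> nlinarith

theorem Expr.cost_le {Z X : ℕ} (hX : 1 ≤ X) {s : State} (hs : s.Below X) (e : Expr)
    (he : e.Fits Z X) : e.cost s ≤ 3 * e.nodes * (X * Z + 1) ^ 2 := by
  have hY : 2 ≤ X * Z + 1 := by
    have : 1 ≤ X * Z := Nat.mul_pos hX (e.one_le_nodes.trans he.1)
    omega
  generalize hYd : X * Z + 1 = Y at hY
  have hYY : Y ≤ Y ^ 2 := by nlinarith
  induction e with
  | lit c =>
    have := Expr.bitLen_eval_le hX hs he
    simp only [Expr.eval] at this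
    simp only [Expr.cost, Expr.nodes]
    omega
  | get a i ih =>
    have hi : i.Fits Z X := ⟨(Nat.le_succ _).trans he.1, he.2⟩
    have h1 := Expr.bitLen_eval_le hX hs hi
    have h2 := Expr.bitLen_eval_le hX hs he
    simp only [Expr.eval] at h2
    have h3 := ih hi
    simp only [Expr.cost, Expr.nodes]
    nlinarith
  | bin o e f ihe ihf =>
    have h1 := he.1
    simp only [Expr.nodes] at h1
    have hfe : e.Fits Z X := ⟨by omega, he.2.1⟩
    have hff : f.Fits Z X := ⟨by omega, he.2.2⟩
    have h3 := ihe hfe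
    have h4 := ihf hff
    have h5 : o.cost (e.eval s) (f.eval s) ≤ Y ^ 2 :=
      BinOp.cost_le hY (hYd ▸ Expr.bitLen_eval_le hX hs hfe) (hYd ▸ Expr.bitLen_eval_le hX hs hff)
    simp only [Expr.cost, Expr.nodes]
    nlinarith

/-- Execution in which a command or test counts as one step and only numbers of at most `X` bits
are written. -/
inductive Steps (X : ℕ) : Prog → State → State → ℕ → Prop where
  | skip (s : State) : Steps X .skip s s 1
  | set (s : State) (a : ℕ) (i e : Expr) : e.eval s < 2 ^ X →
      Steps X (.set a i e) s (s.write a (i.eval s) (e.eval s)) 1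
  | seq {p q : Prog} {s s' s'' : State} {t t' : ℕ} :
      Steps X p s s' t → Steps X q s' s'' t' → Steps X (.seq p q) s s'' (t + t')
  | ite_true {e : Expr} {p q : Prog} {s s' : State} {t : ℕ} :
      e.eval s ≠ 0 → Steps X p s s' t → Steps X (.ite e p q) s s' (t + 1)
  | ite_false {e : Expr} {p q : Prog} {s s' : State} {t : ℕ} :
      e.eval s = 0 → Steps X q s s' t → Steps X (.ite e p q) s s' (t + 1)
  | loop_true {e : Expr} {p : Prog} {s s' s'' : State} {t t' : ℕ} :
      e.eval s ≠ 0 → Steps X p s s' t → Steps X (.loop e p) s' s'' t' →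
      Steps X (.loop e p) s s'' (t + t' + 1)
  | loop_false {e : Expr} {p : Prog} {s : State} :
      e.eval s = 0 → Steps X (.loop e p) s s 1

theorem State.Below.write {X : ℕ} {s : State} (hs : s.Below X) {a i c : ℕ} (hc : c < 2 ^ X) :
    (s.write a i c).Below X := by
  intro a' i'
  unfold State.write
  split_ifs
  · exact hc
  · exact hs a' i'

/-- The cost of one step. -/
def stepCost (Z X : ℕ) : ℕ := 8 * Z * (X * Z + 1) ^ 2

theorem Expr.test_cost_le {Z X : ℕ} (hX : 1 ≤ X) {s : State} (hs : s.Below X) {e : Expr}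
    (he : e.Fits Z X) : e.cost s + bitLen (e.eval s) ≤ 4 * Z * (X * Z + 1) ^ 2 := by
  have h1 := e.cost_le hX hs he
  have h2 := Expr.bitLen_eval_le hX hs he
  have h3 := e.one_le_nodes
  have h4 := he.1
  have h5 : 3 * e.nodes * (X * Z + 1) ^ 2 ≤ 3 * Z * (X * Z + 1) ^ 2 := by gcongr
  have h6 : 1 * (X * Z + 1) ≤ Z * (X * Z + 1) ^ 2 :=
    Nat.mul_le_mul (h3.trans h4) (Nat.le_self_pow two_ne_zero _)
  nlinarith

/-- The bridge from unit steps to logarithmic cost: cells stay below `2 ^ X`, so every expression of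
bounded size is cheap to evaluate at each step. Correctness and step counts can then be proved
without mentioning bit costs. -/
theorem Steps.exec {Z X : ℕ} (hZ : 1 ≤ Z) (hX : 1 ≤ X) {p : Prog} {s s' : State} {T : ℕ}
    (h : Steps X p s s' T) : p.Fits Z X → s.Below X →
      s'.Below X ∧ ∃ t, t ≤ T * stepCost Z X ∧ Exec p s s' t := by
  have hU : 1 ≤ stepCost Z X := Nat.mul_pos (by omega) (by positivity)
  have hE : ∀ {s : State} {e : Expr}, s.Below X → e.Fits Z X →
      e.cost s + bitLen (e.eval s) ≤ stepCost Z X := fun hs he =>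
    (Expr.test_cost_le hX hs he).trans (Nat.mul_le_mul_right _ (by omega))
  generalize hUd : stepCost Z X = U at hU hE
  induction h with
  | skip s => exact fun _ hs => ⟨hs, 1, by omega, .skip s⟩
  | set s a i e he =>
    intro hf hs
    refine ⟨hs.write he, _, ?_, .set s a i e⟩
    -- An assignment evaluates two expressions, index and value, at cost factor 4 each; this is the
    -- 8 in `stepCost`.
    have h1 := Expr.test_cost_le hX hs hf.1
    have h2 := Expr.test_cost_le hX hs hf.2
    have h3 : U = 8 * Z * (X * Z + 1) ^ 2 := hUd.symm
    nlinarith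
  | seq _ _ ih1 ih2 =>
    intro hf hs
    obtain ⟨hs', t1, ht1, he1⟩ := ih1 hf.1 hs
    obtain ⟨hs'', t2, ht2, he2⟩ := ih2 hf.2 hs'
    exact ⟨hs'', _, by nlinarith, he1.seq he2⟩
  | ite_true hne _ ih =>
    intro hf hs
    obtain ⟨hs', t1, ht1, he1⟩ := ih hf.2.1 hs
    have := hE hs hf.1
    exact ⟨hs', _, by nlinarith, .ite_true hne he1⟩
  | ite_false hne _ ih =>
    intro hf hs
    obtain ⟨hs', t1, ht1, he1⟩ := ih hf.2.2 hs
    have := hE hs hf.1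
    exact ⟨hs', _, by nlinarith, .ite_false hne he1⟩
  | loop_true hne _ _ ih1 ih2 =>
    intro hf hs
    obtain ⟨hs', t1, ht1, he1⟩ := ih1 hf.2 hs
    obtain ⟨hs'', t2, ht2, he2⟩ := ih2 hf hs'
    have := hE hs hf.1
    exact ⟨hs'', _, by nlinarith, .loop_true hne he1 he2⟩
  | loop_false h0 =>
    intro hf hs
    have := hE hs hf.1
    exact ⟨hs, _, by omega, .loop_false h0⟩

/-! ### Total correctness with step counts -/

/-- Started in `s`, the program `p` halts after at most `T` steps in a state with property `Q`. -/
def Runs (X : ℕ) (p : Prog) (s : State) (T : ℕ) (Q : State → Prop) : Prop :=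
  ∃ s' t, Steps X p s s' t ∧ t ≤ T ∧ Q s'

section Rules

variable {X : ℕ} {p q : Prog} {s : State} {T T' : ℕ} {Q R : State → Prop}

theorem Runs.mono (h : Runs X p s T Q) (hT : T ≤ T') (hQ : ∀ s', Q s' → R s') :
    Runs X p s T' R := by
  obtain ⟨s', t, h1, h2, h3⟩ := h
  exact ⟨s', t, h1, h2.trans hT, hQ s' h3⟩

theorem Runs.skip (h : Q s) : Runs X .skip s 1 Q := ⟨s, 1, .skip s, le_rfl, h⟩

theorem Runs.set {a : ℕ} {i e : Expr} (he : e.eval s < 2 ^ X)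
    (h : Q (s.write a (i.eval s) (e.eval s))) : Runs X (.set a i e) s 1 Q :=
  ⟨_, 1, .set s a i e he, le_rfl, h⟩

theorem Runs.seq (h : Runs X p s T R) (h' : ∀ s', R s' → Runs X q s' T' Q) :
    Runs X (.seq p q) s (T + T') Q := by
  obtain ⟨s', t, h1, h2, h3⟩ := h
  obtain ⟨s'', t', h4, h5, h6⟩ := h' s' h3
  exact ⟨s'', _, h1.seq h4, by omega, h6⟩

theorem Runs.set_seq {a : ℕ} {i e : Expr} (he : e.eval s < 2 ^ X)
    (h : Runs X q (s.write a (i.eval s) (e.eval s)) T Q) :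
    Runs X (.seq (.set a i e) q) s (T + 1) Q := by
  rw [add_comm]
  exact Runs.seq (R := fun s' => s' = s.write a (i.eval s) (e.eval s)) (Runs.set he rfl)
    (fun s' h' => h' ▸ h)

theorem Runs.ite {e : Expr} (h1 : e.eval s ≠ 0 → Runs X p s T Q)
    (h2 : e.eval s = 0 → Runs X q s T Q) : Runs X (.ite e p q) s (T + 1) Q := by
  by_cases h : e.eval s = 0
  · obtain ⟨s', t, h3, h4, h5⟩ := h2 h
    exact ⟨s', _, .ite_false h h3, by omega, h5⟩
  · obtain ⟨s', t, h3, h4, h5⟩ := h1 h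
    exact ⟨s', _, .ite_true h h3, by omega, h5⟩

/-- Strong induction on the measure `μ`: each round costs the body plus one test, and one last test
leaves the loop. -/
theorem Runs.loop {e : Expr} (Inv : State → Prop) (μ : State → ℕ)
    (hstep : ∀ s, Inv s → e.eval s ≠ 0 → Runs X p s T (fun s' => Inv s' ∧ μ s' < μ s))
    (h0 : Inv s) :
    Runs X (.loop e p) s (μ s * (T + 1) + 1) (fun s' => Inv s' ∧ e.eval s' = 0) := by
  induction hn : μ s using Nat.strong_induction_on generalizing s with
  | _ N ih =>
    subst hn
    by_cases he : e.eval s = 0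
    · exact ⟨s, 1, .loop_false he, by omega, h0, he⟩
    · obtain ⟨s', t, h1, h2, h3, h4⟩ := hstep s h0 he
      obtain ⟨s'', t', h5, h6, h7⟩ := ih (μ s') h4 h3 rfl
      refine ⟨s'', _, .loop_true he h1 h5, ?_, h7⟩
      nlinarith

end Rules

@[simp] theorem State.write_same (s : State) (a i c : ℕ) :
    s.write a i c a = Function.update (s a) i c := by
  funext i'
  simp [State.write, Function.update_apply]

theorem State.write_of_ne {s : State} {a a' i c : ℕ} (h : a' ≠ a) :
    s.write a i c a' = s a' := by
  funext i'
  simp [State.write, h]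

/-! ### Expressions -/

instance : Add Expr := ⟨.bin .add⟩
instance : Sub Expr := ⟨.bin .sub⟩
instance : Mul Expr := ⟨.bin .mul⟩
instance : Div Expr := ⟨.bin .div⟩

namespace Expr

variable (s : State) (e f g : Expr)

/-- The scalar variable kept in cell `0` of the array `a`. -/
def var (a : ℕ) : Expr := .get a (.lit 0)
/-- The test `e ≤ f`. -/
def le : Expr := .lit 1 - (e - f)
/-- The test `e = f`. -/
def eq : Expr := le e f * le f e
/-- `f` if `e` is nonzero, else `g`. -/
def cond : Expr := (.lit 1 - (.lit 1 - e)) * f + (.lit 1 - e) * g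
/-- The minimum. -/
def min : Expr := e - (e - f)
/-- The maximum. -/
def max : Expr := f + (e - f)
/-- The remainder. -/
def mod : Expr := e - e / f * f
/-- The sum of a list of expressions. -/
def sum (l : List Expr) : Expr := l.foldr (· + ·) (.lit 0)
/-- The value `f c` at the number `c ≤ d` that the expression `e` has as value. -/
def lookup (f : ℕ → ℕ) (d : ℕ) : Expr :=
  sum ((List.range (d + 1)).map fun c => eq e (.lit c) * .lit (f c))

@[simp] theorem eval_lit (c : ℕ) : (lit c).eval s = c := by
  exact id rfl
@[simp] theorem eval_get (a : ℕ) : (get a e).eval s = s a (e.eval s) := by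
  exact id rfl
@[simp] theorem eval_var (a : ℕ) : (var a).eval s = s a 0 := by
  exact id rfl
@[simp] theorem eval_add : (e + f).eval s = e.eval s + f.eval s := by
  exact id rfl
@[simp] theorem eval_sub : (e - f).eval s = e.eval s - f.eval s := by
  exact id rfl
@[simp] theorem eval_mul : (e * f).eval s = e.eval s * f.eval s := by
  exact id rfl
@[simp] theorem eval_div : (e / f).eval s = e.eval s / f.eval s := by
  exact id rfl
@[simp] theorem eval_le : (le e f).eval s = if e.eval s ≤ f.eval s then 1 else 0 := by
  simp only [le, eval_sub, eval_lit]
  split_ifs <;> omega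
@[simp] theorem eval_eq : (eq e f).eval s = if e.eval s = f.eval s then 1 else 0 := by
  simp only [eq, eval_mul, eval_le]
  split_ifs <;> omega
@[simp] theorem eval_cond : (cond e f g).eval s = if e.eval s = 0 then g.eval s else f.eval s := by
  simp only [cond, eval_mul, eval_sub, eval_add, eval_lit]
  split_ifs with h
  · simp [h]
  · have h1 : 1 - e.eval s = 0 := by omega
    simp [h1]
@[simp] theorem eval_min : (min e f).eval s = Min.min (e.eval s) (f.eval s) := by
  simp only [min, eval_sub]
  omega
@[simp] theorem eval_max : (max e f).eval s = Max.max (e.eval s) (f.eval s) := by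
  simp only [max, eval_sub, eval_add]
  omega
@[simp] theorem eval_mod : (mod e f).eval s = e.eval s % f.eval s := by
  simp only [mod, eval_sub, eval_mul, eval_div]
  have := Nat.div_add_mod (e.eval s) (f.eval s)
  rw [mul_comm] at this
  omega
@[simp] theorem eval_sum (l : List Expr) : (sum l).eval s = (l.map (fun e => e.eval s)).sum := by
  induction l with
  | nil => rfl
  | cons a l ih =>
    simp only [List.map_cons, List.sum_cons, ← ih]
    rfl
theorem eval_sum_range (F : ℕ → Expr) (d : ℕ) :
    (sum ((List.range d).map F)).eval s = ∑ c ∈ Finset.range d, (F c).eval s := by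
  rw [eval_sum, List.map_map, Finset.sum_range]
  rw [← List.sum_ofFn, List.ofFn_eq_map, ← List.map_coe_finRange_eq_range, List.map_map]
  rfl
theorem eval_lookup (F : ℕ → ℕ) (d : ℕ) (h : e.eval s ≤ d) :
    (lookup e F d).eval s = F (e.eval s) := by
  rw [lookup, eval_sum_range, Finset.sum_eq_single (e.eval s)]
  · simp
  · intro c _ hc
    simp [hc.symm]
  · intro hc
    simp at hc
    omega

@[simp] theorem nodes_lit (c : ℕ) : (lit c).nodes = 1 := rfl
@[simp] theorem nodes_get (a : ℕ) : (get a e).nodes = e.nodes + 1 := rfl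
@[simp] theorem nodes_var (a : ℕ) : (var a).nodes = 2 := rfl
@[simp] theorem nodes_add : (e + f).nodes = e.nodes + f.nodes + 1 := rfl
@[simp] theorem nodes_sub : (e - f).nodes = e.nodes + f.nodes + 1 := rfl
@[simp] theorem nodes_mul : (e * f).nodes = e.nodes + f.nodes + 1 := rfl
@[simp] theorem nodes_div : (e / f).nodes = e.nodes + f.nodes + 1 := rfl
@[simp] theorem nodes_le : (le e f).nodes = e.nodes + f.nodes + 3 := by
  simp only [le, nodes_sub, nodes_lit]; omega
@[simp] theorem nodes_eq : (eq e f).nodes = 2 * e.nodes + 2 * f.nodes + 7 := by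
  simp only [eq, nodes_mul, nodes_le]; omega
@[simp] theorem nodes_cond : (cond e f g).nodes = 2 * e.nodes + f.nodes + g.nodes + 9 := by
  simp only [cond, nodes_mul, nodes_sub, nodes_add, nodes_lit]; omega
@[simp] theorem nodes_min : (min e f).nodes = 2 * e.nodes + f.nodes + 2 := by
  simp only [min, nodes_sub]; omega
@[simp] theorem nodes_max : (max e f).nodes = e.nodes + 2 * f.nodes + 2 := by
  simp only [max, nodes_sub, nodes_add]; omega
@[simp] theorem nodes_mod : (mod e f).nodes = 2 * e.nodes + 2 * f.nodes + 3 := by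
  simp only [mod, nodes_sub, nodes_mul, nodes_div]; omega
theorem nodes_sum_le (F : ℕ → Expr) (l : List ℕ) (b : ℕ) (h : ∀ c ∈ l, (F c).nodes ≤ b) :
    (sum (l.map F)).nodes ≤ l.length * (b + 1) + 1 := by
  induction l with
  | nil => simp [sum]
  | cons a l ih =>
    have h1 := ih fun c hc => h c (List.mem_cons_of_mem _ hc)
    have h2 := h a List.mem_cons_self
    have h3 : (sum (List.map F (a :: l))).nodes = (F a).nodes + (sum (l.map F)).nodes + 1 := rfl
    rw [h3, List.length_cons]
    nlinarith

variable (M : ℕ)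

@[simp] theorem litsBelow_lit (c : ℕ) : (lit c).LitsBelow M ↔ c < M := Iff.rfl
@[simp] theorem litsBelow_get (a : ℕ) : (get a e).LitsBelow M ↔ e.LitsBelow M := Iff.rfl
@[simp] theorem litsBelow_var (a : ℕ) : (var a).LitsBelow M ↔ 0 < M := Iff.rfl
@[simp] theorem litsBelow_add : (e + f).LitsBelow M ↔ e.LitsBelow M ∧ f.LitsBelow M := Iff.rfl
@[simp] theorem litsBelow_sub : (e - f).LitsBelow M ↔ e.LitsBelow M ∧ f.LitsBelow M := Iff.rfl
@[simp] theorem litsBelow_mul : (e * f).LitsBelow M ↔ e.LitsBelow M ∧ f.LitsBelow M := Iff.rfl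
@[simp] theorem litsBelow_div : (e / f).LitsBelow M ↔ e.LitsBelow M ∧ f.LitsBelow M := Iff.rfl
@[simp] theorem litsBelow_le :
    (le e f).LitsBelow M ↔ 1 < M ∧ e.LitsBelow M ∧ f.LitsBelow M := by
  simp only [le, litsBelow_sub, litsBelow_lit]
@[simp] theorem litsBelow_eq :
    (eq e f).LitsBelow M ↔ 1 < M ∧ e.LitsBelow M ∧ f.LitsBelow M := by
  simp only [eq, litsBelow_mul, litsBelow_le]; tauto
@[simp] theorem litsBelow_cond : (cond e f g).LitsBelow M ↔
    1 < M ∧ e.LitsBelow M ∧ f.LitsBelow M ∧ g.LitsBelow M := by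
  simp only [cond, litsBelow_mul, litsBelow_sub, litsBelow_add, litsBelow_lit]; tauto
@[simp] theorem litsBelow_min : (min e f).LitsBelow M ↔ e.LitsBelow M ∧ f.LitsBelow M := by
  simp only [min, litsBelow_sub]; tauto
@[simp] theorem litsBelow_max : (max e f).LitsBelow M ↔ e.LitsBelow M ∧ f.LitsBelow M := by
  simp only [max, litsBelow_sub, litsBelow_add]; tauto
@[simp] theorem litsBelow_mod : (mod e f).LitsBelow M ↔ e.LitsBelow M ∧ f.LitsBelow M := by
  simp only [mod, litsBelow_sub, litsBelow_mul, litsBelow_div]; tauto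
theorem litsBelow_sum (hM : 0 < M) (F : ℕ → Expr) (l : List ℕ)
    (h : ∀ c ∈ l, (F c).LitsBelow M) : (sum (l.map F)).LitsBelow M := by
  induction l with
  | nil => exact hM
  | cons a l ih =>
    exact ⟨h a List.mem_cons_self, ih fun c hc => h c (List.mem_cons_of_mem _ hc)⟩

end Expr

/-! ### Counting loops -/

/-- Run `p` with the scalar variable `v` going through `0, …, N - 1`. -/
def Prog.count (v : ℕ) (N : Expr) (p : Prog) : Prog :=
  .seq (.set v (.lit 0) (.lit 0))
    (.loop (N - .var v) (.seq p (.set v (.lit 0) (.var v + .lit 1))))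

/-- The invariant refers to the state after the counter has been written, and the limit is evaluated
anew in each round, so `hN` asks that the invariant fixes its value. Each round adds one test and
one increment, hence `T + 2`. -/
theorem Runs.count {X v N₀ T : ℕ} {N : Expr} {p : Prog} {s : State} (Inv : ℕ → State → Prop)
    (hN : ∀ i s, i ≤ N₀ → Inv i s → N.eval s = N₀) (hX : N₀ < 2 ^ X)
    (h0 : Inv 0 (s.write v 0 0))
    (hstep : ∀ i s, i < N₀ → Inv i s → s v 0 = i →
      Runs X p s T (fun s' => s' v 0 = i ∧ Inv (i + 1) (s'.write v 0 (i + 1)))) :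
    Runs X (Prog.count v N p) s (N₀ * (T + 2) + 2) (Inv N₀) := by
  refine (Runs.set_seq (T := N₀ * (T + 2) + 1) ?_ ?_).mono le_rfl fun _ h => h
  · simp only [Expr.eval_lit]; omega
  have key := Runs.loop (X := X) (p := .seq p (.set v (.lit 0) (.var v + .lit 1)))
    (e := N - .var v) (T := T + 1) (s := s.write v 0 0)
    (fun s => s v 0 ≤ N₀ ∧ Inv (s v 0) s) (fun s => N₀ - s v 0) ?_ ?_
  · refine key.mono ?_ ?_
    · simp
    · rintro s' ⟨⟨h1, h2⟩, h3⟩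
      rw [Expr.eval_sub, hN _ _ h1 h2, Expr.eval_var] at h3
      have : s' v 0 = N₀ := by omega
      exact this ▸ h2
  · rintro s ⟨h1, h2⟩ h3
    rw [Expr.eval_sub, hN _ _ h1 h2, Expr.eval_var] at h3
    refine Runs.seq (hstep _ s (by omega) h2 rfl) ?_
    rintro s' ⟨h4, h5⟩
    refine Runs.set ?_ ?_
    · simp only [Expr.eval_add, Expr.eval_var, Expr.eval_lit]; omega
    · simp only [Expr.eval_add, Expr.eval_var, Expr.eval_lit, h4, State.write_same,
        Function.update_self]
      exact ⟨⟨by omega, h5⟩, by omega⟩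
  · simp only [State.write_same, Function.update_self]
    exact ⟨by omega, h0⟩

/-- The states agree outside the arrays in `A`. -/
def State.Agree (A : List ℕ) (s s' : State) : Prop := ∀ x, x ∉ A → s' x = s x

theorem State.Agree.refl (A : List ℕ) (s : State) : State.Agree A s s := fun _ _ => rfl

theorem State.Agree.trans {A : List ℕ} {s s' s'' : State} (h : State.Agree A s s')
    (h' : State.Agree A s' s'') : State.Agree A s s'' := fun x hx => (h' x hx).trans (h x hx)

theorem State.Agree.mono {A A' : List ℕ} {s s' : State} (h : State.Agree A s s') (hA : A ⊆ A') :
    State.Agree A' s s' := fun x hx => h x fun hx' => hx (hA hx')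

theorem State.Agree.write {A : List ℕ} {s s' : State} (h : State.Agree A s s') {a : ℕ}
    (ha : a ∈ A) (i c : ℕ) : State.Agree A s (s'.write a i c) := fun x hx => by
  have hxa : x ≠ a := by
    rintro rfl
    exact hx ha
  rw [State.write_of_ne hxa, h x hx]

/-- A counting loop whose body transforms one array, other changes being irrelevant. -/
theorem Runs.count_array {X v a N₀ T : ℕ} {N : Expr} {p : Prog} {s : State} (A : List ℕ)
    (R : ℕ → ℕ → ℕ) (hva : v ≠ a) (hv : v ∈ A) (hN : ∀ s', State.Agree (a :: A) s s' → N.eval s' = N₀)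
    (hX : N₀ < 2 ^ X) (h0 : s a = R 0)
    (hstep : ∀ i s', i < N₀ → State.Agree (a :: A) s s' → s' v 0 = i → s' a = R i →
      Runs X p s' T (fun s'' => State.Agree (a :: A) s s'' ∧ s'' v 0 = i ∧ s'' a = R (i + 1))) :
    Runs X (Prog.count v N p) s (N₀ * (T + 2) + 2)
      (fun s' => State.Agree (a :: A) s s' ∧ s' a = R N₀) := by
  have hv' : v ∈ a :: A := List.mem_cons_of_mem _ hv
  refine Runs.count (fun i s' => State.Agree (a :: A) s s' ∧ s' a = R i) ?_ hX ?_ ?_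
  · exact fun i s' _ h => hN s' h.1
  · exact ⟨(State.Agree.refl _ s).write hv' _ _, by rw [State.write_of_ne hva.symm, h0]⟩
  · rintro i s' hi ⟨h1, h2⟩ h3
    refine (hstep i s' hi h1 h3 h2).mono le_rfl ?_
    rintro s'' ⟨h4, h5, h6⟩
    exact ⟨h5, h4.write hv' _ _, by rw [State.write_of_ne hva.symm, h6]⟩

/-- A counting loop with a single assignment as its body. -/
theorem Runs.count_set {X v a N₀ : ℕ} {N ie e : Expr} {s : State}
    (R : ℕ → ℕ → ℕ) (hva : v ≠ a) (hN : ∀ s', State.Agree [a, v] s s' → N.eval s' = N₀)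
    (hX : N₀ < 2 ^ X) (h0 : s a = R 0)
    (hstep : ∀ i s', i < N₀ → State.Agree [a, v] s s' → s' v 0 = i → s' a = R i →
      e.eval s' < 2 ^ X ∧ Function.update (R i) (ie.eval s') (e.eval s') = R (i + 1)) :
    Runs X (Prog.count v N (.set a ie e)) s (N₀ * 3 + 2)
      (fun s' => State.Agree [a, v] s s' ∧ s' a = R N₀) := by
  refine Runs.count_array (T := 1) [v] R hva (by simp) hN hX h0 ?_
  intro i s' hi h1 h2 h3
  obtain ⟨h4, h5⟩ := hstep i s' hi h1 h2 h3
  refine Runs.set h4 ⟨h1.write (by simp) _ _, ?_, ?_⟩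
  · rw [State.write_of_ne hva, h2]
  · rw [State.write_same, h3, h5]

end NashWelfare

namespace NashWelfare

/-! ### The dynamic program -/

/-- The data of the dynamic program: the accuracy `k`, the numbers of goods, agents and levels, the
integer sizes of the goods and the integer weights of the agents, in increasing order. -/
structure Data where
  k : ℕ
  m : ℕ
  n : ℕ
  L : ℕ
  b : ℕ → ℕ
  w : ℕ → ℕ

namespace Data

variable (P : Data)

/-- The number of size classes: at level `ℓ`, the goods of class `c < D` have size about `c * 2 ^ ℓ`. -/
def D : ℕ := 2 * P.k ^ 2
/-- The radix in which vectors of counts are encoded. -/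
def B : ℕ := 2 * P.m + 2
/-- The class of the good `j` at level `ℓ`. -/
def cls (ℓ j : ℕ) : ℕ := P.b j / 2 ^ ℓ
/-- The number of goods of class `c` at level `ℓ`. -/
def cnt (ℓ c : ℕ) : ℕ := ((Finset.range P.m).filter fun j => P.cls ℓ j = c).card
/-- The `c`-th digit of `C`. -/
def digit (C c : ℕ) : ℕ := C / P.B ^ c % P.B
/-- The number with digits `g`. -/
def encode (g : ℕ → ℕ) : ℕ := ∑ c ∈ Finset.range P.D, g c * P.B ^ c
/-- The number of encoded states per level and agent, for a fixed nominal load. -/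
def W : ℕ := P.B ^ P.D
/-- The level of an encoded state. -/
def lev (s : ℕ) : ℕ := s / P.W / (P.D + 1) / (P.n + 1)
/-- The agent that is being served in an encoded state. -/
def agt (s : ℕ) : ℕ := s / P.W / (P.D + 1) % (P.n + 1)
/-- The nominal load of the agent that is being served. -/
def nom (s : ℕ) : ℕ := s / P.W % (P.D + 1)
/-- The encoded numbers of remaining goods of every class. -/
def con (s : ℕ) : ℕ := s % P.W
/-- The code of a state. -/
def code (ℓ i N C : ℕ) : ℕ := ((ℓ * (P.n + 1) + i) * (P.D + 1) + N) * P.W + C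
/-- The number of codes. -/
def NS : ℕ := P.L * (P.n + 1) * (P.D + 1) * P.W
/-- The remaining goods seen from the next level: pairs of classes are merged, the goods that become
small are glued to chunks of class `k`, and new goods appear. -/
def up (g : ℕ → ℕ) (ℓ c : ℕ) : ℕ :=
  min (P.B - 1)
    (if c < P.k then 0
    else if c = P.k then (∑ d ∈ Finset.range (P.k + 2), (P.k + d) * g (P.k + d)) / (2 * P.k)
    else if c < P.k ^ 2 then g (2 * c) + g (2 * c + 1)
    else P.cnt (ℓ + 1) c)
/-- The gain for serving agent `i` with nominal load `N` at level `ℓ`. -/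
def gain (ℓ i N : ℕ) : ℕ := P.w i * (P.k * ℓ + Nat.log 2 (N ^ P.k))

/-- The move `mv` may be made in state `s`: stop, serve the agent, go to the next level, or take
an item of class `mv`. -/
def Legal (s mv : ℕ) : Prop :=
  if mv = 0 then P.agt s = P.n
  else if mv = 1 then P.agt s < P.n ∧ P.k ^ 2 ≤ 2 * P.nom s
  else if mv = 2 then P.lev s + 1 < P.L
  else P.k ≤ mv ∧ 1 ≤ P.digit (P.con s) mv ∧ P.nom s + mv ≤ P.D ∧ P.agt s < P.n

instance (s mv : ℕ) : Decidable (P.Legal s mv) := by unfold Legal; infer_instance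

/-- The state after a move. -/
def next (s mv : ℕ) : ℕ :=
  if mv = 1 then P.code (P.lev s) (P.agt s + 1) 0 (P.con s)
  else if mv = 2 then P.code (P.lev s + 1) (P.agt s) 0 (P.encode (P.up (P.digit (P.con s)) (P.lev s)))
  else s + mv * P.W - P.B ^ mv

/-- The gain of a move. -/
def gainAt (s mv : ℕ) : ℕ := if mv = 1 then P.gain (P.lev s) (P.agt s) (P.nom s) else 0

/-- The entry of the table for a state and a move: value and move in one number, zero if the move
is not possible. -/
def entry (A : ℕ → ℕ) (s mv : ℕ) : ℕ :=
  if P.Legal s mv then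
    if mv = 0 then P.D
    else if P.D ≤ A (P.next s mv) then (A (P.next s mv) / P.D + P.gainAt s mv) * P.D + mv
    else 0
  else 0

/-- `A` is the table of best moves. -/
def IsTable (A : ℕ → ℕ) : Prop :=
  (∀ s < P.NS, A s = (Finset.range P.D).sup (P.entry A s)) ∧ ∀ s, P.NS ≤ s → A s = 0

variable {P}

theorem D_pos (hk : 8 ≤ P.k) : 0 < P.D := by unfold D; positivity

theorem B_pos : 0 < P.B := by unfold B; positivity

theorem W_pos : 0 < P.W := pow_pos B_pos _

theorem encode_lt {g : ℕ → ℕ} (hg : ∀ c, g c < P.B) : P.encode g < P.W := by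
  unfold encode W
  induction P.D with
  | zero => simp
  | succ d ih =>
    rw [Finset.sum_range_succ, pow_succ]
    have := hg d
    have h2 : (g d + 1) * P.B ^ d ≤ P.B * P.B ^ d := Nat.mul_le_mul_right _ this
    nlinarith

theorem digit_encode {g : ℕ → ℕ} (hg : ∀ c, g c < P.B) {c : ℕ} (hc : c < P.D) :
    P.digit (P.encode g) c = g c := by
  have key : ∀ d, c < d → (∑ e ∈ Finset.range d, g e * P.B ^ e) / P.B ^ c % P.B = g c := by
    have hlt : ∑ e ∈ Finset.range c, g e * P.B ^ e < P.B ^ c := by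
      clear hc
      induction c with
      | zero => simp
      | succ d ih =>
        rw [Finset.sum_range_succ, pow_succ]
        have h2 : (g d + 1) * P.B ^ d ≤ P.B * P.B ^ d := Nat.mul_le_mul_right _ (hg d)
        nlinarith
    intro d hd
    obtain ⟨e, rfl⟩ := Nat.exists_eq_add_of_le hd
    have hsum : ∑ x ∈ Finset.range (c + 1 + e), g x * P.B ^ x =
        ∑ x ∈ Finset.range c, g x * P.B ^ x +
          P.B ^ c * (g c + P.B * ∑ x ∈ Finset.range e, g (c + 1 + x) * P.B ^ x) := by
      rw [Finset.sum_range_add, Finset.sum_range_succ, mul_add, add_assoc, mul_comm (g c),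
        ← mul_assoc (P.B ^ c), ← pow_succ, Finset.mul_sum]
      congr 2
      refine Finset.sum_congr rfl fun x _ => ?_
      rw [pow_add]
      ring
    rw [hsum, Nat.add_mul_div_left _ _ (pow_pos B_pos c), Nat.div_eq_of_lt hlt, zero_add,
      Nat.add_mul_mod_self_left, Nat.mod_eq_of_lt (hg c)]
  exact key _ hc

section Code

variable {ℓ i N C : ℕ}

theorem code_div (hC : C < P.W) : P.code ℓ i N C / P.W = (ℓ * (P.n + 1) + i) * (P.D + 1) + N := by
  unfold code
  rw [mul_comm, Nat.mul_add_div W_pos, Nat.div_eq_of_lt hC, add_zero]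

theorem con_code (hC : C < P.W) : P.con (P.code ℓ i N C) = C := by
  unfold code con
  rw [Nat.mul_add_mod', Nat.mod_eq_of_lt hC]

theorem nom_code (hC : C < P.W) (hN : N ≤ P.D) : P.nom (P.code ℓ i N C) = N := by
  unfold nom
  rw [code_div hC, Nat.mul_add_mod', Nat.mod_eq_of_lt (by omega)]

theorem code_div_div (hC : C < P.W) (hN : N ≤ P.D) :
    P.code ℓ i N C / P.W / (P.D + 1) = ℓ * (P.n + 1) + i := by
  rw [code_div hC, mul_comm, Nat.mul_add_div (by omega), Nat.div_eq_of_lt (by omega), add_zero]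

theorem agt_code (hC : C < P.W) (hN : N ≤ P.D) (hi : i ≤ P.n) :
    P.agt (P.code ℓ i N C) = i := by
  unfold agt
  rw [code_div_div hC hN, Nat.mul_add_mod', Nat.mod_eq_of_lt (by omega)]

theorem lev_code (hC : C < P.W) (hN : N ≤ P.D) (hi : i ≤ P.n) :
    P.lev (P.code ℓ i N C) = ℓ := by
  unfold lev
  rw [code_div_div hC hN, mul_comm, Nat.mul_add_div (by omega), Nat.div_eq_of_lt (by omega),
    add_zero]

theorem code_lt (hC : C < P.W) (hN : N ≤ P.D) (hi : i ≤ P.n) (hℓ : ℓ < P.L) :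
    P.code ℓ i N C < P.NS := by
  unfold code NS
  have h1 : ℓ * (P.n + 1) + i + 1 ≤ P.L * (P.n + 1) := by nlinarith
  have h2 : (ℓ * (P.n + 1) + i) * (P.D + 1) + N + 1 ≤ P.L * (P.n + 1) * (P.D + 1) := by nlinarith
  nlinarith

theorem exists_code (P : Data) (s : ℕ) :
    s = P.code (P.lev s) (P.agt s) (P.nom s) (P.con s) ∧ P.con s < P.W ∧ P.nom s ≤ P.D ∧
      P.agt s ≤ P.n := by
  refine ⟨?_, Nat.mod_lt _ W_pos, Nat.lt_succ_iff.1 (Nat.mod_lt _ (by omega)),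
    Nat.lt_succ_iff.1 (Nat.mod_lt _ (by omega))⟩
  unfold code lev agt nom con
  rw [mul_comm _ (P.n + 1), Nat.div_add_mod, mul_comm _ (P.D + 1), Nat.div_add_mod, mul_comm,
    Nat.div_add_mod]

end Code

/-- Codes are ordered lexicographically by level, agent, nominal load and vector, and every move
raises one of the first three. Taking an item of class `mv` adds `mv * W` and removes only `B ^ mv <
W`. So the table can be filled backwards, and following moves terminates. -/
theorem lt_next {s mv : ℕ} (hmv : mv ≠ 0) (hD : mv < P.D) : s < P.next s mv := by
  obtain ⟨h1, h2, h3, h4⟩ := P.exists_code s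
  unfold next
  split_ifs with h5 h6
  · conv_lhs => rw [h1]
    unfold code
    have : (P.lev s * (P.n + 1) + P.agt s) * (P.D + 1) + P.nom s + 1 ≤
      (P.lev s * (P.n + 1) + (P.agt s + 1)) * (P.D + 1) + 0 := by nlinarith
    nlinarith
  · conv_lhs => rw [h1]
    unfold code
    have : (P.lev s * (P.n + 1) + P.agt s) * (P.D + 1) + P.nom s + 1 ≤
      ((P.lev s + 1) * (P.n + 1) + P.agt s) * (P.D + 1) + 0 := by nlinarith
    nlinarith
  · have h7 : P.B ^ mv < P.W := Nat.pow_lt_pow_right (by unfold B; omega) hD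
    have h8 : P.W ≤ mv * P.W := Nat.le_mul_of_pos_left _ (by omega)
    omega

section Table

variable {A : ℕ → ℕ} (hA : P.IsTable A)
include hA

theorem le_val {s mv : ℕ} (hs : s < P.NS) (h : P.Legal s mv) (h0 : mv ≠ 0) (hD : mv < P.D)
    (hpos : 0 < A (P.next s mv) / P.D) :
    A (P.next s mv) / P.D + P.gainAt s mv ≤ A s / P.D := by
  have h1 : P.entry A s mv ≤ A s := by
    rw [hA.1 s hs]
    exact Finset.le_sup (f := P.entry A s) (Finset.mem_range.2 hD)
  have hD' : 0 < P.D := by omega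
  have h2 : P.D ≤ A (P.next s mv) := (Nat.div_pos_iff.1 hpos).2
  rw [entry, if_pos h, if_neg h0, if_pos h2] at h1
  rw [Nat.le_div_iff_mul_le hD']
  omega

/-- A finished path has value 1 rather than 0, so that value 0 can mean that no path reaches the
end. -/
theorem one_le_val {s : ℕ} (hs : s < P.NS) (h : P.agt s = P.n) (hD : 0 < P.D) :
    1 ≤ A s / P.D := by
  have h1 : P.entry A s 0 ≤ A s := by
    rw [hA.1 s hs]
    exact Finset.le_sup (f := P.entry A s) (Finset.mem_range.2 hD)
  rw [entry, if_pos (by simpa [Legal] using h), if_pos rfl] at h1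
  exact (Nat.one_le_div_iff hD).2 h1

/-- An entry is `value * D + move` with `move < D`, so the maximum of the entries maximises the
value, and quotient and remainder recover both parts. -/
theorem move_spec {s : ℕ} (hs : A s ≠ 0) :
    s < P.NS ∧ A s % P.D < P.D ∧ P.Legal s (A s % P.D) ∧
      (A s % P.D = 0 → A s / P.D = 1) ∧
      (A s % P.D ≠ 0 → 0 < A (P.next s (A s % P.D)) / P.D ∧
        A s / P.D = A (P.next s (A s % P.D)) / P.D + P.gainAt s (A s % P.D)) := by
  have hlt : s < P.NS := by
    by_contra h
    exact hs (hA.2 s (by omega))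
  have hD : 0 < P.D := by
    by_contra h
    apply hs
    rw [hA.1 s hlt]
    simp [show P.D = 0 by omega]
  obtain ⟨mv, h1, h2⟩ := Finset.exists_mem_eq_sup (Finset.range P.D) ⟨0, by simpa using hD⟩
    (P.entry A s)
  rw [Finset.mem_range] at h1
  rw [← hA.1 s hlt] at h2
  unfold entry at h2
  split_ifs at h2 with h3 h4 h5
  · have h6 : A s % P.D = 0 := by rw [h2, Nat.mod_self]
    rw [h6]
    exact ⟨hlt, hD, h4 ▸ h3, fun _ => by rw [h2, Nat.div_self hD], fun h => absurd rfl h⟩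
  · have h6 : A s % P.D = mv := by rw [h2, Nat.mul_add_mod', Nat.mod_eq_of_lt h1]
    have h7 : A s / P.D = A (P.next s mv) / P.D + P.gainAt s mv := by
      rw [h2, mul_comm, Nat.mul_add_div hD, Nat.div_eq_of_lt h1, add_zero]
    rw [h6]
    exact ⟨hlt, h1, h3, fun h => absurd h h4, fun _ => ⟨Nat.div_pos h5 hD, h7⟩⟩
  · exact absurd h2 hs
  · exact absurd h2 hs

end Table

end Data
end NashWelfare

/-! ### Size classes, the invariant `Room`, and lower bounds on table values along moves. -/

namespace NashWelfare
namespace Data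

variable {P : Data}

theorem cls_succ (ℓ j : ℕ) : P.cls (ℓ + 1) j = P.cls ℓ j / 2 := by
  unfold cls
  rw [pow_succ, Nat.div_div_eq_div_mul]

theorem cls_mul_le (ℓ j : ℕ) : P.cls ℓ j * 2 ^ ℓ ≤ P.b j := Nat.div_mul_le_self _ _

theorem lt_cls_succ_mul (ℓ j : ℕ) : P.b j < (P.cls ℓ j + 1) * 2 ^ ℓ :=
  Nat.lt_mul_of_div_lt (Nat.lt_succ_self _) (by positivity)

/-- A sum over the goods with classes in an interval, class by class. -/
theorem sum_cls_range (S : Finset ℕ) (ℓ a e : ℕ) (f : ℕ → ℕ) :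
    ∑ j ∈ S with (a ≤ P.cls ℓ j ∧ P.cls ℓ j < a + e), f j =
      ∑ d ∈ Finset.range e, ∑ j ∈ S with P.cls ℓ j = a + d, f j := by
  rw [← Finset.sum_fiberwise_of_maps_to (s := S.filter _) (t := Finset.range e)
    (g := fun j => P.cls ℓ j - a)]
  · refine Finset.sum_congr rfl fun d hd => Finset.sum_congr ?_ fun _ _ => rfl
    rw [Finset.mem_range] at hd
    ext j
    simp only [Finset.mem_filter]
    constructor
    · rintro ⟨⟨h1, h2⟩, h3⟩
      exact ⟨h1, by omega⟩
    · rintro ⟨h1, h2⟩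
      exact ⟨⟨h1, by omega⟩, by omega⟩
  · intro j hj
    simp only [Finset.mem_filter] at hj
    rw [Finset.mem_range]
    omega

/-- The small goods at level `ℓ + 1` are those of the lower classes at level `ℓ`. -/
theorem sum_cls_succ_le (S : Finset ℕ) (ℓ : ℕ) :
    ∑ j ∈ S with P.cls (ℓ + 1) j ≤ P.k, P.b j = ∑ j ∈ S with P.cls ℓ j ≤ P.k, P.b j +
      ∑ d ∈ Finset.range (P.k + 1), ∑ j ∈ S with P.cls ℓ j = P.k + 1 + d, P.b j := by
  rw [← sum_cls_range, ← Finset.sum_union]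
  · refine Finset.sum_congr ?_ fun _ _ => rfl
    ext j
    simp only [Finset.mem_filter, Finset.mem_union, cls_succ]
    have : P.cls ℓ j / 2 ≤ P.k ↔ P.cls ℓ j ≤ P.k ∨
        (P.k + 1 ≤ P.cls ℓ j ∧ P.cls ℓ j < P.k + 1 + (P.k + 1)) := by omega
    tauto
  · rw [Finset.disjoint_filter]
    intro j _ h1 h2
    omega

/-- The digits `g` at level `ℓ` leave room for the goods of `S`. -/
def Room (P : Data) (S : Finset ℕ) (ℓ : ℕ) (g : ℕ → ℕ) : Prop :=
  (∀ c, P.k < c → c < P.D → (S.filter fun j => P.cls ℓ j = c).card ≤ g c) ∧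
    (P.k - 1) * ∑ j ∈ S with P.cls ℓ j ≤ P.k, P.b j ≤ (g P.k * P.k + 2 * P.k) * 2 ^ ℓ * P.k

/-- Rounding a size down to its class loses a factor of at most `1 - 1/k`: `(k-1)(c+1) ≤ ck` amounts
to `k ≤ c + 1`. -/
theorem mul_sum_le_of_cls_eq {S : Finset ℕ} {ℓ c : ℕ} (hc : P.k ≤ c + 1) :
    (P.k - 1) * ∑ j ∈ S with P.cls ℓ j = c, P.b j ≤
      c * (S.filter fun j => P.cls ℓ j = c).card * 2 ^ ℓ * P.k := by
  rw [Finset.mul_sum]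
  have h : ∀ j ∈ S.filter (fun j => P.cls ℓ j = c), (P.k - 1) * P.b j ≤ c * 2 ^ ℓ * P.k := by
    intro j hj
    rw [Finset.mem_filter] at hj
    have h1 := (lt_cls_succ_mul (P := P) ℓ j).le
    rw [hj.2] at h1
    have h2 : (P.k - 1) * (c + 1) ≤ c * P.k := by
      rcases Nat.eq_zero_or_pos P.k with h | h
      · simp [h]
      · obtain ⟨k', hk'⟩ := Nat.exists_eq_add_of_le' h
        rw [hk'] at hc ⊢
        simp only [Nat.add_sub_cancel]
        nlinarith
    calc (P.k - 1) * P.b j ≤ (P.k - 1) * ((c + 1) * 2 ^ ℓ) := Nat.mul_le_mul_left _ h1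
      _ = (P.k - 1) * (c + 1) * 2 ^ ℓ := by ring
      _ ≤ c * P.k * 2 ^ ℓ := Nat.mul_le_mul_right _ h2
      _ = c * 2 ^ ℓ * P.k := by ring
  refine (Finset.sum_le_card_nsmul _ _ _ h).trans_eq ?_
  rw [smul_eq_mul]
  ring

theorem up_lt (g : ℕ → ℕ) (ℓ c : ℕ) : P.up g ℓ c < P.B := by
  unfold up
  have := P.B_pos
  omega

theorem up_congr {g g' : ℕ → ℕ} (h : ∀ c < P.D, g c = g' c) (hk : 8 ≤ P.k) (ℓ c : ℕ) :
    P.up g ℓ c = P.up g' ℓ c := by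
  unfold up
  congr 1
  split_ifs with h1 h2 h3
  · rfl
  · congr 1
    refine Finset.sum_congr rfl fun d hd => ?_
    rw [Finset.mem_range] at hd
    rw [h _ (by unfold D; nlinarith)]
  · rw [h _ (by unfold D; omega), h _ (by unfold D; omega)]
  · rfl

/-- Class `c` at level `ℓ + 1` is the union of classes `2c` and `2c + 1` at level `ℓ`, so counts of
middle classes add up, and classes from `k²` on become visible for the first time. Small goods are
undervalued by `1 - 1/k` only once, when they pass from an exact class into chunks; the additive
slack of two chunks survives because the unit doubles from level to level. -/
theorem Room.up {S : Finset ℕ} (hS : S ⊆ Finset.range P.m) {ℓ : ℕ} {g : ℕ → ℕ} (hk : 8 ≤ P.k)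
    (h : P.Room S ℓ g) : P.Room S (ℓ + 1) (P.up g ℓ) := by
  have hSm : S.card ≤ P.m := by simpa using Finset.card_le_card hS
  have hB : P.B - 1 = 2 * P.m + 1 := rfl
  refine ⟨fun c hc hcD => ?_, ?_⟩
  · have h1 : (S.filter fun j => P.cls (ℓ + 1) j = c).card ≤ P.m :=
      (Finset.card_filter_le _ _).trans hSm
    unfold Data.up
    rw [le_min_iff, if_neg (by omega), if_neg (by omega)]
    refine ⟨by omega, ?_⟩
    split_ifs with h2
    · have h3 := h.1 (2 * c) (by omega) (by unfold D; omega)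
      have h4 := h.1 (2 * c + 1) (by omega) (by unfold D; omega)
      refine le_trans ?_ (add_le_add h3 h4)
      refine le_trans (Finset.card_le_card ?_) (Finset.card_union_le _ _)
      intro j hj
      simp only [Finset.mem_filter, Finset.mem_union, cls_succ] at hj ⊢
      have : P.cls ℓ j = 2 * c ∨ P.cls ℓ j = 2 * c + 1 := by omega
      tauto
    · exact Finset.card_le_card (Finset.filter_subset_filter _ hS)
  -- The cap `B - 1 = 2m + 1` on the digit is harmless: at most `m` small goods of size below `(k+1)
  -- 2^(ℓ+1)` exist, and `(k-1)(k+1) ≤ k²`.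
  · have hbig : (P.k - 1) * ∑ j ∈ S with P.cls (ℓ + 1) j ≤ P.k, P.b j ≤
        ((2 * P.m + 1) * P.k + 2 * P.k) * 2 ^ (ℓ + 1) * P.k := by
      have h1 : ∑ j ∈ S with P.cls (ℓ + 1) j ≤ P.k, P.b j ≤ P.m * ((P.k + 1) * 2 ^ (ℓ + 1)) := by
        have h2 : ∀ j ∈ S.filter (fun j => P.cls (ℓ + 1) j ≤ P.k),
            P.b j ≤ (P.k + 1) * 2 ^ (ℓ + 1) := by
          intro j hj
          rw [Finset.mem_filter] at hj
          refine (lt_cls_succ_mul (P := P) (ℓ + 1) j).le.trans (Nat.mul_le_mul_right _ ?_)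
          omega
        refine (Finset.sum_le_card_nsmul _ _ _ h2).trans ?_
        rw [smul_eq_mul]
        exact Nat.mul_le_mul_right _ ((Finset.card_filter_le _ _).trans hSm)
      obtain ⟨k', hk'⟩ := Nat.exists_eq_add_of_le' (show 1 ≤ P.k by omega)
      calc _ ≤ (P.k - 1) * (P.m * ((P.k + 1) * 2 ^ (ℓ + 1))) := Nat.mul_le_mul_left _ h1
        _ = ((P.k - 1) * (P.k + 1)) * P.m * 2 ^ (ℓ + 1) := by ring
        _ ≤ (P.k * P.k) * P.m * 2 ^ (ℓ + 1) := by
          gcongr ?_ * _ * _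
          rw [hk', Nat.add_sub_cancel]
          nlinarith
        _ = (P.m * P.k) * 2 ^ (ℓ + 1) * P.k := by ring
        _ ≤ _ := by
          gcongr ?_ * _ * _
          nlinarith
    unfold Data.up
    rw [if_neg (lt_irrefl _), if_pos rfl, hB]
    rcases min_choice (2 * P.m + 1)
      ((∑ d ∈ Finset.range (P.k + 2), (P.k + d) * g (P.k + d)) / (2 * P.k)) with hm | hm
    · rw [hm]; exact hbig
    rw [hm]
    clear hbig hm
    set T := ∑ d ∈ Finset.range (P.k + 2), (P.k + d) * g (P.k + d) with hT
    have hT1 : T = P.k * g P.k + ∑ d ∈ Finset.range (P.k + 1), (P.k + 1 + d) * g (P.k + 1 + d) := by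
      rw [hT, Finset.sum_range_succ', add_comm]
      congr 1
      refine Finset.sum_congr rfl fun d _ => ?_
      rw [show P.k + (d + 1) = P.k + 1 + d by ring]
    have hsplit : ∑ j ∈ S with P.cls (ℓ + 1) j ≤ P.k, P.b j =
        ∑ j ∈ S with P.cls ℓ j ≤ P.k, P.b j +
          ∑ d ∈ Finset.range (P.k + 1), ∑ j ∈ S with P.cls ℓ j = P.k + 1 + d, P.b j :=
      sum_cls_succ_le S ℓ
    have hcls : (P.k - 1) *
        ∑ d ∈ Finset.range (P.k + 1), ∑ j ∈ S with P.cls ℓ j = P.k + 1 + d, P.b j ≤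
          (∑ d ∈ Finset.range (P.k + 1), (P.k + 1 + d) * g (P.k + 1 + d)) * 2 ^ ℓ * P.k := by
      rw [Finset.mul_sum, Finset.sum_mul, Finset.sum_mul]
      refine Finset.sum_le_sum fun d hd => ?_
      rw [Finset.mem_range] at hd
      refine (mul_sum_le_of_cls_eq (by omega)).trans ?_
      gcongr
      exact h.1 _ (by omega) (by unfold D; nlinarith)
    have h2 := h.2
    -- The floor loses less than `2k` units of `2^ℓ`. With the old slack of `2k` units this is `4k`
    -- units of `2^ℓ`, exactly the slack `2k` in units of `2^(ℓ+1)`.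
    have hdiv : T + 1 ≤ 2 * P.k * (T / (2 * P.k)) + 2 * P.k := by
      have := Nat.div_add_mod T (2 * P.k)
      have := Nat.mod_lt T (show 2 * P.k > 0 by omega)
      omega
    rw [hsplit, mul_add]
    calc _ ≤ (g P.k * P.k + 2 * P.k) * 2 ^ ℓ * P.k +
          (∑ d ∈ Finset.range (P.k + 1), (P.k + 1 + d) * g (P.k + 1 + d)) * 2 ^ ℓ * P.k :=
          add_le_add h2 hcls
      _ = (T + 2 * P.k) * (2 ^ ℓ * P.k) := by rw [hT1]; ring
      _ ≤ (2 * P.k * (T / (2 * P.k)) + 2 * P.k + 2 * P.k) * (2 ^ ℓ * P.k) := by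
          gcongr; omega
      _ = _ := by rw [pow_succ]; ring

theorem sum_sub_single (f t : ℕ → ℕ) {c d : ℕ} (hc : c < d) (ht : 1 ≤ t c) :
    ∑ e ∈ Finset.range d, f e * t e =
      ∑ e ∈ Finset.range d, f e * (t e - if e = c then 1 else 0) + f c := by
  have h : ∑ e ∈ Finset.range d, f e * (if e = c then 1 else 0) = f c := by
    simp [hc]
  rw [← h, ← Finset.sum_add_distrib]
  refine Finset.sum_congr rfl fun e _ => ?_
  rw [← mul_add]
  congr 1
  split_ifs with h1
  · rw [h1]; omega
  · omega

theorem encode_sub_single {g : ℕ → ℕ} {c : ℕ} (hc : c < P.D) (hg : 1 ≤ g c) :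
    P.encode g = P.encode (fun d => g d - if d = c then 1 else 0) + P.B ^ c := by
  unfold encode
  simp_rw [mul_comm _ (P.B ^ _)]
  exact sum_sub_single _ _ hc hg

theorem encode_congr {g g' : ℕ → ℕ} (h : ∀ c < P.D, g c = g' c) : P.encode g = P.encode g' :=
  Finset.sum_congr rfl fun c hc => by rw [h c (Finset.mem_range.1 hc)]

/-- Since digit `c` is positive, subtracting `B ^ c` lowers it by one without a borrow. -/
theorem next_take {ℓ i N c : ℕ} {g : ℕ → ℕ} (hk : 8 ≤ P.k) (hc : P.k ≤ c) (hcD : c < P.D) (hgc : 1 ≤ g c) :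
    P.next (P.code ℓ i N (P.encode g)) c =
      P.code ℓ i (N + c) (P.encode fun d => g d - if d = c then 1 else 0) := by
  unfold next
  rw [if_neg (by omega), if_neg (by omega), encode_sub_single hcD hgc]
  unfold code
  generalize P.encode _ = E
  rw [show ((ℓ * (P.n + 1) + i) * (P.D + 1) + N) * P.W + (E + P.B ^ c) + c * P.W =
    (((ℓ * (P.n + 1) + i) * (P.D + 1) + (N + c)) * P.W + E) + P.B ^ c by ring, Nat.add_sub_cancel]

section Path

variable {A : ℕ → ℕ} (hA : P.IsTable A) (hk : 8 ≤ P.k)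
include hA hk

theorem val_take {ℓ i N : ℕ} {g : ℕ → ℕ} (hℓ : ℓ < P.L) (hi : i < P.n) (hg : ∀ c, g c < P.B)
    {c : ℕ} (hc : P.k ≤ c) (hcD : c < P.D) (hgc : 1 ≤ g c) (hN : N + c ≤ P.D) :
    A (P.code ℓ i (N + c) (P.encode fun d => g d - if d = c then 1 else 0)) / P.D ≤
      A (P.code ℓ i N (P.encode g)) / P.D := by
  rcases Nat.eq_zero_or_pos
    (A (P.code ℓ i (N + c) (P.encode fun d => g d - if d = c then 1 else 0)) / P.D) with h | h
  · rw [h]; exact Nat.zero_le _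
  have hE := encode_lt hg
  rw [← next_take hk hc hcD hgc] at h ⊢
  refine le_trans (Nat.le_add_right _ _)
    (le_val hA (code_lt hE (by omega) hi.le hℓ) ?_ (by omega) hcD h)
  unfold Legal
  rw [if_neg (by omega), if_neg (by omega), if_neg (by omega), con_code hE, digit_encode hg hcD,
    nom_code hE (by omega), agt_code hE (by omega) hi.le]
  exact ⟨hc, hgc, hN, hi⟩

/-- Taking many items. -/
theorem val_take_many {ℓ i : ℕ} (hℓ : ℓ < P.L) (hi : i < P.n) (t : ℕ → ℕ) (ht : ∀ c < P.k, t c = 0) :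
    ∀ (g : ℕ → ℕ) (N : ℕ), (∀ c, g c < P.B) → (∀ c < P.D, t c ≤ g c) →
    N + ∑ c ∈ Finset.range P.D, c * t c ≤ P.D →
    A (P.code ℓ i (N + ∑ c ∈ Finset.range P.D, c * t c) (P.encode fun c => g c - t c)) / P.D ≤
      A (P.code ℓ i N (P.encode g)) / P.D := by
  induction hs : ∑ c ∈ Finset.range P.D, t c generalizing t with
  | zero =>
    intro g N _ _ _
    have h0 : ∀ c < P.D, t c = 0 := by
      simpa [Finset.sum_eq_zero_iff] using hs
    rw [Finset.sum_eq_zero (fun c hc => by rw [h0 c (Finset.mem_range.1 hc), mul_zero]), add_zero,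
      encode_congr (g' := g) fun c hc => by simp [h0 c hc]]
  | succ S ih =>
    intro g N hg htg hN
    obtain ⟨c, hc, htc⟩ : ∃ c < P.D, 1 ≤ t c := by
      by_contra! h
      rw [Finset.sum_eq_zero (fun c hc => by
        have := h c (Finset.mem_range.1 hc)
        omega)] at hs
      omega
    have hkc : P.k ≤ c := by
      by_contra h
      have := ht c (by omega)
      omega
    have e1 := sum_sub_single (fun _ => 1) t hc htc
    have e2 := sum_sub_single (fun d => d) t hc htc
    simp only [one_mul] at e1
    rw [e2] at hN
    refine le_trans ?_ (val_take hA hk hℓ hi hg hkc hc (htc.trans (htg c hc)) (by omega))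
    have := ih (fun d => t d - if d = c then 1 else 0) (fun d hd => by rw [ht d hd]; simp)
      (by omega) (fun d => g d - if d = c then 1 else 0) (N + c)
      (fun d => (Nat.sub_le _ _).trans_lt (hg d))
      (fun d hd => Nat.sub_le_sub_right (htg d hd) _) (by omega)
    refine le_trans (le_of_eq ?_) this
    rw [e2, show ∀ a, N + (a + c) = N + c + a by intro a; ring]
    congr 3
    refine encode_congr fun d hd => ?_
    have := htg d hd
    split_ifs with h1
    · subst h1; omega
    · omega

theorem val_serve {ℓ i N C : ℕ} (hℓ : ℓ < P.L) (hi : i < P.n) (hC : C < P.W) (hN : N ≤ P.D)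
    (hN' : P.k ^ 2 ≤ 2 * N) (hpos : 0 < A (P.code ℓ (i + 1) 0 C) / P.D) :
    A (P.code ℓ (i + 1) 0 C) / P.D + P.gain ℓ i N ≤ A (P.code ℓ i N C) / P.D := by
  have h1 : P.next (P.code ℓ i N C) 1 = P.code ℓ (i + 1) 0 C := by
    unfold next
    rw [if_pos rfl, lev_code hC hN hi.le, agt_code hC hN hi.le, con_code hC]
  have h2 : P.gainAt (P.code ℓ i N C) 1 = P.gain ℓ i N := by
    unfold gainAt
    rw [if_pos rfl, lev_code hC hN hi.le, agt_code hC hN hi.le, nom_code hC hN]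
  rw [← h1, ← h2]
  rw [← h1] at hpos
  refine le_val hA (code_lt hC hN hi.le hℓ) ?_ one_ne_zero (by unfold D; nlinarith) hpos
  unfold Legal
  rw [if_neg one_ne_zero, if_pos rfl, agt_code hC hN hi.le, nom_code hC hN]
  exact ⟨hi, hN'⟩

theorem val_up {ℓ i : ℕ} {g : ℕ → ℕ} (hℓ : ℓ + 1 < P.L) (hi : i ≤ P.n) (hg : ∀ c, g c < P.B) :
    A (P.code (ℓ + 1) i 0 (P.encode (P.up g ℓ))) / P.D ≤ A (P.code ℓ i 0 (P.encode g)) / P.D := by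
  rcases Nat.eq_zero_or_pos (A (P.code (ℓ + 1) i 0 (P.encode (P.up g ℓ))) / P.D) with h | h
  · rw [h]; exact Nat.zero_le _
  have hE := encode_lt hg
  have h1 : P.next (P.code ℓ i 0 (P.encode g)) 2 = P.code (ℓ + 1) i 0 (P.encode (P.up g ℓ)) := by
    unfold next
    rw [if_neg (by norm_num), if_pos rfl, lev_code hE (Nat.zero_le _) hi,
      agt_code hE (Nat.zero_le _) hi, con_code hE,
      encode_congr (fun c _ => up_congr (fun d hd => digit_encode hg hd) hk ℓ c)]
  rw [← h1] at h ⊢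
  refine le_trans (Nat.le_add_right _ _)
    (le_val hA (code_lt hE (Nat.zero_le _) hi (by omega)) ?_ two_ne_zero (by unfold D; nlinarith) h)
  unfold Legal
  rw [if_neg (by norm_num), if_neg (by norm_num), if_pos rfl, lev_code hE (Nat.zero_le _) hi]
  exact hℓ

end Path

end Data
end NashWelfare

/-! ### The path in the table that follows a given allocation with increasing loads. -/

namespace NashWelfare
namespace Data

variable {P : Data}

/-- The goods that `y` gives to agents from `i` on. -/
def late (P : Data) (y : ℕ → ℕ) (i : ℕ) : Finset ℕ := (Finset.range P.m).filter fun j => i ≤ y j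

/-- The goods that `y` gives to agent `i`. -/
def share (P : Data) (y : ℕ → ℕ) (i : ℕ) : Finset ℕ := (Finset.range P.m).filter fun j => y j = i

/-- The total size of the goods that `y` gives to agent `i`. -/
def load (P : Data) (y : ℕ → ℕ) (i : ℕ) : ℕ := ∑ j ∈ P.share y i, P.b j

/-- The number of chunks that stand for the small goods of agent `i`. -/
def chunks (P : Data) (y : ℕ → ℕ) (ℓ i : ℕ) : ℕ :=
  (P.k - 1) * (∑ j ∈ P.share y i with P.cls ℓ j ≤ P.k, P.b j) / (P.k * P.k * 2 ^ ℓ) - 2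

/-- The numbers of items of every class that stand for the goods of agent `i`. -/
def items (P : Data) (y : ℕ → ℕ) (ℓ i c : ℕ) : ℕ :=
  if c < P.k then 0 else if c = P.k then P.chunks y ℓ i
  else ((P.share y i).filter fun j => P.cls ℓ j = c).card

/-- The nominal load of agent `i`. -/
def nominal (P : Data) (y : ℕ → ℕ) (ℓ i : ℕ) : ℕ :=
  ∑ c ∈ Finset.range P.D, c * P.items y ℓ i c

theorem sum_late (y : ℕ → ℕ) (i : ℕ) (p : ℕ → Prop) [DecidablePred p] (f : ℕ → ℕ) :
    ∑ j ∈ P.late y i with p j, f j =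
      ∑ j ∈ P.late y (i + 1) with p j, f j + ∑ j ∈ P.share y i with p j, f j := by
  rw [← Finset.sum_union]
  · refine Finset.sum_congr ?_ fun _ _ => rfl
    ext j
    simp only [late, share, Finset.mem_filter, Finset.mem_union]
    have : i ≤ y j ↔ i + 1 ≤ y j ∨ y j = i := by omega
    tauto
  · rw [Finset.disjoint_left]
    intro j h1 h2
    simp only [late, share, Finset.mem_filter] at h1 h2
    omega

theorem card_late (y : ℕ → ℕ) (i : ℕ) (p : ℕ → Prop) [DecidablePred p] :
    ((P.late y i).filter p).card =
      ((P.late y (i + 1)).filter p).card + ((P.share y i).filter p).card := by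
  simp only [Finset.card_eq_sum_ones]
  exact sum_late y i p _

theorem nominal_eq (hk : 8 ≤ P.k) (y : ℕ → ℕ) (ℓ i : ℕ) :
    P.nominal y ℓ i = P.k * P.chunks y ℓ i + ∑ e ∈ Finset.range (P.D - (P.k + 1)),
      (P.k + 1 + e) * ((P.share y i).filter fun j => P.cls ℓ j = P.k + 1 + e).card := by
  have hD : P.D = P.k + 1 + (P.D - (P.k + 1)) := by
    have : P.k + 1 ≤ P.D := by unfold D; nlinarith
    omega
  unfold nominal
  conv_lhs => rw [hD]
  rw [Finset.sum_range_add, Finset.sum_range_succ, Finset.sum_eq_zero, zero_add]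
  · congr 1
    · simp [items]
    · refine Finset.sum_congr rfl fun e _ => ?_
      rw [items, if_neg (by omega), if_neg (by omega)]
  · intro c hc
    rw [Finset.mem_range] at hc
    simp [items, hc]

/-- No good of the agent can exceed the load, so all its goods have class below `D` and are seen at
this level. -/
theorem load_eq (hk : 8 ≤ P.k) {y : ℕ → ℕ} {ℓ i : ℕ} (h : P.load y i < P.D * 2 ^ ℓ) :
    P.load y i = ∑ j ∈ P.share y i with P.cls ℓ j ≤ P.k, P.b j +
      ∑ e ∈ Finset.range (P.D - (P.k + 1)),
        ∑ j ∈ P.share y i with P.cls ℓ j = P.k + 1 + e, P.b j := by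
  have hD : P.k + 1 ≤ P.D := by unfold D; nlinarith
  rw [← sum_cls_range, ← Finset.sum_union]
  · refine Finset.sum_congr ?_ fun _ _ => rfl
    ext j
    simp only [Finset.mem_filter, Finset.mem_union]
    constructor
    · intro hj
      have h1 : P.b j ≤ P.load y i := Finset.single_le_sum (fun _ _ => Nat.zero_le _) hj
      have h2 : P.cls ℓ j < P.D := Nat.div_lt_of_lt_mul (by rw [mul_comm]; omega)
      rcases le_or_gt (P.cls ℓ j) P.k with h3 | h3
      · exact Or.inl ⟨hj, h3⟩
      · exact Or.inr ⟨hj, by omega, by omega⟩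
    · rintro (h | h) <;> exact h.1
  · rw [Finset.disjoint_filter]
    intro j _ h1 h2
    omega

theorem chunks_mul_le (y : ℕ → ℕ) (ℓ i : ℕ) :
    (P.chunks y ℓ i) * (P.k * P.k * 2 ^ ℓ) ≤
      (P.k - 1) * ∑ j ∈ P.share y i with P.cls ℓ j ≤ P.k, P.b j :=
  (Nat.mul_le_mul_right _ (Nat.sub_le _ _)).trans (Nat.div_mul_le_self _ _)

/-- Of the three missing chunks two are subtracted in `chunks` and one is lost by the floor. -/
theorem le_chunks_mul (hk : 8 ≤ P.k) (y : ℕ → ℕ) (ℓ i : ℕ) :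
    (P.k - 1) * ∑ j ∈ P.share y i with P.cls ℓ j ≤ P.k, P.b j ≤
      (P.chunks y ℓ i + 3) * (P.k * P.k * 2 ^ ℓ) := by
  have h : 0 < P.k * P.k * 2 ^ ℓ := by positivity
  have h1 := Nat.lt_mul_of_div_lt (Nat.lt_succ_self
    ((P.k - 1) * (∑ j ∈ P.share y i with P.cls ℓ j ≤ P.k, P.b j) / (P.k * P.k * 2 ^ ℓ))) h
  refine h1.le.trans (Nat.mul_le_mul_right _ ?_)
  unfold chunks
  omega

theorem nominal_mul_le (hk : 8 ≤ P.k) {y : ℕ → ℕ} {ℓ i : ℕ} (h : P.load y i < P.D * 2 ^ ℓ) :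
    P.nominal y ℓ i * 2 ^ ℓ ≤ P.load y i := by
  rw [nominal_eq hk, load_eq hk h, add_mul, Finset.sum_mul]
  refine add_le_add ?_ (Finset.sum_le_sum fun e _ => ?_)
  · have h1 := chunks_mul_le (P := P) y ℓ i
    have h2 : (P.k - 1) * ∑ j ∈ P.share y i with P.cls ℓ j ≤ P.k, P.b j ≤
      P.k * ∑ j ∈ P.share y i with P.cls ℓ j ≤ P.k, P.b j :=
      Nat.mul_le_mul_right _ (Nat.sub_le _ _)
    refine le_of_mul_le_mul_left (le_trans (le_of_eq ?_) (h1.trans h2)) (show 0 < P.k by omega)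
    ring
  · rw [mul_comm (P.k + 1 + e), mul_assoc]
    refine Finset.card_nsmul_le_sum _ _ _ fun j hj => ?_
    rw [Finset.mem_filter] at hj
    rw [← hj.2]
    exact cls_mul_le _ _

/-- Rounding sizes costs a fraction `1/k`. The three missing chunks cost `3k 2^ℓ`, which is at most
`3/k` of a load of at least `k² 2^ℓ`. -/
theorem le_nominal_mul (hk : 8 ≤ P.k) {y : ℕ → ℕ} {ℓ i : ℕ} (h : P.load y i < P.D * 2 ^ ℓ)
    (h' : P.k ^ 2 * 2 ^ ℓ ≤ P.load y i) :
    (P.k - 4) * P.load y i ≤ P.nominal y ℓ i * 2 ^ ℓ * P.k := by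
  have h1 := le_chunks_mul hk y ℓ i
  have h2 : (P.k - 1) * P.load y i ≤ P.nominal y ℓ i * 2 ^ ℓ * P.k + 3 * P.load y i := by
    have h3 : (P.k - 1) * ∑ e ∈ Finset.range (P.D - (P.k + 1)),
        ∑ j ∈ P.share y i with P.cls ℓ j = P.k + 1 + e, P.b j ≤
        (∑ e ∈ Finset.range (P.D - (P.k + 1)),
          (P.k + 1 + e) * ((P.share y i).filter fun j => P.cls ℓ j = P.k + 1 + e).card) *
            2 ^ ℓ * P.k := by
      rw [Finset.mul_sum, Finset.sum_mul, Finset.sum_mul]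
      exact Finset.sum_le_sum fun e _ => mul_sum_le_of_cls_eq (by omega)
    calc _ ≤ P.nominal y ℓ i * 2 ^ ℓ * P.k + 3 * (P.k ^ 2 * 2 ^ ℓ) := by
          rw [load_eq hk h, nominal_eq hk, mul_add]
          nlinarith
      _ ≤ _ := by omega
  obtain ⟨a, ha⟩ := Nat.exists_eq_add_of_le' hk
  rw [ha] at h2 ⊢
  rw [show a + 8 - 4 = a + 4 by omega]
  rw [show a + 8 - 1 = a + 7 by omega] at h2
  nlinarith

/-- This makes serving legal. The loss gives `N ≥ (k-4)k`, and `2(k-4) ≥ k` is where `8 ≤ k` is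
needed. -/
theorem sq_le_nominal (hk : 8 ≤ P.k) {y : ℕ → ℕ} {ℓ i : ℕ} (h : P.load y i < P.D * 2 ^ ℓ)
    (h' : P.k ^ 2 * 2 ^ ℓ ≤ P.load y i) : P.k ^ 2 ≤ 2 * P.nominal y ℓ i := by
  have h1 := le_nominal_mul hk h h'
  have h2 : (P.k - 4) * (P.k ^ 2 * 2 ^ ℓ) ≤ P.nominal y ℓ i * 2 ^ ℓ * P.k :=
    (Nat.mul_le_mul_left _ h').trans h1
  have h3 : (P.k - 4) * P.k ≤ P.nominal y ℓ i := by
    refine Nat.le_of_mul_le_mul_right (c := 2 ^ ℓ * P.k) (le_trans (le_of_eq ?_)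
      (h2.trans_eq ?_)) (by positivity) <;> ring
  obtain ⟨a, ha⟩ := Nat.exists_eq_add_of_le' hk
  rw [ha] at h3 ⊢
  rw [show a + 8 - 4 = a + 4 by omega] at h3
  nlinarith

/-- The two chunks subtracted in `chunks` pay for the slack `2k` in `Room`: when the number of
chunks is positive, the agent's discounted small goods amount to at least two chunks more, and
`Room` bounds that by `g k + 2`. -/
theorem items_le (hk : 8 ≤ P.k) {y : ℕ → ℕ} {ℓ i : ℕ} {g : ℕ → ℕ}
    (hg : P.Room (P.late y i) ℓ g) {c : ℕ} (hc : c < P.D) : P.items y ℓ i c ≤ g c := by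
  unfold items
  split_ifs with h1 h2
  · exact Nat.zero_le _
  · subst h2
    have h3 := (chunks_mul_le (P := P) y ℓ i).trans
      (Nat.mul_le_mul_left _ ((Nat.le_add_left _ _).trans_eq (sum_late y i _ _).symm))
    have h4 := h3.trans hg.2
    rcases Nat.eq_zero_or_pos (P.chunks y ℓ i) with h5 | h5
    · omega
    have h6 : (P.chunks y ℓ i + 2) * (P.k * P.k * 2 ^ ℓ) ≤
        (P.k - 1) * ∑ j ∈ P.share y i with P.cls ℓ j ≤ P.k, P.b j := by
      have : P.chunks y ℓ i + 2 =
          (P.k - 1) * (∑ j ∈ P.share y i with P.cls ℓ j ≤ P.k, P.b j) / (P.k * P.k * 2 ^ ℓ) := by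
        unfold chunks at h5 ⊢
        omega
      rw [this]
      exact Nat.div_mul_le_self _ _
    have h7 := (h6.trans
      (Nat.mul_le_mul_left _ ((Nat.le_add_left _ _).trans_eq (sum_late y i _ _).symm))).trans hg.2
    have h8 : (P.chunks y ℓ i + 2) * (P.k * P.k * 2 ^ ℓ) ≤ (g P.k + 2) * (P.k * P.k * 2 ^ ℓ) :=
      h7.trans_eq (by ring)
    have := Nat.le_of_mul_le_mul_right h8 (by positivity)
    omega
  · refine le_trans ?_ (hg.1 c (by omega) hc)
    rw [card_late]
    omega

theorem Room.serve (hk : 8 ≤ P.k) {y : ℕ → ℕ} {ℓ i : ℕ} {g : ℕ → ℕ}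
    (hg : P.Room (P.late y i) ℓ g) :
    P.Room (P.late y (i + 1)) ℓ (fun c => g c - P.items y ℓ i c) := by
  have hkD : P.k < P.D := by unfold D; nlinarith
  refine ⟨fun c hc hcD => ?_, ?_⟩
  · have h1 := hg.1 c hc hcD
    rw [card_late] at h1
    simp only [items, if_neg (show ¬ c < P.k by omega), if_neg (show ¬ c = P.k by omega)]
    omega
  · have h1 := hg.2
    have h2 := items_le hk hg hkD
    have h3 : P.items y ℓ i P.k = P.chunks y ℓ i := by simp [items]
    have h4 := chunks_mul_le (P := P) y ℓ i
    -- the chunks of agent `i` do not cost more than its small goods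
    rw [sum_late, mul_add] at h1
    simp only
    rw [h3] at h2 ⊢
    obtain ⟨a, ha⟩ := Nat.exists_eq_add_of_le' h2
    rw [ha] at h1 ⊢
    rw [Nat.add_sub_cancel]
    have h5 : ((a + P.chunks y ℓ i) * P.k + 2 * P.k) * 2 ^ ℓ * P.k =
      (a * P.k + 2 * P.k) * 2 ^ ℓ * P.k + P.chunks y ℓ i * (P.k * P.k * 2 ^ ℓ) := by ring
    omega

/-- The value of the table is at least the gain of the path that follows `y`. -/
theorem path_le_val {A : ℕ → ℕ} (hA : P.IsTable A) (hk : 8 ≤ P.k) {y lv : ℕ → ℕ}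
    (hmono : ∀ i i', i ≤ i' → i' < P.n → lv i ≤ lv i') (hL : ∀ i < P.n, lv i < P.L)
    (hlo : ∀ i < P.n, P.k ^ 2 * 2 ^ lv i ≤ P.load y i)
    (hhi : ∀ i < P.n, P.load y i < P.D * 2 ^ lv i) (f : ℕ) :
    ∀ (ℓ i : ℕ) (g : ℕ → ℕ), (P.n - i) + (P.L - ℓ) ≤ f → ℓ < P.L → i ≤ P.n →
      (∀ c, g c < P.B) → (i < P.n → ℓ ≤ lv i) → P.Room (P.late y i) ℓ g →
      1 + ∑ i' ∈ Finset.Ico i P.n, P.gain (lv i') i' (P.nominal y (lv i') i') ≤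
        A (P.code ℓ i 0 (P.encode g)) / P.D := by
  -- `f` bounds the number of agents not yet served plus the number of levels left; each serving or
  -- change of level decreases it.
  induction f with
  | zero => intros; omega
  | succ f ih =>
    intro ℓ i g hf hℓ hi hg hlv hroom
    rcases hi.eq_or_lt with rfl | hin
    · rw [Finset.Ico_self, Finset.sum_empty, add_zero]
      have hE := encode_lt hg
      exact one_le_val hA (code_lt hE (Nat.zero_le _) le_rfl hℓ)
        (agt_code hE (Nat.zero_le _) le_rfl) (D_pos hk)
    -- At the agent's own level its items are taken and it is served; below that level the path goes
    -- up, with nominal load zero.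
    · rcases (hlv hin).eq_or_lt with rfl | hlt
      · have h1 := nominal_mul_le hk (hhi i hin)
        have h2 : P.nominal y (lv i) i ≤ P.D :=
          (Nat.lt_of_mul_lt_mul_right (h1.trans_lt (hhi i hin))).le
        have hg' : ∀ c, g c - P.items y (lv i) i c < P.B := fun c =>
          (Nat.sub_le _ _).trans_lt (hg c)
        have h3 := ih (lv i) (i + 1) (fun c => g c - P.items y (lv i) i c) (by omega) hℓ hin hg'
          (fun h => hmono _ _ (Nat.le_succ i) h) (hroom.serve hk)
        have h4 := val_take_many hA hk hℓ hin (P.items y (lv i) i)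
          (fun c hc => by simp [items, hc]) g 0 hg (fun c hc => items_le hk hroom hc)
          (by rw [zero_add]; exact h2)
        rw [zero_add] at h4
        change A (P.code (lv i) i (P.nominal y (lv i) i) _) / P.D ≤ _ at h4
        have h5 := val_serve hA hk hℓ hin (encode_lt hg') h2 (sq_le_nominal hk (hhi i hin) (hlo i hin))
          (by omega)
        rw [← Finset.insert_Ico_add_one_left_eq_Ico hin, Finset.sum_insert (by simp)]
        omega
      · have h1 := hL i hin
        refine le_trans ?_ (val_up hA hk (by omega) hi hg)
        exact ih (ℓ + 1) i (P.up g ℓ) (by omega) (by omega) hi (up_lt g ℓ) (fun _ => hlt)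
          (hroom.up (Finset.filter_subset _ _) hk)

end Data
end NashWelfare

namespace NashWelfare

/-! ### The expressions of the program

Arrays: `0` input, `1` output, `2` sizes, `3` weights, `4` ranks, `5` agents by rank, `6` powers of
two, `7` class counts, `8` table, `9` marks of assigned goods, `10` powers of the radix.
Scalars: `11` product of denominators, `12`, `13` loop variables, `14` total size, `15` number of
levels, `16` state, `17` move, `18` credit, `19` room, `20` lowest class. -/

namespace Expr

variable (k : ℕ) (S M : Expr)

/-- The number of agents. -/
def nE : Expr := get 0 (lit 0)
/-- The number of goods. -/
def mE : Expr := get 0 (lit 1)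
/-- The radix. -/
def radixE : Expr := lit 2 * mE + lit 2
/-- The number of classes. -/
def classesE : Expr := lit (2 * k ^ 2)
/-- The number of encoded vectors. -/
def widthE : Expr := get 10 (classesE k)
/-- The number of states. -/
def statesE : Expr := var 15 * (nE + lit 1) * lit (2 * k ^ 2 + 1) * widthE k
/-- The level of the state `S`. -/
def levE : Expr := S / widthE k / lit (2 * k ^ 2 + 1) / (nE + lit 1)
/-- The agent of the state `S`. -/
def agtE : Expr := mod (S / widthE k / lit (2 * k ^ 2 + 1)) (nE + lit 1)
/-- The nominal load of the state `S`. -/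
def nomE : Expr := mod (S / widthE k) (lit (2 * k ^ 2 + 1))
/-- The encoded vector of the state `S`. -/
def conE : Expr := mod S (widthE k)
/-- The digit of the state `S` with index `M`. -/
def digitE : Expr := mod (conE k S / get 10 M) radixE
/-- The code of a state. -/
def codeE (ℓ i N C : Expr) : Expr :=
  ((ℓ * (nE + lit 1) + i) * lit (2 * k ^ 2 + 1) + N) * widthE k + C
/-- The digit `c` of the state `S` after going to the next level. -/
def upE (c : ℕ) : Expr :=
  min (radixE - lit 1)
    (if c < k then lit 0
    else if c = k then
      sum ((List.range (k + 2)).map fun d => lit (k + d) * digitE k S (lit (k + d))) / lit (2 * k)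
    else if c < k ^ 2 then digitE k S (lit (2 * c)) + digitE k S (lit (2 * c + 1))
    else get 7 ((levE k S + lit 1) * classesE k + lit c))
/-- The encoded vector after going to the next level. -/
def encodeUpE : Expr :=
  sum ((List.range (2 * k ^ 2)).map fun c => upE k S c * get 10 (lit c))
/-- The gain for serving the agent. -/
def gainE : Expr :=
  get 3 (get 5 (agtE k S)) *
    (lit k * levE k S + lookup (nomE k S) (fun N => Nat.log 2 (N ^ k)) (2 * k ^ 2))
/-- The test whether the move `M` is possible. -/
def legalE : Expr :=
  cond (eq M (lit 0)) (eq (agtE k S) nE)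
    (cond (eq M (lit 1)) (le (agtE k S + lit 1) nE * le (lit (k ^ 2)) (lit 2 * nomE k S))
      (cond (eq M (lit 2)) (le (levE k S + lit 2) (var 15))
        (le (lit k) M * le (lit 1) (digitE k S M) * le (nomE k S + M) (classesE k) *
          le (agtE k S + lit 1) nE)))
/-- The state after the move `M`. -/
def nextE : Expr :=
  cond (eq M (lit 1)) (codeE k (levE k S) (agtE k S + lit 1) (lit 0) (conE k S))
    (cond (eq M (lit 2)) (codeE k (levE k S + lit 1) (agtE k S) (lit 0) (encodeUpE k S))
      (S + M * widthE k - get 10 M))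
/-- The table entry for the state `S` and the move `M`. -/
def entryE : Expr :=
  cond (legalE k S M)
    (cond (eq M (lit 0)) (classesE k)
      (cond (le (classesE k) (get 8 (nextE k S M)))
        ((get 8 (nextE k S M) / classesE k + cond (eq M (lit 1)) (gainE k S) (lit 0)) *
            classesE k + M)
        (lit 0)))
    (lit 0)

end Expr

/-- The state of the machine holds the data `P`. -/
structure Holds (P : Data) (st : State) : Prop where
  n : st 0 0 = P.n
  m : st 0 1 = P.m
  pow : ∀ c ≤ P.D, st 10 c = P.B ^ c
  L : st 15 0 = P.L
  cnt : ∀ ℓ < P.L, ∀ c < P.D, st 7 (ℓ * P.D + c) = P.cnt ℓ c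
  w : ∀ i < P.n, st 3 (st 5 i) = P.w i
  b : ∀ j < P.m, st 2 j = P.b j
  two : ∀ ℓ < P.L, st 6 ℓ = 2 ^ ℓ

namespace Holds

variable {P : Data} {st : State} (h : Holds P st) (S M : Expr)

/-- The listed arrays are exactly those that hold the data; the table, the marks and the working
scalars may change freely. -/
theorem of_agree {A : List ℕ} (h : Holds P st) {st' : State} (h' : State.Agree A st st')
    (hA : ∀ x ∈ [0, 10, 15, 7, 3, 5, 2, 6], x ∉ A) : Holds P st' := by
  simp only [List.forall_mem_cons] at hA
  obtain ⟨h0, h10, h15, h7, h3, h5, h2, h6, _⟩ := hA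
  constructor
  · rw [h' 0 h0, h.n]
  · rw [h' 0 h0, h.m]
  · rw [h' 10 h10]; exact h.pow
  · rw [h' 15 h15, h.L]
  · rw [h' 7 h7]; exact h.cnt
  · rw [h' 3 h3, h' 5 h5]; exact h.w
  · rw [h' 2 h2]; exact h.b
  · rw [h' 6 h6]; exact h.two

include h

theorem eval_radixE : Expr.radixE.eval st = P.B := by
  simp [Expr.radixE, Expr.mE, h.m, Data.B]

theorem eval_widthE : (Expr.widthE P.k).eval st = P.W := by
  simp only [Expr.widthE, Expr.classesE, Expr.eval_get, Expr.eval_lit]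
  exact h.pow _ le_rfl

theorem eval_statesE : (Expr.statesE P.k).eval st = P.NS := by
  simp [Expr.statesE, Expr.nE, h.eval_widthE, h.L, h.n, Data.NS, Data.D]

theorem eval_levE : (Expr.levE P.k S).eval st = P.lev (S.eval st) := by
  simp [Expr.levE, Expr.nE, h.eval_widthE, h.n, Data.lev, Data.D]

theorem eval_agtE : (Expr.agtE P.k S).eval st = P.agt (S.eval st) := by
  simp [Expr.agtE, Expr.nE, h.eval_widthE, h.n, Data.agt, Data.D]

theorem eval_nomE : (Expr.nomE P.k S).eval st = P.nom (S.eval st) := by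
  simp [Expr.nomE, h.eval_widthE, Data.nom, Data.D]

theorem eval_conE : (Expr.conE P.k S).eval st = P.con (S.eval st) := by
  simp [Expr.conE, h.eval_widthE, Data.con]

theorem eval_digitE (hM : M.eval st ≤ P.D) :
    (Expr.digitE P.k S M).eval st = P.digit (P.con (S.eval st)) (M.eval st) := by
  simp [Expr.digitE, h.eval_conE, h.eval_radixE, h.pow _ hM, Data.digit]

theorem eval_codeE (ℓ i N C : Expr) : (Expr.codeE P.k ℓ i N C).eval st =
    P.code (ℓ.eval st) (i.eval st) (N.eval st) (C.eval st) := by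
  simp [Expr.codeE, Expr.nE, h.eval_widthE, h.n, Data.code, Data.D]

theorem eval_upE (hk : 8 ≤ P.k) {c : ℕ} (hc : c < P.D) (hℓ : P.lev (S.eval st) + 1 < P.L) :
    (Expr.upE P.k S c).eval st =
      P.up (P.digit (P.con (S.eval st))) (P.lev (S.eval st)) c := by
  have hD : ∀ d < P.k + 2, P.k + d ≤ P.D := fun d hd => by unfold Data.D; nlinarith
  unfold Expr.upE Data.up
  rw [Expr.eval_min, Expr.eval_sub, h.eval_radixE, Expr.eval_lit]
  congr 1
  split_ifs with h1 h2 h3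
  · rfl
  · rw [Expr.eval_div, Expr.eval_sum_range, Expr.eval_lit]
    congr 1
    refine Finset.sum_congr rfl fun d hd => ?_
    rw [Expr.eval_mul, h.eval_digitE S (.lit (P.k + d)) (hD d (Finset.mem_range.1 hd)),
      Expr.eval_lit]
  · unfold Data.D at hc
    rw [Expr.eval_add, h.eval_digitE S _ (by simp only [Expr.eval_lit, Data.D]; omega),
      h.eval_digitE S _ (by simp only [Expr.eval_lit, Data.D]; omega), Expr.eval_lit, Expr.eval_lit]
  · rw [← h.cnt _ hℓ _ hc]
    simp [Expr.classesE, h.eval_levE, Data.D]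

theorem eval_encodeUpE (hk : 8 ≤ P.k) (hℓ : P.lev (S.eval st) + 1 < P.L) :
    (Expr.encodeUpE P.k S).eval st =
      P.encode (P.up (P.digit (P.con (S.eval st))) (P.lev (S.eval st))) := by
  unfold Expr.encodeUpE Data.encode
  rw [Expr.eval_sum_range]
  refine Finset.sum_congr rfl fun c hc => ?_
  rw [Expr.eval_mul, h.eval_upE S hk (Finset.mem_range.1 hc) hℓ, Expr.eval_get, Expr.eval_lit,
    h.pow _ (Finset.mem_range.1 hc).le]

/-- No logarithm is computed by the machine: `k` is fixed and nominal loads are at most `D`, so the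
values `⌊log₂ N^k⌋` are literals in the program text. -/
theorem eval_gainE (hi : P.agt (S.eval st) < P.n) :
    (Expr.gainE P.k S).eval st =
      P.gain (P.lev (S.eval st)) (P.agt (S.eval st)) (P.nom (S.eval st)) := by
  unfold Expr.gainE Data.gain
  rw [Expr.eval_mul, Expr.eval_add, Expr.eval_lookup]
  · simp [h.eval_agtE, h.eval_levE, h.eval_nomE, h.w _ hi]
  · rw [h.eval_nomE]
    exact (P.exists_code (S.eval st)).2.2.1

theorem eval_legalE (hM : M.eval st < P.D) :
    (Expr.legalE P.k S M).eval st = if P.Legal (S.eval st) (M.eval st) then 1 else 0 := by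
  unfold Expr.legalE Data.Legal
  rw [show Expr.classesE P.k = .lit P.D from rfl, Expr.nE]
  simp only [Expr.eval_cond, Expr.eval_eq, Expr.eval_le, Expr.eval_mul, Expr.eval_add,
    Expr.eval_lit, Expr.eval_var, h.eval_agtE, h.eval_nomE, h.eval_levE,
    h.eval_digitE S M hM.le, Expr.eval_get, h.n, h.L]
  by_cases h0 : M.eval st = 0
  · simp [h0]
  by_cases h1 : M.eval st = 1
  · simp only [h1, one_ne_zero, if_false, if_true]
    split_ifs <;> simp_all
  by_cases h2 : M.eval st = 2
  · simp [h2]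
    rfl
  · simp only [h0, h1, h2, if_false, if_true]
    split_ifs <;> simp_all

/-- Legality matters only for going up: it keeps the next level among those for which class counts
are stored. -/
theorem eval_nextE (hk : 8 ≤ P.k) (hM : M.eval st < P.D)
    (hl : P.Legal (S.eval st) (M.eval st)) :
    (Expr.nextE P.k S M).eval st = P.next (S.eval st) (M.eval st) := by
  unfold Expr.nextE Data.next
  simp only [Expr.eval_cond, Expr.eval_eq, Expr.eval_lit]
  by_cases h1 : M.eval st = 1
  · rw [if_pos h1, if_pos h1, if_neg one_ne_zero, h.eval_codeE, h.eval_levE, Expr.eval_add,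
      h.eval_agtE, h.eval_conE, Expr.eval_lit, Expr.eval_lit]
  by_cases h2 : M.eval st = 2
  · rw [if_neg h1, if_neg h1, if_pos rfl, if_pos h2, if_pos h2, if_neg one_ne_zero, h.eval_codeE,
      Expr.eval_add, h.eval_levE, h.eval_agtE, h.eval_encodeUpE S hk, Expr.eval_lit, Expr.eval_lit]
    unfold Data.Legal at hl
    simpa [h2] using hl
  · simp [h1, h2, h.eval_widthE, h.pow _ hM.le]

theorem eval_entryE (hk : 8 ≤ P.k) (hM : M.eval st < P.D) :
    (Expr.entryE P.k S M).eval st = P.entry (st 8) (S.eval st) (M.eval st) := by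
  unfold Expr.entryE Data.entry
  rw [Expr.eval_cond, h.eval_legalE S M hM]
  by_cases hl : P.Legal (S.eval st) (M.eval st)
  · rw [if_pos hl, if_pos hl, if_neg one_ne_zero]
    by_cases h0 : M.eval st = 0
    · simp [h0, Expr.classesE, Data.D]
    · have hg : (Expr.cond (Expr.eq M (.lit 1)) (Expr.gainE P.k S) (.lit 0)).eval st =
          P.gainAt (S.eval st) (M.eval st) := by
        unfold Data.gainAt
        by_cases h1 : M.eval st = 1
        · have hi : P.agt (S.eval st) < P.n := by
            unfold Data.Legal at hl
            rw [if_neg h0, if_pos h1] at hl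
            exact hl.1
          simp [h1, h.eval_gainE S hi]
        · simp [h1]
      simp only [Expr.eval_cond, Expr.eval_eq, Expr.eval_le, Expr.eval_lit, Expr.eval_get,
        h.eval_nextE S M hk hM hl, Expr.classesE, Expr.eval_add, Expr.eval_mul, Expr.eval_div,
        if_neg h0] at hg ⊢
      rw [hg, show 2 * P.k ^ 2 = P.D from rfl]
      by_cases hD : P.D ≤ st 8 (P.next (S.eval st) (M.eval st)) <;> simp [hD]
  · rw [if_neg hl, if_neg hl, if_pos rfl, Expr.eval_lit]

end Holds
end NashWelfare

/-! ### Preprocessing: integer sizes and weights, levels, class counts, powers and ranks. -/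

namespace NashWelfare

section Phases

open NashWelfare.Expr (lit var eval_lit eval_var eval_get eval_add eval_mul eval_div eval_sub)

/-- Write `c * num / den`, multiplied with the product of all `den`, into the array `out`. -/
def Prog.scale (off cnt : Expr) (c out : ℕ) : Prog :=
  .seq (.set 11 (lit 0) (lit 1))
    (.seq (.count 12 cnt (.set 11 (lit 0) (var 11 * .get 0 (off + lit 2 * var 12 + lit 1))))
      (.count 12 cnt (.set out (var 12) (lit c * .get 0 (off + lit 2 * var 12) *
        (var 11 / .get 0 (off + lit 2 * var 12 + lit 1))))))

theorem update_ite_lt (f g : ℕ → ℕ) (i : ℕ) :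
    Function.update (fun j => if j < i then f j else g j) i (f i) =
      fun j => if j < i + 1 then f j else g j := by
  funext j
  rw [Function.update_apply]
  by_cases h : j = i
  · simp [h]
  · have : j < i + 1 ↔ j < i := by omega
    simp [h, this]

/-- Multiplying by the product of all denominators makes every number an integer without changing
ratios. As denominators are positive, partial products never exceed the full one, so a single bound
covers the first loop. -/
theorem runs_scale {X off₀ N out c : ℕ} {off cnt : Expr} {s : State} {num den : ℕ → ℕ}
    (h0 : out ≠ 0) (h11 : out ≠ 11) (h12 : out ≠ 12)
    (hoff : ∀ s', s' 0 = s 0 → off.eval s' = off₀) (hcnt : ∀ s', s' 0 = s 0 → cnt.eval s' = N)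
    (hnum : ∀ j < N, s 0 (off₀ + 2 * j) = num j) (hden : ∀ j < N, s 0 (off₀ + 2 * j + 1) = den j)
    (hpos : ∀ j < N, 0 < den j) (hN : N < 2 ^ X) (hP : ∏ j ∈ Finset.range N, den j < 2 ^ X)
    (hv : ∀ j < N, c * num j * ((∏ j ∈ Finset.range N, den j) / den j) < 2 ^ X) :
    Runs X (Prog.scale off cnt c out) s (6 * N + 5) (fun s' => State.Agree [11, 12, out] s s' ∧
      s' out = fun j => if j < N then c * num j * ((∏ j ∈ Finset.range N, den j) / den j)
        else s out j) := by
  have hpart : ∀ i ≤ N, ∏ j ∈ Finset.range i, den j < 2 ^ X := fun i hi =>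
    (Finset.prod_le_prod_of_subset_of_one_le' (Finset.range_subset_range.2 hi)
      fun j hj _ => hpos j (Finset.mem_range.1 hj)).trans_lt hP
  refine (Runs.set_seq (T := (N * 3 + 2) + (N * 3 + 2)) (by simpa using hpart 0 (Nat.zero_le _)) ?_).mono
    (by omega) fun _ h => h
  set s₁ := s.write 11 ((lit 0 : Expr).eval s) ((lit 1 : Expr).eval s) with hs₁
  have hs₁' : State.Agree [11, 12, out] s s₁ := (State.Agree.refl _ s).write (by simp) _ _
  refine Runs.seq (R := fun s' => State.Agree [11, 12, out] s s' ∧ s' out = s out ∧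
    s' 11 0 = ∏ j ∈ Finset.range N, den j) ?_ ?_
  · refine (Runs.count_set (v := 12) (s := s₁)
      (fun i => Function.update (s 11) 0 (∏ j ∈ Finset.range i, den j)) (by norm_num)
      (fun s' hs' => hcnt s' ?_) hN ?_ ?_).mono le_rfl ?_
    · rw [hs' 0 (by simp), hs₁' 0 (by simp [h0.symm])]
    · simp [hs₁]
    · intro i s' hi hs' h12' h11'
      have h0' : s' 0 = s 0 := by rw [hs' 0 (by simp), hs₁' 0 (by simp [h0.symm])]
      have he : (var 11 * Expr.get 0 (off + lit 2 * var 12 + lit 1)).eval s' =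
          ∏ j ∈ Finset.range (i + 1), den j := by
        simp only [eval_mul, eval_var, h11', Function.update_self, eval_get, eval_add, hoff s' h0',
          h12', eval_lit, h0', hden i hi]
        rw [Finset.prod_range_succ]
      exact ⟨he ▸ hpart _ hi, by simp [he]⟩
    · rintro s' ⟨h1, h2⟩
      refine ⟨fun x hx => ?_, ?_, ?_⟩
      · simp only [List.mem_cons, not_or] at hx
        rw [h1 x (by simp [hx]), hs₁' x (by simp [hx])]
      · rw [h1 out (by simp [h11, h12]), hs₁, State.write_of_ne h11]
      · rw [h2, Function.update_self]
  · rintro s₂ ⟨h1, h2, h3⟩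
    refine (Runs.count_set (v := 12) (s := s₂)
      (fun i j => if j < i then c * num j * ((∏ j ∈ Finset.range N, den j) / den j) else s out j)
      h12.symm (fun s' hs' => hcnt s' ?_) hN ?_ ?_).mono le_rfl ?_
    · rw [hs' 0 (by simp [h0.symm]), h1 0 (by simp [h0.symm])]
    · simp [h2]
    · intro i s' hi hs' h12' hout'
      have h0' : s' 0 = s 0 := by rw [hs' 0 (by simp [h0.symm]), h1 0 (by simp [h0.symm])]
      have h11' : s' 11 0 = ∏ j ∈ Finset.range N, den j := by
        rw [hs' 11 (by simp [h11.symm]), h3]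
      have he : (lit c * Expr.get 0 (off + lit 2 * var 12) *
          (var 11 / Expr.get 0 (off + lit 2 * var 12 + lit 1))).eval s' =
          c * num i * ((∏ j ∈ Finset.range N, den j) / den i) := by
        simp only [eval_mul, eval_div, eval_var, h11', eval_get, eval_add, hoff s' h0', h12',
          eval_lit, h0', hden i hi, hnum i hi]
      rw [he, eval_var, h12']
      exact ⟨hv i hi, update_ite_lt _ _ _⟩
    · rintro s' ⟨h4, h5⟩
      refine ⟨fun x hx => ?_, h5⟩
      simp only [List.mem_cons, not_or] at hx
      rw [h4 x (by simp [hx]), h1 x (by simp [hx])]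

/-- Add up the sizes. -/
def Prog.total : Prog :=
  .count 12 Expr.mE (.set 14 (lit 0) (var 14 + .get 2 (var 12)))

theorem runs_total {X m : ℕ} {s : State} {b : ℕ → ℕ} (hm : s 0 1 = m) (hb : ∀ j < m, s 2 j = b j)
    (h14 : s 14 0 = 0) (hX : m < 2 ^ X) (hS : ∑ j ∈ Finset.range m, b j < 2 ^ X) :
    Runs X Prog.total s (3 * m + 2) (fun s' => State.Agree [12, 14] s s' ∧
      s' 14 0 = ∑ j ∈ Finset.range m, b j) := by
  refine (Runs.count_set (v := 12) (s := s)
    (fun i => Function.update (s 14) 0 (∑ j ∈ Finset.range i, b j)) (by norm_num)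
    (fun s' hs' => ?_) hX ?_ ?_).mono (by omega) ?_
  · simp [Expr.mE, hs' 0 (by simp), hm]
  · have h := Function.update_eq_self 0 (s 14)
    rw [h14] at h
    exact h.symm
  · intro i s' hi hs' h12 h14'
    have he : (var 14 + .get 2 (var 12) : Expr).eval s' = ∑ j ∈ Finset.range (i + 1), b j := by
      simp [h14', h12, hs' 2 (by simp), hb i hi, Finset.sum_range_succ]
    rw [he]
    refine ⟨(Finset.sum_le_sum_of_subset (Finset.range_subset_range.2 hi)).trans_lt hS, ?_⟩
    simp
  · rintro s' ⟨h1, h2⟩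
    exact ⟨h1.mono (by simp), by simp [h2]⟩

/-- Compute the powers of two up to the total size, and the number of levels. -/
def Prog.levels : Prog :=
  .seq (.set 6 (lit 0) (lit 1))
    (.loop (.le (.get 6 (var 15)) (var 14))
      (.seq (.set 6 (var 15 + lit 1) (lit 2 * .get 6 (var 15))) (.set 15 (lit 0) (var 15 + lit 1))))

/-- The loop stops at the first `ℓ` with `2 ^ ℓ` above the total, which is its `Nat.size`. No bundle
needs a higher level. -/
theorem runs_levels {X : ℕ} {s : State} (h15 : s 15 0 = 0) (hX : 2 ^ Nat.size (s 14 0) < 2 ^ X) :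
    Runs X Prog.levels s (3 * Nat.size (s 14 0) + 2) (fun s' => State.Agree [6, 15] s s' ∧
      s' 15 0 = Nat.size (s 14 0) ∧ ∀ ℓ ≤ Nat.size (s 14 0), s' 6 ℓ = 2 ^ ℓ) := by
  set S := s 14 0 with hS
  have h1 : (1 : ℕ) ≤ 2 ^ Nat.size S := Nat.one_le_two_pow
  refine (Runs.set_seq (T := Nat.size S * 3 + 1) (by rw [eval_lit]; omega) ?_).mono (by omega) fun _ h => h
  set s₁ := s.write 6 ((lit 0 : Expr).eval s) ((lit 1 : Expr).eval s) with hs₁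
  have key := Runs.loop (X := X) (s := s₁) (e := .le (.get 6 (var 15)) (var 14))
    (p := .seq (.set 6 (var 15 + lit 1) (lit 2 * .get 6 (var 15)))
      (.set 15 (lit 0) (var 15 + lit 1))) (T := 2)
    (fun s' => State.Agree [6, 15] s s' ∧ s' 15 0 ≤ Nat.size S ∧ ∀ ℓ ≤ s' 15 0, s' 6 ℓ = 2 ^ ℓ)
    (fun s' => Nat.size S - s' 15 0) ?_ ?_
  · refine key.mono ?_ ?_
    · have : s₁ 15 0 = 0 := by rw [hs₁, State.write_of_ne (by norm_num), h15]
      simp only [this]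
      omega
    · rintro s' ⟨⟨h2, h3, h4⟩, h5⟩
      have h6 : s' 15 0 = Nat.size S := by
        by_contra h
        have := Nat.lt_size.1 (lt_of_le_of_ne h3 h)
        simp [h4 _ le_rfl, h2 14 (by simp)] at h5
        omega
      exact ⟨h2, h6, h6 ▸ h4⟩
  · rintro s' ⟨h2, h3, h4⟩ h5
    simp [h4 _ le_rfl, h2 14 (by simp)] at h5
    have h6 := Nat.lt_size.2 h5
    rw [← hS] at h6
    have h8 : (2 : ℕ) ^ (s' 15 0 + 1) < 2 ^ X :=
      (Nat.pow_le_pow_right (by norm_num) h6).trans_lt hX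
    refine Runs.set_seq ?_ (Runs.set ?_ ⟨⟨?_, ?_, ?_⟩, ?_⟩)
    · simpa [h4 _ le_rfl, pow_succ'] using h8
    · have : s' 15 0 + 1 < 2 ^ (s' 15 0 + 1) := Nat.lt_two_pow_self
      simp only [eval_add, eval_var, State.write_of_ne (show (15 : ℕ) ≠ 6 by norm_num), eval_lit]
      omega
    · exact (h2.write (by simp) _ _).write (by simp) _ _
    · simp [State.write_of_ne]
      omega
    · simp only [State.write_same, eval_add, eval_var, eval_lit, State.write_of_ne, ne_eq,
        Nat.reduceEqDiff, not_false_eq_true, Function.update_self]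
      intro ℓ hℓ
      rw [Function.update_apply]
      split_ifs with h9
      · simp [h4 _ le_rfl, h9, pow_succ']
      · exact h4 ℓ (by omega)
    · simp [State.write_of_ne]
      omega
  · simp only [hs₁]
    refine ⟨(State.Agree.refl _ s).write (by simp) _ _, ?_, ?_⟩
    · simp [State.write_of_ne, h15]
    · simp [State.write_of_ne, h15]

/-- Count the goods of every class at every level. -/
def Prog.counts (k : ℕ) : Prog :=
  .count 13 (var 15 * Expr.classesE k)
    (.count 12 Expr.mE (.set 7 (var 13)
      (.get 7 (var 13) + .eq (.get 2 (var 12) / .get 6 (var 13 / Expr.classesE k))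
        (.mod (var 13) (Expr.classesE k)))))

/-- Levels and classes share one flat index `t = ℓ * D + c`; the cells below `t` are final and the
others still zero. -/
theorem runs_counts {X : ℕ} {P : Data} (hk : 8 ≤ P.k) {s : State} (hm : s 0 1 = P.m)
    (hL : s 15 0 = P.L) (hb : ∀ j < P.m, s 2 j = P.b j) (h2 : ∀ ℓ ≤ P.L, s 6 ℓ = 2 ^ ℓ)
    (h7 : ∀ t, s 7 t = 0) (hX : P.m < 2 ^ X) (hLX : P.L * P.D < 2 ^ X) :
    Runs X (Prog.counts P.k) s (P.L * P.D * (3 * P.m + 4) + 2) (fun s' =>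
      State.Agree [7, 12, 13] s s' ∧
        ∀ ℓ < P.L, ∀ c < P.D, s' 7 (ℓ * P.D + c) = P.cnt ℓ c) := by
  have hD := P.D_pos hk
  have hcl : Expr.classesE P.k = lit P.D := rfl
  have hcnt : ∀ ℓ c d, ((Finset.range d).filter fun j => P.cls ℓ j = c).card =
      ∑ j ∈ Finset.range d, if P.cls ℓ j = c then 1 else 0 := fun ℓ c d => Finset.card_filter _ _
  refine (Runs.count_array (T := 3 * P.m + 2) (v := 13) (a := 7) (s := s) [12, 13]
    (fun t u => if u < t then P.cnt (u / P.D) (u % P.D) else 0) (by norm_num) (by simp)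
    (fun s' hs' => ?_) hLX ?_ ?_).mono le_rfl ?_
  · simp [hcl, hs' 15 (by simp), hL]
  · funext u; simp [h7]
  · intro t s' ht hs' h13 h7'
    have htL : t / P.D < P.L := Nat.div_lt_of_lt_mul (by rw [mul_comm]; exact ht)
    refine (Runs.count_set (v := 12) (s := s')
      (fun i => Function.update (s' 7) t
        (∑ j ∈ Finset.range i, if P.cls (t / P.D) j = t % P.D then 1 else 0)) (by norm_num)
      (fun s'' hs'' => ?_) hX ?_ ?_).mono (by omega) ?_
    · simp [Expr.mE, hs'' 0 (by simp), hs' 0 (by simp), hm]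
    · rw [Finset.range_zero, Finset.sum_empty, h7']
      funext u
      rw [Function.update_apply]
      split_ifs <;> first | rfl | omega
    · intro i s'' hi hs'' h12 h7''
      have h13' : s'' 13 0 = t := by rw [hs'' 13 (by simp), h13]
      have he : (Expr.get 7 (var 13) + .eq (.get 2 (var 12) / .get 6 (var 13 / Expr.classesE P.k))
          (.mod (var 13) (Expr.classesE P.k)) : Expr).eval s'' =
            ∑ j ∈ Finset.range (i + 1), if P.cls (t / P.D) j = t % P.D then 1 else 0 := by
        rw [Finset.sum_range_succ, hcl]
        simp only [eval_add, eval_get, eval_var, h13', h7'', Function.update_self, Expr.eval_eq,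
          eval_div, h12, eval_lit, Expr.eval_mod, hs'' 2 (by simp), hs' 2 (by simp), hb i hi,
          hs'' 6 (by simp), hs' 6 (by simp), h2 _ htL.le]
        rfl
      rw [he, eval_var, h13']
      refine ⟨?_, by simp⟩
      rw [← hcnt]
      refine ((Finset.card_filter_le _ _).trans ?_).trans_lt hX
      rw [Finset.card_range]
      omega
    · rintro s'' ⟨h3, h4⟩
      refine ⟨hs'.trans (h3.mono (by simp)), ?_, ?_⟩
      · rw [h3 13 (by simp), h13]
      · rw [h4, h7', ← hcnt]
        exact update_ite_lt (fun u => P.cnt (u / P.D) (u % P.D)) (fun _ => 0) t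
  · rintro s' ⟨h3, h4⟩
    refine ⟨h3.mono (by simp), fun ℓ hℓ c hc => ?_⟩
    rw [h4]
    simp only
    rw [if_pos (by nlinarith), mul_comm, Nat.mul_add_div hD, Nat.div_eq_of_lt hc, add_zero,
      Nat.mul_add_mod, Nat.mod_eq_of_lt hc]

/-- Compute the powers of the radix. -/
def Prog.powers (k : ℕ) : Prog :=
  .seq (.set 10 (lit 0) (lit 1))
    (.count 12 (Expr.classesE k) (.set 10 (var 12 + lit 1) (.get 10 (var 12) * Expr.radixE)))

theorem runs_powers {X : ℕ} {P : Data} {s : State} (hm : s 0 1 = P.m) (hDX : P.D < 2 ^ X)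
    (hX : P.W < 2 ^ X) :
    Runs X (Prog.powers P.k) s (3 * P.D + 3) (fun s' => State.Agree [10, 12] s s' ∧
      ∀ c ≤ P.D, s' 10 c = P.B ^ c) := by
  have hB : ∀ c ≤ P.D, P.B ^ c < 2 ^ X := fun c hc =>
    (Nat.pow_le_pow_right Data.B_pos hc).trans_lt hX
  refine (Runs.set_seq (T := P.D * 3 + 2) (by simpa using hB 0 (Nat.zero_le _)) ?_).mono (by omega) fun _ h => h
  set s₁ := s.write 10 ((lit 0 : Expr).eval s) ((lit 1 : Expr).eval s) with hs₁
  have hs₁' : State.Agree [10, 12] s s₁ := (State.Agree.refl _ s).write (by simp) _ _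
  refine (Runs.count_set (v := 12) (s := s₁)
    (fun i c => if c < i + 1 then P.B ^ c else s 10 c) (by norm_num)
    (fun s' hs' => rfl) hDX ?_ ?_).mono le_rfl ?_
  · funext c
    simp only [hs₁, State.write_same, eval_lit, Function.update_apply]
    split_ifs with h1 h2 h2 <;> first | omega | rfl | simp [h1]
  · intro i s' hi hs' h12 h10
    have he : (.get 10 (var 12) * Expr.radixE : Expr).eval s' = P.B ^ (i + 1) := by
      simp [h10, h12, Expr.radixE, Expr.mE, hs' 0 (by simp), hs₁' 0 (by simp), hm, pow_succ,
        Data.B]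
    rw [he, eval_add, eval_var, h12, eval_lit]
    exact ⟨hB _ hi, update_ite_lt _ _ _⟩
  · rintro s' ⟨h1, h2⟩
    refine ⟨hs₁'.trans (h1.mono (by simp)), fun c hc => ?_⟩
    rw [h2]
    simp only
    rw [if_pos (by omega)]

/-- The key by which agents are ranked. -/
def rankKey (n : ℕ) (w : ℕ → ℕ) (i : ℕ) : ℕ := w i * n + i

/-- The number of agents before agent `i` in the order by weight. -/
def rankOf (n : ℕ) (w : ℕ → ℕ) (i : ℕ) : ℕ :=
  ((Finset.range n).filter fun j => rankKey n w j < rankKey n w i).card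

/-- The index breaks ties between equal weights, so keys are distinct and the ranks form a
permutation. -/
theorem rankKey_inj {n : ℕ} {w : ℕ → ℕ} {i j : ℕ} (hi : i < n) (hj : j < n)
    (h : rankKey n w i = rankKey n w j) : i = j := by
  have h1 := congrArg (· % n) h
  simpa [rankKey, Nat.mul_add_mod', Nat.mod_eq_of_lt hi, Nat.mod_eq_of_lt hj] using h1

theorem rankOf_lt_rankOf {n : ℕ} {w : ℕ → ℕ} {i j : ℕ} (hi : i < n)
    (h : rankKey n w i < rankKey n w j) : rankOf n w i < rankOf n w j := by
  refine Finset.card_lt_card ⟨fun a ha => ?_, fun hs => ?_⟩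
  · simp only [Finset.mem_filter] at ha ⊢
    exact ⟨ha.1, ha.2.trans h⟩
  · have := hs (Finset.mem_filter.2 ⟨Finset.mem_range.2 hi, h⟩)
    simp at this

theorem rankOf_inj {n : ℕ} {w : ℕ → ℕ} {i j : ℕ} (hi : i < n) (hj : j < n)
    (h : rankOf n w i = rankOf n w j) : i = j := by
  rcases lt_trichotomy (rankKey n w i) (rankKey n w j) with h1 | h1 | h1
  · exact absurd h (rankOf_lt_rankOf hi h1).ne
  · exact rankKey_inj hi hj h1
  · exact absurd h (rankOf_lt_rankOf hj h1).ne'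

/-- Sort the agents by weight. -/
def Prog.ranks : Prog :=
  .count 13 Expr.nE
    (.seq (.count 12 Expr.nE (.set 4 (var 13) (.get 4 (var 13) +
        .le (.get 3 (var 12) * Expr.nE + var 12 + lit 1) (.get 3 (var 13) * Expr.nE + var 13))))
      (.set 5 (.get 4 (var 13)) (var 13)))

theorem runs_ranks {X n : ℕ} {s : State} {w : ℕ → ℕ} (hn : s 0 0 = n) (hw : ∀ i < n, s 3 i = w i)
    (h4 : ∀ t, s 4 t = 0) (hX : n < 2 ^ X) :
    Runs X Prog.ranks s (n * (3 * n + 5) + 2) (fun s' => State.Agree [4, 5, 12, 13] s s' ∧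
      ∀ i < n, s' 5 (rankOf n w i) = i) := by
  refine (Runs.count (N₀ := n) (T := 3 * n + 3) (v := 13) (s := s)
    (fun i s' => State.Agree [4, 5, 12, 13] s s' ∧
      (s' 4 = fun j => if j < i then rankOf n w j else 0) ∧ ∀ j < i, s' 5 (rankOf n w j) = j)
    ?_ hX ?_ ?_).mono le_rfl ?_
  · rintro i s' _ ⟨h1, -⟩
    simp [Expr.nE, h1 0 (by simp), hn]
  · refine ⟨(State.Agree.refl _ s).write (by simp) _ _, ?_, by simp⟩
    funext t
    simp [State.write_of_ne, h4]
  · rintro i s' hi ⟨h1, h2, h3⟩ h13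
    refine (Runs.seq (T := n * 3 + 2) (T' := 1) (Runs.count_set (v := 12) (s := s')
      (fun d => Function.update (s' 4) i
        (∑ j ∈ Finset.range d, if rankKey n w j < rankKey n w i then 1 else 0)) (by norm_num)
      (fun s'' hs'' => ?_) hX ?_ ?_) ?_).mono (by omega) fun _ h => h
    · simp [Expr.nE, hs'' 0 (by simp), h1 0 (by simp), hn]
    · rw [Finset.range_zero, Finset.sum_empty, h2]
      funext u
      rw [Function.update_apply]
      split_ifs <;> first | rfl | omega
    · intro d s'' hd hs'' h12 h4''
      have h13' : s'' 13 0 = i := by rw [hs'' 13 (by simp), h13]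
      have he : (.get 4 (var 13) + .le (.get 3 (var 12) * Expr.nE + var 12 + lit 1)
          (.get 3 (var 13) * Expr.nE + var 13) : Expr).eval s'' =
            ∑ j ∈ Finset.range (d + 1), if rankKey n w j < rankKey n w i then 1 else 0 := by
        rw [Finset.sum_range_succ]
        simp only [eval_add, eval_get, eval_var, h13', h4'', Function.update_self, Expr.eval_le,
          eval_mul, h12, eval_lit, Expr.nE, hs'' 0 (by simp), h1 0 (by simp), hn,
          hs'' 3 (by simp), h1 3 (by simp), hw d hd, hw i hi]
        rfl
      rw [he, eval_var, h13', ← Finset.card_filter]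
      refine ⟨((Finset.card_filter_le _ _).trans ?_).trans_lt hX, by
        simp only [Function.update_idem, Finset.card_filter]⟩
      rw [Finset.card_range]
      omega
    · rintro s'' ⟨h5, h6⟩
      rw [← Finset.card_filter] at h6
      have h13' : s'' 13 0 = i := by rw [h5 13 (by simp), h13]
      have h4' : s'' 4 i = rankOf n w i := by rw [h6, Function.update_self, rankOf]
      have h7 : State.Agree [4, 5, 12, 13] s s'' := h1.trans (h5.mono (by simp))
      refine Runs.set (by rw [eval_var, h13']; omega) ⟨?_, ?_, ?_, ?_⟩
      · rw [State.write_of_ne (by norm_num), h13']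
      · exact (h7.write (by simp) _ _).write (by simp) _ _
      · simp only [State.write_of_ne, ne_eq, Nat.reduceEqDiff, not_false_eq_true]
        rw [h6, h2]
        exact update_ite_lt (rankOf n w) (fun _ => 0) i
      · intro j hj
        simp only [State.write_of_ne, ne_eq, Nat.reduceEqDiff, not_false_eq_true,
          State.write_same, eval_get, eval_var, h13', h4', Function.update_apply]
        split_ifs with h8
        · exact (rankOf_inj (by omega) hi h8).symm
        · have : j ≠ i := by rintro rfl; exact h8 rfl
          rw [h5 5 (by simp), h3 j (by omega)]
  · rintro s' ⟨h1, -, h3⟩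
    exact ⟨h1, h3⟩

end Phases

end NashWelfare

/-! ### Filling the table and bounding its entries. -/

namespace NashWelfare

namespace Data

variable {P : Data}

theorem lev_lt {u : ℕ} (hu : u < P.NS) : P.lev u < P.L := by
  unfold lev NS at *
  refine Nat.div_lt_of_lt_mul (Nat.div_lt_of_lt_mul (Nat.div_lt_of_lt_mul (hu.trans_eq ?_)))
  ring

/-- Moves lead to larger codes only, so an entry does not depend on cells that are still to be
filled in the backward order. -/
theorem entry_congr {A A' : ℕ → ℕ} {u mv : ℕ} (h : ∀ v, u < v → A v = A' v) (hD : mv < P.D) :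
    P.entry A u mv = P.entry A' u mv := by
  unfold entry
  by_cases h2 : mv = 0
  · simp only [if_pos h2]
  · rw [h _ (lt_next h2 hD)]

/-- A bound for the table. -/
def Bounded (P : Data) (G : ℕ) (A : ℕ → ℕ) : Prop := ∀ u, A u < (2 + (P.NS - u) * G) * P.D

/-- A path from `u` makes at most `NS - u` moves, each gaining at most `G`, and ends with value 1.
This is what keeps the table within `X` bits. -/
theorem entry_lt {A : ℕ → ℕ} {G u mv : ℕ} (hk : 8 ≤ P.k)
    (hG : ∀ ℓ < P.L, ∀ i < P.n, ∀ N ≤ P.D, P.gain ℓ i N ≤ G) (hA : P.Bounded G A)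
    (h0 : ∀ v, P.NS ≤ v → A v = 0) (hu : u < P.NS) (hD : mv < P.D) :
    P.entry A u mv < (2 + (P.NS - u) * G) * P.D := by
  have hD0 := P.D_pos hk
  unfold entry
  split_ifs with h1 h2 h3
  · exact lt_mul_of_one_lt_left hD0 (by omega)
  · have h4 : P.next u mv < P.NS := by
      by_contra h
      rw [h0 _ (by omega)] at h3
      omega
    have h5 := lt_next (s := u) h2 hD
    have h6 : A (P.next u mv) / P.D < 2 + (P.NS - P.next u mv) * G :=
      Nat.div_lt_of_lt_mul ((hA _).trans_eq (mul_comm _ _))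
    have h7 : P.gainAt u mv ≤ G := by
      unfold gainAt
      split_ifs with h8
      · unfold Legal at h1
        rw [if_neg h2, if_pos h8] at h1
        exact hG _ (lev_lt hu) _ h1.1 _ (P.exists_code u).2.2.1
      · exact Nat.zero_le _
    have h8 : (P.NS - P.next u mv + 1) * G ≤ (P.NS - u) * G := Nat.mul_le_mul_right _ (by omega)
    have h9 : A (P.next u mv) / P.D + P.gainAt u mv + 1 ≤ 2 + (P.NS - u) * G := by
      nlinarith
    nlinarith
  · positivity
  · positivity

end Data

section Phases

open NashWelfare.Expr (lit var eval_lit eval_var eval_get eval_add eval_mul eval_div eval_sub)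

/-- Fill the table, from the last state to the first one. -/
def Prog.table (k : ℕ) : Prog :=
  .count 13 (Expr.statesE k)
    (.seq (.set 16 (lit 0) (Expr.statesE k - lit 1 - var 13))
      (.count 12 (Expr.classesE k)
        (.set 8 (var 16) (.max (.get 8 (var 16)) (Expr.entryE k (var 16) (var 12))))))

/-- States are treated in decreasing order, so the cells that an entry reads are final; the inner
loop keeps a running maximum over the moves in the cell itself. -/
theorem runs_table {X G : ℕ} {P : Data} (hk : 8 ≤ P.k) {s : State} (hs : Holds P s)
    (h8 : ∀ u, s 8 u = 0) (hG : ∀ ℓ < P.L, ∀ i < P.n, ∀ N ≤ P.D, P.gain ℓ i N ≤ G)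
    (hX : (2 + P.NS * G) * P.D ≤ 2 ^ X) (hNX : P.NS < 2 ^ X) :
    Runs X (Prog.table P.k) s (P.NS * (3 * P.D + 5) + 2) (fun s' =>
      State.Agree [8, 12, 13, 16] s s' ∧ P.IsTable (s' 8) ∧ P.Bounded G (s' 8)) := by
  have hD0 := P.D_pos hk
  have hb : ∀ u, (2 + (P.NS - u) * G) * P.D ≤ 2 ^ X := fun u => by
    refine le_trans ?_ hX
    gcongr
    omega
  have hDX : P.D < 2 ^ X := (lt_mul_of_one_lt_left hD0 (by omega)).trans_le hX
  refine (Runs.count (N₀ := P.NS) (T := 3 * P.D + 3) (v := 13) (s := s)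
    (fun t s' => State.Agree [8, 12, 13, 16] s s' ∧
      (∀ u, P.NS - t ≤ u → u < P.NS → s' 8 u = (Finset.range P.D).sup (P.entry (s' 8) u)) ∧
      (∀ u < P.NS - t, s' 8 u = 0) ∧ (∀ u, P.NS ≤ u → s' 8 u = 0) ∧ P.Bounded G (s' 8))
    ?_ hNX ?_ ?_).mono le_rfl ?_
  · rintro t s' _ ⟨h1, -⟩
    exact (hs.of_agree h1 (by simp)).eval_statesE
  · refine ⟨(State.Agree.refl _ s).write (by simp) _ _, fun u _ _ => by omega, ?_, ?_, ?_⟩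
    · intro u _
      rw [State.write_of_ne (by norm_num), h8]
    · intro u _
      rw [State.write_of_ne (by norm_num), h8]
    · intro u
      rw [State.write_of_ne (by norm_num), h8]
      positivity
  · rintro t s' ht ⟨h1, h2, h3, h4, h5⟩ h13
    have hst := hs.of_agree h1 (by simp)
    have he : (Expr.statesE P.k - lit 1 - var 13 : Expr).eval s' = P.NS - 1 - t := by
      simp [hst.eval_statesE, h13]
    obtain ⟨u, hu⟩ : ∃ u, u = P.NS - 1 - t := ⟨_, rfl⟩
    have huN : u < P.NS := by omega
    refine (Runs.set_seq (T := P.D * 3 + 2) (by omega) ?_).mono (by omega) fun _ h => h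
    rw [he, eval_lit, ← hu]
    set s₁ := s'.write 16 0 u with hs₁
    have hs₁' : State.Agree [8, 12, 13, 16] s s₁ := h1.write (by simp) _ _
    have h81 : s₁ 8 = s' 8 := State.write_of_ne (by norm_num)
    refine (Runs.count_set (v := 12) (s := s₁)
      (fun d => Function.update (s' 8) u ((Finset.range d).sup (P.entry (s' 8) u))) (by norm_num)
      (fun s'' hs'' => rfl) hDX ?_ ?_).mono le_rfl ?_
    · have h := Function.update_eq_self u (s' 8)
      rw [h3 u (by omega)] at h
      exact h81.trans h.symm
    · intro d s'' hd hs'' h12 h8''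
      have hst' := hs.of_agree (hs₁'.trans (hs''.mono (A' := [8, 12, 13, 16]) (by simp))) (by simp)
      have h16 : s'' 16 0 = u := by rw [hs'' 16 (by simp), hs₁, State.write_same,
        Function.update_self]
      have he' : (Expr.max (.get 8 (var 16)) (Expr.entryE P.k (var 16) (var 12))).eval s'' =
          (Finset.range (d + 1)).sup (P.entry (s' 8) u) := by
        rw [Expr.eval_max, hst'.eval_entryE _ _ hk (by rw [eval_var, h12]; exact hd), eval_get,
          eval_var, eval_var, h16, h12, h8'', Function.update_self,
          Data.entry_congr (A' := s' 8) (fun v hv => Function.update_of_ne hv.ne' _ _) hd,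
          Finset.range_add_one, Finset.sup_insert, sup_comm]
      rw [he', eval_var, h16, Function.update_idem]
      refine ⟨(Finset.sup_lt_iff (by simp)).2 fun mv hmv => ?_, rfl⟩
      rw [Finset.mem_range] at hmv
      exact (Data.entry_lt hk hG h5 h4 huN (by omega)).trans_le (hb u)
    · rintro s'' ⟨h6, h7⟩
      have h9 : State.Agree [8, 12, 13, 16] s s'' := hs₁'.trans (h6.mono (by simp))
      have h10 : ∀ v, u < v → s'' 8 v = s' 8 v := fun v hv => by
        rw [h7, Function.update_of_ne hv.ne']
      refine ⟨?_, h9.write (by simp) _ _, ?_⟩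
      · rw [h6 13 (by simp), hs₁, State.write_of_ne (by norm_num), h13]
      rw [State.write_of_ne (by norm_num)]
      refine ⟨fun v hv hvN => ?_, fun v hv => ?_, fun v hv => ?_, fun v => ?_⟩
      · rw [Finset.sup_congr rfl fun mv hmv => Data.entry_congr (A' := s' 8)
          (fun x (hx : v < x) => h10 x (by omega)) (Finset.mem_range.1 hmv)]
        rcases eq_or_ne v u with rfl | hvu
        · rw [h7, Function.update_self]
        · rw [h10 v (by omega), h2 v (by omega) hvN]
      · rw [h7, Function.update_of_ne (by omega), h3 v (by omega)]
      · rw [h7, Function.update_of_ne (by omega), h4 v hv]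
      · rw [h7, Function.update_apply]
        split_ifs with h11
        · subst h11
          refine (Finset.sup_lt_iff (by simp; positivity)).2 fun mv hmv => ?_
          exact Data.entry_lt hk hG h5 h4 huN (Finset.mem_range.1 hmv)
        · exact h5 v
  · rintro s' ⟨h1, h2, -, h4, h5⟩
    exact ⟨h1, ⟨fun u hu => h2 u (by omega) hu, h4⟩, h5⟩

end Phases

end NashWelfare

/-! ### Turning counts into goods: the invariant `Covers` and the credit. -/

namespace NashWelfare
namespace Data

variable {P : Data}

/-- The total size of the goods outside of `F` that `x` gives to agent `a`. -/
def held (P : Data) (F : Finset ℕ) (x : ℕ → ℕ) (a : ℕ) : ℕ :=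
  ∑ j ∈ (Finset.range P.m).filter (fun j => j ∉ F ∧ x j = a), P.b j

theorem held_give {F Q : Finset ℕ} {x : ℕ → ℕ} (hF : F ⊆ Finset.range P.m) (hQ : Q ⊆ F) (a a' : ℕ) :
    P.held (F \ Q) (fun j => if j ∈ Q then a else x j) a' =
      P.held F x a' + if a' = a then ∑ j ∈ Q, P.b j else 0 := by
  unfold held
  rw [show (if a' = a then ∑ j ∈ Q, P.b j else 0) = ∑ j ∈ Q.filter (fun _ => a' = a), P.b j by
    split_ifs with h <;> simp [h], ← Finset.sum_union]
  · refine Finset.sum_congr ?_ fun _ _ => rfl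
    ext j
    simp only [Finset.mem_filter, Finset.mem_union, Finset.mem_sdiff]
    by_cases hj : j ∈ Q
    · have h1 := hQ hj
      have h2 := hF h1
      simp only [hj, h1, h2, if_true]
      tauto
    · simp only [hj, if_false]
      tauto
  · rw [Finset.disjoint_left]
    intro j h1 h2
    simp only [Finset.mem_filter] at h1 h2
    exact h1.2.1 (hQ h2.1)

theorem held_le_give {F Q : Finset ℕ} {x : ℕ → ℕ} (hF : F ⊆ Finset.range P.m) (hQ : Q ⊆ F)
    (a a' : ℕ) : P.held F x a' ≤ P.held (F \ Q) (fun j => if j ∈ Q then a else x j) a' := by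
  rw [held_give hF hQ]
  exact Nat.le_add_right _ _

/-- The unassigned goods `F` cover the digits `g` at level `ℓ`, and agent `a` has its nominal load
`N`, up to the credit. -/
structure Covers (P : Data) (F : Finset ℕ) (x : ℕ → ℕ) (credit ℓ a N : ℕ) (g : ℕ → ℕ) : Prop where
  sub : F ⊆ Finset.range P.m
  big : ∀ c, P.k < c → c < P.D → g c ≤ (F.filter fun j => P.cls ℓ j = c).card
  small : g P.k * P.k * 2 ^ ℓ + credit ≤ ∑ j ∈ F with P.cls ℓ j ≤ P.k, P.b j
  nominal_le : N * 2 ^ ℓ ≤ P.held F x a + credit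
  credit_lt : credit < (P.k + 1) * 2 ^ ℓ
  assigned : ∀ j < P.m, j ∉ F → P.cls ℓ j < P.D

namespace Covers

variable {F : Finset ℕ} {x : ℕ → ℕ} {credit ℓ a N : ℕ} {g : ℕ → ℕ}

theorem start (P : Data) (x : ℕ → ℕ) (a : ℕ) :
    P.Covers (Finset.range P.m) x 0 0 a 0 fun _ => 0 where
  sub := subset_rfl
  big := fun _ _ _ => Nat.zero_le _
  small := by simp
  nominal_le := by simp
  credit_lt := by positivity
  assigned := fun j hj hj' => absurd (Finset.mem_range.2 hj) hj'

/-- The credit is the part of the nominal load that the current agent has not received. It is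
forgotten when the agent changes, which only relaxes the bound on the small goods. -/
theorem serve (h : P.Covers F x credit ℓ a N g) (a' : ℕ) : P.Covers F x 0 ℓ a' 0 g where
  sub := h.sub
  big := h.big
  small := (Nat.add_le_add_left (Nat.zero_le _) _).trans h.small
  nominal_le := by simp
  credit_lt := by positivity
  assigned := h.assigned

/-- Only the credit is missing, less than `(k+1) 2^ℓ`. From `k² ≤ 2N` follows `k(k+1) ≤ 3N`, so this
is at most `3/k` of the nominal load. -/
theorem held_ge (hk : 8 ≤ P.k) (h : P.Covers F x credit ℓ a N g) (hN : P.k ^ 2 ≤ 2 * N) :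
    N * 2 ^ ℓ * (P.k - 3) ≤ P.held F x a * P.k := by
  have h1 := h.nominal_le
  have h2 := h.credit_lt
  obtain ⟨t, ht⟩ := Nat.exists_eq_add_of_le' hk
  rw [ht] at h2 hN ⊢
  rw [show t + 8 - 3 = t + 5 by omega]
  have h3 : (t + 9) * (t + 8) * 2 ^ ℓ ≤ 3 * N * 2 ^ ℓ := Nat.mul_le_mul_right _ (by nlinarith)
  have h4 : N * 2 ^ ℓ * (t + 8) ≤ (P.held F x a + (t + 8 + 1) * 2 ^ ℓ) * (t + 8) :=
    Nat.mul_le_mul_right _ (by omega)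
  nlinarith

/-- All roundings in `Data.up` go down and class sizes are lower bounds for the goods, so the new
digits are still covered by real goods. -/
theorem up (h : P.Covers F x credit ℓ a N g) (hk : 8 ≤ P.k) :
    P.Covers F x 0 (ℓ + 1) a 0 (P.up g ℓ) where
  sub := h.sub
  big := by
    intro c hc hcD
    unfold Data.up
    refine (min_le_right _ _).trans ?_
    rw [if_neg (by omega), if_neg (by omega)]
    split_ifs with h2
    · have h3 := h.big (2 * c) (by omega) (by unfold D; omega)
      have h4 := h.big (2 * c + 1) (by omega) (by unfold D; omega)
      refine (add_le_add h3 h4).trans ?_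
      rw [← Finset.card_union_of_disjoint]
      · refine Finset.card_le_card fun j hj => ?_
        simp only [Finset.mem_filter, Finset.mem_union, cls_succ] at hj ⊢
        refine ⟨by tauto, by omega⟩
      · rw [Finset.disjoint_filter]
        intro j _ h5 h6
        omega
    · refine Finset.card_le_card fun j hj => ?_
      simp only [Finset.mem_filter, Finset.mem_range] at hj ⊢
      refine ⟨?_, hj.2⟩
      -- A good of class at least `k²` at the new level had class at least `D` before, and by
      -- `assigned` no such good has been given away. So counting all goods counts only free ones.
      by_contra hF
      have := h.assigned j hj.1 hF
      rw [cls_succ] at hj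
      unfold D at this
      omega
  small := by
    unfold Data.up
    rw [if_neg (lt_irrefl _), if_pos rfl, add_zero]
    set T := ∑ d ∈ Finset.range (P.k + 2), (P.k + d) * g (P.k + d) with hT
    have hT1 : T = P.k * g P.k + ∑ d ∈ Finset.range (P.k + 1), (P.k + 1 + d) * g (P.k + 1 + d) := by
      rw [hT, Finset.sum_range_succ', add_comm]
      congr 1
      refine Finset.sum_congr rfl fun d _ => ?_
      rw [show P.k + (d + 1) = P.k + 1 + d by ring]
    have hsplit : ∑ j ∈ F with P.cls (ℓ + 1) j ≤ P.k, P.b j =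
        ∑ j ∈ F with P.cls ℓ j ≤ P.k, P.b j +
          ∑ d ∈ Finset.range (P.k + 1), ∑ j ∈ F with P.cls ℓ j = P.k + 1 + d, P.b j :=
      sum_cls_succ_le F ℓ
    have hcls : (∑ d ∈ Finset.range (P.k + 1), (P.k + 1 + d) * g (P.k + 1 + d)) * 2 ^ ℓ ≤
        ∑ d ∈ Finset.range (P.k + 1), ∑ j ∈ F with P.cls ℓ j = P.k + 1 + d, P.b j := by
      rw [Finset.sum_mul]
      refine Finset.sum_le_sum fun d hd => ?_
      rw [Finset.mem_range] at hd
      have h1 := h.big (P.k + 1 + d) (by omega) (by unfold D; nlinarith)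
      calc (P.k + 1 + d) * g (P.k + 1 + d) * 2 ^ ℓ
          = g (P.k + 1 + d) * ((P.k + 1 + d) * 2 ^ ℓ) := by ring
        _ ≤ (F.filter fun j => P.cls ℓ j = P.k + 1 + d).card * ((P.k + 1 + d) * 2 ^ ℓ) := by gcongr
        _ ≤ _ := by
          refine Finset.card_nsmul_le_sum _ _ _ fun j hj => ?_
          rw [Finset.mem_filter] at hj
          rw [← hj.2]
          exact cls_mul_le _ _
    have h1 := h.small
    rw [hsplit]
    calc _ ≤ T / (2 * P.k) * P.k * 2 ^ (ℓ + 1) := by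
          gcongr
          exact min_le_right _ _
      _ = T / (2 * P.k) * (2 * P.k) * 2 ^ ℓ := by ring
      _ ≤ T * 2 ^ ℓ := Nat.mul_le_mul_right _ (Nat.div_mul_le_self _ _)
      _ = g P.k * P.k * 2 ^ ℓ +
          (∑ d ∈ Finset.range (P.k + 1), (P.k + 1 + d) * g (P.k + 1 + d)) * 2 ^ ℓ := by
          rw [hT1]; ring
      _ ≤ _ := by omega
  nominal_le := by simp
  credit_lt := by positivity
  assigned := by
    intro j hj hF
    have := h.assigned j hj hF
    rw [cls_succ]
    omega

/-- A greedy pass with room `(c+1) 2^ℓ - 1` takes exactly one good of class `c`: each such good fits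
alone, two need at least `2c 2^ℓ`, and the positive digit guarantees that one is free. -/
theorem take_big (h : P.Covers F x credit ℓ a N g) {c cr : ℕ} (hc : P.k < c) (hcD : c < P.D)
    (hg : 1 ≤ g c) {Q : Finset ℕ} (hQ : Q ⊆ F) (hcls : ∀ j ∈ Q, P.cls ℓ j = c)
    (hcr : ∑ j ∈ Q, P.b j + cr = (c + 1) * 2 ^ ℓ - 1)
    (hmax : ∀ j ∈ F, P.cls ℓ j = c → j ∉ Q → cr < P.b j) :
    P.Covers (F \ Q) (fun j => if j ∈ Q then a else x j) credit ℓ a (N + c)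
      (fun d => g d - if d = c then 1 else 0) := by
  have hb : ∀ j ∈ Q, c * 2 ^ ℓ ≤ P.b j := fun j hj => by
    rw [← hcls j hj]
    exact cls_mul_le _ _
  have hp : 0 < 2 ^ ℓ := by positivity
  have hcard : Q.card = 1 := by
    have h1 : Q.card ≤ 1 := by
      by_contra h1
      have h2 : Q.card • (c * 2 ^ ℓ) ≤ ∑ j ∈ Q, P.b j := Finset.card_nsmul_le_sum Q _ _ hb
      rw [smul_eq_mul] at h2
      have h3 : 2 * (c * 2 ^ ℓ) ≤ Q.card * (c * 2 ^ ℓ) := Nat.mul_le_mul_right _ (by omega)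
      have h4 : (c + 1) * 2 ^ ℓ ≤ 2 * (c * 2 ^ ℓ) := by
        rw [← mul_assoc]
        exact Nat.mul_le_mul_right _ (by omega)
      have h5 : 0 < (c + 1) * 2 ^ ℓ := by positivity
      omega
    have h2 : Q.Nonempty := by
      by_contra hne
      rw [Finset.not_nonempty_iff_eq_empty] at hne
      subst hne
      have h3 : 0 < (F.filter fun j => P.cls ℓ j = c).card := hg.trans (h.big c hc hcD)
      obtain ⟨j, hj⟩ := Finset.card_pos.1 h3
      rw [Finset.mem_filter] at hj
      have h4 := hmax j hj.1 hj.2 (by simp)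
      have h5 := lt_cls_succ_mul (P := P) ℓ j
      rw [hj.2] at h5
      simp only [Finset.sum_empty] at hcr
      omega
    have := h2.card_pos
    omega
  constructor
  · exact Finset.sdiff_subset.trans h.sub
  · intro d hd hdD
    have h1 := h.big d hd hdD
    by_cases hdc : d = c
    · subst hdc
      have h2 : (F.filter fun j => P.cls ℓ j = d).card ≤
          ((F \ Q).filter fun j => P.cls ℓ j = d).card + Q.card := by
        refine (Finset.card_le_card fun j hj => ?_).trans (Finset.card_union_le _ _)
        simp only [Finset.mem_filter, Finset.mem_union, Finset.mem_sdiff] at hj ⊢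
        tauto
      simp only [if_true]
      omega
    · simp only [if_neg hdc, Nat.sub_zero]
      refine h1.trans (Finset.card_le_card fun j hj => ?_)
      simp only [Finset.mem_filter, Finset.mem_sdiff] at hj ⊢
      exact ⟨⟨hj.1, fun hjQ => hdc (hj.2.symm.trans (hcls j hjQ))⟩, hj.2⟩
  · simp only [if_neg (show P.k ≠ c by omega), Nat.sub_zero]
    refine h.small.trans_eq (Finset.sum_congr ?_ fun _ _ => rfl)
    ext j
    simp only [Finset.mem_filter, Finset.mem_sdiff]
    constructor
    · rintro ⟨h1, h2⟩
      exact ⟨⟨h1, fun hjQ => by have := hcls j hjQ; omega⟩, h2⟩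
    · rintro ⟨⟨h1, -⟩, h2⟩
      exact ⟨h1, h2⟩
  · rw [held_give h.sub hQ, if_pos rfl]
    have h1 : Q.card • (c * 2 ^ ℓ) ≤ ∑ j ∈ Q, P.b j := Finset.card_nsmul_le_sum Q _ _ hb
    rw [hcard, one_smul] at h1
    have h2 := h.nominal_le
    rw [add_mul]
    omega
  · exact h.credit_lt
  · intro j hj hjF
    by_cases hjQ : j ∈ Q
    · rw [hcls j hjQ]; exact hcD
    · exact h.assigned j hj fun h1 => hjF (Finset.mem_sdiff.2 ⟨h1, hjQ⟩)

/-- The agent is owed a chunk `k 2^ℓ` plus the old credit and takes small goods greedily; what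
remains unfilled is the new credit. Chunks are thus never rounded separately, and the error per
agent stays below one small good. -/
theorem take_small (h : P.Covers F x credit ℓ a N g) (hk : 8 ≤ P.k) {cr : ℕ}
    (hg : 1 ≤ g P.k) {Q : Finset ℕ} (hQ : Q ⊆ F) (hcls : ∀ j ∈ Q, P.cls ℓ j ≤ P.k)
    (hcr : ∑ j ∈ Q, P.b j + cr = credit + P.k * 2 ^ ℓ)
    (hmax : ∀ j ∈ F, P.cls ℓ j ≤ P.k → j ∉ Q → cr < P.b j) :
    P.Covers (F \ Q) (fun j => if j ∈ Q then a else x j) cr ℓ a (N + P.k)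
      (fun d => g d - if d = P.k then 1 else 0) := by
  have hkD : P.k < P.D := by unfold D; nlinarith
  have hsmall : (g P.k - 1) * P.k * 2 ^ ℓ + cr ≤ ∑ j ∈ F \ Q with P.cls ℓ j ≤ P.k, P.b j := by
    have h1 : ∑ j ∈ F with P.cls ℓ j ≤ P.k, P.b j =
        ∑ j ∈ F \ Q with P.cls ℓ j ≤ P.k, P.b j + ∑ j ∈ Q, P.b j := by
      rw [← Finset.sum_union]
      · refine Finset.sum_congr ?_ fun _ _ => rfl
        ext j
        simp only [Finset.mem_filter, Finset.mem_union, Finset.mem_sdiff]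
        by_cases hj : j ∈ Q
        · simp [hj, hcls j hj, hQ hj]
        · simp [hj]
      · rw [Finset.disjoint_left]
        intro j h1 h2
        simp only [Finset.mem_filter, Finset.mem_sdiff] at h1
        exact h1.1.2 h2
    have h2 := h.small
    obtain ⟨e, he⟩ := Nat.exists_eq_add_of_le' hg
    rw [he] at h2 ⊢
    rw [Nat.add_sub_cancel]
    have h3 : (e + 1) * P.k * 2 ^ ℓ = e * P.k * 2 ^ ℓ + P.k * 2 ^ ℓ := by ring
    omega
  constructor
  · exact Finset.sdiff_subset.trans h.sub
  · intro d hd hdD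
    have h1 := h.big d hd hdD
    simp only [if_neg (show d ≠ P.k by omega), Nat.sub_zero]
    refine h1.trans (Finset.card_le_card fun j hj => ?_)
    simp only [Finset.mem_filter, Finset.mem_sdiff] at hj ⊢
    exact ⟨⟨hj.1, fun hjQ => by have := hcls j hjQ; omega⟩, hj.2⟩
  · simpa using hsmall
  · rw [held_give h.sub hQ, if_pos rfl]
    have h2 := h.nominal_le
    rw [add_mul]
    omega
  -- With so much room left no small good would have been refused, so none remains; but `hsmall`
  -- says that the remaining ones are worth at least the credit.
  · by_contra hlt
    have h1 : (F \ Q).filter (fun j => P.cls ℓ j ≤ P.k) = ∅ := by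
      rw [Finset.filter_eq_empty_iff]
      intro j hj hjk
      rw [Finset.mem_sdiff] at hj
      have h2 := hmax j hj.1 hjk hj.2
      have h3 := lt_cls_succ_mul (P := P) ℓ j
      have h4 : (P.cls ℓ j + 1) * 2 ^ ℓ ≤ (P.k + 1) * 2 ^ ℓ := Nat.mul_le_mul_right _ (by omega)
      omega
    rw [h1, Finset.sum_empty] at hsmall
    have h5 : 0 < (P.k + 1) * 2 ^ ℓ := by positivity
    omega
  · intro j hj hjF
    by_cases hjQ : j ∈ Q
    · exact (hcls j hjQ).trans_lt hkD
    · exact h.assigned j hj fun h1 => hjF (Finset.mem_sdiff.2 ⟨h1, hjQ⟩)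

end Covers

end Data
end NashWelfare

/-! ### Following the best path: the invariant `Track` and one greedy pass over the goods. -/

namespace NashWelfare
namespace Data

variable {P : Data}

/-- The allocation built so far follows the best path in the table `A` up to the state `u`:
the agents before the current one, with names given by `ord`, were served at levels `a` and with
nominal loads `e`. -/
def Track (P : Data) (A ord : ℕ → ℕ) (F : Finset ℕ) (x : ℕ → ℕ) (credit u : ℕ) : Prop :=
  ∃ (ℓ i N : ℕ) (g a e : ℕ → ℕ), u = P.code ℓ i N (P.encode g) ∧ (∀ c, g c < P.B) ∧ ℓ < P.L ∧
    i ≤ P.n ∧ N ≤ P.D ∧ P.Covers F x credit ℓ (ord i) N g ∧ 0 < A u / P.D ∧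
    A 0 / P.D = A u / P.D + ∑ i' ∈ Finset.range i, P.gain (a i') i' (e i') ∧
    ∀ i' < i, P.k ^ 2 ≤ 2 * e i' ∧
      e i' * 2 ^ a i' * (P.k - 3) ≤ P.held F x (ord i') * P.k

namespace Track

variable {A ord : ℕ → ℕ} {F : Finset ℕ} {x : ℕ → ℕ} {credit u : ℕ}

theorem start (hA : P.IsTable A) (hk : 8 ≤ P.k) (h0 : A 0 ≠ 0) (x : ℕ → ℕ) :
    P.Track A ord (Finset.range P.m) x 0 0 := by
  have hD := P.D_pos hk
  obtain ⟨h1, h2, h3, h4, h5⟩ := move_spec hA h0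
  have hL : 0 < P.L := by
    by_contra h
    unfold NS at h1
    simp [show P.L = 0 by omega] at h1
  have hpos : 0 < A 0 / P.D := by
    by_cases h6 : A 0 % P.D = 0
    · rw [h4 h6]; exact one_pos
    · have := h5 h6
      omega
  exact ⟨0, 0, 0, fun _ => 0, fun _ => 0, fun _ => 0, by simp [code, encode], fun _ => B_pos, hL,
    Nat.zero_le _, Nat.zero_le _, Covers.start P x _, hpos, by simp, by simp⟩

theorem ne_zero (h : P.Track A ord F x credit u) : A u ≠ 0 := by
  obtain ⟨ℓ, i, N, g, a, e, -, -, -, -, -, -, h1, -, -⟩ := h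
  intro h2
  rw [h2, Nat.zero_div] at h1
  exact lt_irrefl _ h1

theorem credit_lt (h : P.Track A ord F x credit u) : credit < (P.k + 1) * 2 ^ P.lev u := by
  obtain ⟨ℓ, i, N, g, a, e, rfl, hg, -, hi, hN, h1, -⟩ := h
  rw [lev_code (encode_lt hg) hN hi]
  exact h1.credit_lt

theorem finish (hA : P.IsTable A) (h : P.Track A ord F x credit u) (hmv : A u % P.D = 0) :
    ∃ a e : ℕ → ℕ, A 0 / P.D = 1 + ∑ i ∈ Finset.range P.n, P.gain (a i) i (e i) ∧
      ∀ i < P.n, P.k ^ 2 ≤ 2 * e i ∧ e i * 2 ^ a i * (P.k - 3) ≤ P.held F x (ord i) * P.k := by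
  obtain ⟨h1, h2, h3, h4, h5⟩ := move_spec hA h.ne_zero
  obtain ⟨ℓ, i, N, g, a, e, rfl, hg, hℓ, hi, hN, hC, hpos, hsum, hserved⟩ := h
  rw [hmv] at h3
  have hin : i = P.n := by
    simpa [Legal, agt_code (encode_lt hg) hN hi] using h3
  subst hin
  rw [h4 hmv] at hsum
  exact ⟨a, e, hsum, hserved⟩

theorem serve (hA : P.IsTable A) (hk : 8 ≤ P.k) (h : P.Track A ord F x credit u)
    (hmv : A u % P.D = 1) : P.Track A ord F x 0 (P.next u 1) := by
  obtain ⟨h1, h2, h3, h4, h5⟩ := move_spec hA h.ne_zero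
  obtain ⟨ℓ, i, N, g, a, e, rfl, hg, hℓ, hi, hN, hC, hpos, hsum, hserved⟩ := h
  have hE := encode_lt hg
  rw [hmv] at h3 h5
  obtain ⟨h6, h7⟩ := h5 one_ne_zero
  have h8 : i < P.n ∧ P.k ^ 2 ≤ 2 * N := by
    simpa [Legal, agt_code hE hN hi, nom_code hE hN] using h3
  have h9 : P.next (P.code ℓ i N (P.encode g)) 1 = P.code ℓ (i + 1) 0 (P.encode g) := by
    unfold next
    rw [if_pos rfl, lev_code hE hN hi, agt_code hE hN hi, con_code hE]
  have h10 : P.gainAt (P.code ℓ i N (P.encode g)) 1 = P.gain ℓ i N := by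
    unfold gainAt
    rw [if_pos rfl, lev_code hE hN hi, agt_code hE hN hi, nom_code hE hN]
  rw [h10] at h7
  refine ⟨ℓ, i + 1, 0, g, Function.update a i ℓ, Function.update e i N, h9, hg, hℓ, h8.1,
    Nat.zero_le _, hC.serve _, h6, ?_, ?_⟩
  · have h11 : ∑ i' ∈ Finset.range i, P.gain (Function.update a i ℓ i') i' (Function.update e i N i')
        = ∑ i' ∈ Finset.range i, P.gain (a i') i' (e i') := by
      refine Finset.sum_congr rfl fun i' hi' => ?_
      rw [Finset.mem_range] at hi'
      rw [Function.update_of_ne hi'.ne, Function.update_of_ne hi'.ne]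
    rw [Finset.sum_range_succ, Function.update_self, Function.update_self, hsum, h7, h11]
    ring
  · intro i' hi'
    rcases eq_or_ne i' i with rfl | hne
    · rw [Function.update_self, Function.update_self]
      exact ⟨h8.2, hC.held_ge hk h8.2⟩
    · rw [Function.update_of_ne hne, Function.update_of_ne hne]
      exact hserved i' (by omega)

theorem up (hA : P.IsTable A) (hk : 8 ≤ P.k) (h : P.Track A ord F x credit u)
    (hmv : A u % P.D = 2) : P.Track A ord F x 0 (P.next u 2) := by
  obtain ⟨h1, h2, h3, h4, h5⟩ := move_spec hA h.ne_zero
  obtain ⟨ℓ, i, N, g, a, e, rfl, hg, hℓ, hi, hN, hC, hpos, hsum, hserved⟩ := h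
  have hE := encode_lt hg
  rw [hmv] at h3 h5
  obtain ⟨h6, h7⟩ := h5 two_ne_zero
  have h8 : ℓ + 1 < P.L := by
    simpa [Legal, lev_code hE hN hi] using h3
  have h9 : P.next (P.code ℓ i N (P.encode g)) 2 = P.code (ℓ + 1) i 0 (P.encode (P.up g ℓ)) := by
    unfold next
    rw [if_neg (by norm_num), if_pos rfl, lev_code hE hN hi, agt_code hE hN hi, con_code hE,
      encode_congr (fun c _ => up_congr (fun d hd => digit_encode hg hd) hk ℓ c)]
  refine ⟨ℓ + 1, i, 0, P.up g ℓ, a, e, h9, up_lt g ℓ, h8, hi, Nat.zero_le _, hC.up hk, h6, ?_,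
    hserved⟩
  rw [hsum, h7]
  simp [gainAt]

/-- Covers both kinds of items: for `mv = k` the lower class bound is 0 and the credit enters the
room, otherwise only class `mv` is admitted and the credit is untouched. -/
theorem take (hA : P.IsTable A) (hk : 8 ≤ P.k) (h : P.Track A ord F x credit u) {mv : ℕ}
    (hmv : A u % P.D = mv) (hmvk : P.k ≤ mv) {Q : Finset ℕ} (hQ : Q ⊆ F) {cr : ℕ}
    (hcls : ∀ j ∈ Q, (if mv = P.k then 0 else mv) ≤ P.cls (P.lev u) j ∧ P.cls (P.lev u) j ≤ mv)
    (hcr : ∑ j ∈ Q, P.b j + cr =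
      if mv = P.k then credit + P.k * 2 ^ P.lev u else (mv + 1) * 2 ^ P.lev u - 1)
    (hmax : ∀ j ∈ F, (if mv = P.k then 0 else mv) ≤ P.cls (P.lev u) j →
      P.cls (P.lev u) j ≤ mv → j ∉ Q → cr < P.b j) :
    P.Track A ord (F \ Q) (fun j => if j ∈ Q then ord (P.agt u) else x j)
      (if mv = P.k then cr else credit) (P.next u mv) := by
  obtain ⟨h1, h2, h3, h4, h5⟩ := move_spec hA h.ne_zero
  obtain ⟨ℓ, i, N, g, a, e, rfl, hg, hℓ, hi, hN, hC, hpos, hsum, hserved⟩ := h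
  have hE := encode_lt hg
  rw [hmv] at h2 h3 h5
  obtain ⟨h6, h7⟩ := h5 (by omega)
  have h8 : P.k ≤ mv ∧ 1 ≤ P.digit (P.encode g) mv ∧ N + mv ≤ P.D ∧ i < P.n := by
    simpa [Legal, show mv ≠ 0 by omega, show mv ≠ 1 by omega, show mv ≠ 2 by omega,
      agt_code hE hN hi, nom_code hE hN, con_code hE] using h3
  rw [digit_encode hg h2] at h8
  have h10 : P.gainAt (P.code ℓ i N (P.encode g)) mv = 0 := if_neg (by omega)
  rw [lev_code hE hN hi] at hcls hcr hmax
  rw [agt_code hE hN hi]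
  refine ⟨ℓ, i, N + mv, fun d => g d - if d = mv then 1 else 0, a, e, next_take hk hmvk h2 h8.2.1,
    fun c => (Nat.sub_le _ _).trans_lt (hg c), hℓ, hi, h8.2.2.1, ?_, h6, ?_, ?_⟩
  · by_cases hmk : mv = P.k
    · subst hmk
      simp only [if_true] at hcls hcr hmax ⊢
      exact hC.take_small hk h8.2.1 hQ (fun j hj => (hcls j hj).2) hcr
        fun j hj h11 h12 => hmax j hj (Nat.zero_le _) h11 h12
    · simp only [if_neg hmk] at hcls hcr hmax ⊢
      exact hC.take_big (by omega) h2 h8.2.1 hQ (fun j hj => le_antisymm (hcls j hj).2 (hcls j hj).1)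
        hcr fun j hj h11 h12 => hmax j hj h11.ge h11.le h12
  · rw [hsum, h7, h10, add_zero]
  · intro i' hi'
    refine ⟨(hserved i' hi').1, (hserved i' hi').2.trans ?_⟩
    exact Nat.mul_le_mul_right _ (held_le_give hC.sub hQ _ _)

end Track

end Data

section Phases

open NashWelfare.Expr (lit var eval_lit eval_var eval_get eval_add eval_mul eval_div eval_sub)

/-- The class of the good in variable `12` at the current level. -/
def Expr.currentClassE (k : ℕ) : Expr := .get 2 (var 12) / .get 6 (Expr.levE k (var 16))

/-- Give unassigned goods of the wanted classes to the current agent, as long as there is room. -/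
def Prog.pass (k : ℕ) : Prog :=
  .count 12 Expr.mE
    (.ite (.eq (.get 9 (var 12)) (lit 0) * .le (var 20) (Expr.currentClassE k) *
        .le (Expr.currentClassE k) (var 17) * .le (.get 2 (var 12)) (var 19))
      (.seq (.set 1 (var 12) (.get 5 (Expr.agtE k (var 16))))
        (.seq (.set 9 (var 12) (lit 1)) (.set 19 (lit 0) (var 19 - .get 2 (var 12)))))
      .skip)

/-- The room only decreases during the pass, so a good refused once is still too large at the end.
This is the maximality of `Q` on which `take_big` and `take_small` rely. -/
theorem runs_pass {X u mv lo : ℕ} {P : Data} {s : State} (hs : Holds P s) (hu : s 16 0 = u)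
    (huL : P.lev u < P.L) (hmv : s 17 0 = mv) (hlo : s 20 0 = lo) (hmX : P.m < 2 ^ X)
    (haX : s 5 (P.agt u) < 2 ^ X) (hcX : s 19 0 < 2 ^ X) :
    Runs X (Prog.pass P.k) s (6 * P.m + 2) (fun s' => State.Agree [1, 9, 12, 19] s s' ∧
      ∃ Q : Finset ℕ, (∀ j ∈ Q, j < P.m ∧ s 9 j = 0 ∧ lo ≤ P.cls (P.lev u) j ∧
          P.cls (P.lev u) j ≤ mv) ∧
        (s' 1 = fun j => if j ∈ Q then s 5 (P.agt u) else s 1 j) ∧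
        (s' 9 = fun j => if j ∈ Q then 1 else s 9 j) ∧
        ∑ j ∈ Q, P.b j + s' 19 0 = s 19 0 ∧
        ∀ j < P.m, s 9 j = 0 → lo ≤ P.cls (P.lev u) j → P.cls (P.lev u) j ≤ mv → j ∉ Q →
          s' 19 0 < P.b j) := by
  refine (Runs.count (N₀ := P.m) (T := 4) (v := 12) (s := s)
    (fun t s' => State.Agree [1, 9, 12, 19] s s' ∧
      ∃ Q : Finset ℕ, (∀ j ∈ Q, j < t ∧ s 9 j = 0 ∧ lo ≤ P.cls (P.lev u) j ∧
          P.cls (P.lev u) j ≤ mv) ∧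
        (s' 1 = fun j => if j ∈ Q then s 5 (P.agt u) else s 1 j) ∧
        (s' 9 = fun j => if j ∈ Q then 1 else s 9 j) ∧
        ∑ j ∈ Q, P.b j + s' 19 0 = s 19 0 ∧
        ∀ j < t, s 9 j = 0 → lo ≤ P.cls (P.lev u) j → P.cls (P.lev u) j ≤ mv → j ∉ Q →
          s' 19 0 < P.b j) ?_ hmX ?_ ?_).mono (by omega) fun _ h => h
  · rintro t s' _ ⟨h1, -⟩
    exact (hs.of_agree h1 (by simp)).m
  · refine ⟨(State.Agree.refl _ s).write (by simp) _ _, ∅, by simp, ?_, ?_, ?_, by simp⟩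
    · simp [State.write_of_ne]
    · simp [State.write_of_ne]
    · simp [State.write_of_ne]
  · rintro t s' ht ⟨h1, Q, h2, h3, h4, h5, h6⟩ h12
    have hst := hs.of_agree h1 (by simp)
    have htQ : t ∉ Q := fun h => lt_irrefl _ (h2 t h).1
    have h16 : s' 16 0 = u := by rw [h1 16 (by simp), hu]
    have hcl : (Expr.currentClassE P.k).eval s' = P.cls (P.lev u) t := by
      simp [Expr.currentClassE, hst.eval_levE, h16, h12, hst.b t ht, hst.two _ huL, Data.cls]
    have htest : (Expr.eq (.get 9 (var 12)) (lit 0) * .le (var 20) (Expr.currentClassE P.k) *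
        .le (Expr.currentClassE P.k) (var 17) * .le (.get 2 (var 12)) (var 19)).eval s' ≠ 0 ↔
        s 9 t = 0 ∧ lo ≤ P.cls (P.lev u) t ∧ P.cls (P.lev u) t ≤ mv ∧ P.b t ≤ s' 19 0 := by
      simp only [eval_mul, Expr.eval_eq, Expr.eval_le, eval_get, eval_var, eval_lit, hcl, h12, h4,
        if_neg htQ, h1 20 (by simp), h1 17 (by simp), hlo, hmv, hst.b t ht, ne_eq, mul_eq_zero,
        ite_eq_right_iff, one_ne_zero, imp_false, not_or, not_not, and_assoc]
    refine (Runs.ite (T := 3) (fun he => ?_) fun he => (Runs.skip ?_).mono (by norm_num)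
      fun _ h => h).mono le_rfl fun _ h => h
    · obtain ⟨h7, h8, h9, h10⟩ := htest.1 he
      have hag : (Expr.get 5 (Expr.agtE P.k (var 16))).eval s' = s 5 (P.agt u) := by
        simp [hst.eval_agtE, h16, h1 5 (by simp)]
      refine Runs.set_seq (by rw [hag]; exact haX) (Runs.set_seq ?_ (Runs.set ?_ ⟨?_, ?_, insert t Q,
        ?_, ?_, ?_, ?_, ?_⟩))
      · have := hcX
        rw [eval_lit]
        -- If `2 ^ X` were 1, the bound on `m` would leave no goods, against `t < m`.
        by_contra hcon
        have h11 : (2 : ℕ) ^ X = 1 := by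
          have : 0 < 2 ^ X := by positivity
          omega
        omega
      · simp only [eval_sub, eval_var, eval_get, State.write_of_ne, ne_eq, Nat.reduceEqDiff,
          not_false_eq_true, h12, hst.b t ht]
        omega
      · simp [State.write_of_ne, h12]
      · exact (((h1.write (by simp) _ _).write (by simp) _ _).write (by simp) _ _).write (by simp) _ _
      · intro j hj
        rcases Finset.mem_insert.1 hj with rfl | hj
        · exact ⟨Nat.lt_succ_self _, h7, h8, h9⟩
        · have := h2 j hj
          exact ⟨by omega, this.2⟩
      · rw [hag]
        simp only [State.write_of_ne, ne_eq, Nat.reduceEqDiff, not_false_eq_true, State.write_same,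
          eval_var, h12, h3]
        funext j
        simp only [Function.update_apply, Finset.mem_insert]
        split_ifs <;> simp_all
      · simp only [State.write_of_ne, ne_eq, Nat.reduceEqDiff, not_false_eq_true, State.write_same,
          eval_var, h12, h4, eval_lit]
        funext j
        simp only [Function.update_apply, Finset.mem_insert]
        split_ifs <;> simp_all
      · rw [Finset.sum_insert htQ]
        simp only [State.write_of_ne, ne_eq, Nat.reduceEqDiff, not_false_eq_true, State.write_same,
          eval_var, h12, eval_lit, eval_sub, eval_get, Function.update_self, hst.b t ht]
        omega
      · intro j hj h13 h14 h15 h17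
        rw [Finset.mem_insert, not_or] at h17
        have := h6 j (by omega) h13 h14 h15 h17.2
        simp only [State.write_of_ne, ne_eq, Nat.reduceEqDiff, not_false_eq_true, State.write_same,
          eval_var, h12, eval_lit, eval_sub, eval_get, Function.update_self, hst.b t ht]
        omega
    · refine ⟨h12, h1.write (by simp) _ _, Q, fun j hj => ?_, ?_, ?_, ?_, ?_⟩
      · have := h2 j hj
        exact ⟨by omega, this.2⟩
      · rw [State.write_of_ne (by norm_num), h3]
      · rw [State.write_of_ne (by norm_num), h4]
      · rw [State.write_of_ne (by norm_num), h5]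
      · intro j hj h13 h14 h15 h17
        rw [State.write_of_ne (by norm_num)]
        rcases Nat.lt_succ_iff_lt_or_eq.1 hj with hj | rfl
        · exact h6 j hj h13 h14 h15 h17
        · by_contra hlt
          exact htest.2 ⟨h13, h14, h15, by omega⟩ he

end Phases

end NashWelfare

/-! ### The loop that carries out the best moves. -/

namespace NashWelfare

section Phases

open NashWelfare.Expr (lit var eval_lit eval_var eval_get eval_add eval_mul eval_div eval_sub)

/-- Carry out a move that takes items of the class in variable `17`. -/
def Prog.take (k : ℕ) : Prog :=
  .seq (.set 20 (lit 0) (.cond (var 17 - lit k) (var 17) (lit 0)))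
    (.seq (.set 19 (lit 0) (.cond (var 17 - lit k)
        ((var 17 + lit 1) * .get 6 (Expr.levE k (var 16)) - lit 1)
        (var 18 + lit k * .get 6 (Expr.levE k (var 16)))))
      (.seq (.pass k) (.set 18 (lit 0) (.cond (var 17 - lit k) (var 18) (var 19)))))

/-- The best move in the current state. -/
def Expr.moveE (k : ℕ) : Expr := .mod (.get 8 (var 16)) (Expr.classesE k)

/-- Carry out the best move. -/
def Prog.move (k : ℕ) : Prog :=
  .seq (.set 17 (lit 0) (Expr.moveE k))
    (.seq (.ite (.le (lit k) (var 17)) (.take k) (.set 18 (lit 0) (lit 0)))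
      (.set 16 (lit 0) (Expr.nextE k (var 16) (var 17))))

/-- Follow the best moves from the first state on. -/
def Prog.follow (k : ℕ) : Prog :=
  .seq (.set 16 (lit 0) (lit 0)) (.loop (Expr.moveE k) (.move k))

/-- The unassigned goods. -/
def free (P : Data) (s : State) : Finset ℕ := (Finset.range P.m).filter fun j => s 9 j = 0

/-- The invariant of the loop that follows the best moves. -/
def Following (P : Data) (s s' : State) : Prop :=
  State.Agree [1, 9, 12, 16, 17, 18, 19, 20] s s' ∧ (∀ j, s' 1 j < P.n) ∧
    P.Track (s 8) (s 5) (free P s') (s' 1) (s' 18 0) (s' 16 0)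

/-- The test `var 17 - lit k` vanishes only for chunks, since here `k ≤ mv`; it selects lower class,
room and credit. The bit bound uses `(D+1) 2^L ≤ 2^X`, because each room is a number below `D` in
units of `2^ℓ` with `ℓ < L`. -/
theorem runs_take {X u mv : ℕ} {P : Data} (hk : 8 ≤ P.k) {s s' : State} (hs : Holds P s)
    (hA : P.IsTable (s 8)) (hord : ∀ i < P.n, s 5 i < P.n) (hmX : P.m < 2 ^ X) (hnX : P.n < 2 ^ X)
    (hLX : (P.D + 1) * 2 ^ P.L ≤ 2 ^ X) (h : Following P s s') (hu : s' 16 0 = u)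
    (h17 : s' 17 0 = mv) (hmv : s 8 u % P.D = mv) (hmvk : P.k ≤ mv) :
    Runs X (Prog.take P.k) s' (6 * P.m + 5) (fun s'' =>
      State.Agree [1, 9, 12, 16, 17, 18, 19, 20] s s'' ∧ s'' 16 0 = u ∧ s'' 17 0 = mv ∧
        (∀ j, s'' 1 j < P.n) ∧
        P.Track (s 8) (s 5) (free P s'') (s'' 1) (s'' 18 0) (P.next u mv)) := by
  obtain ⟨hag, hx, hT⟩ := h
  rw [hu] at hT
  have hst := hs.of_agree hag (by simp)
  obtain ⟨h1, h2, h3, -, -⟩ := Data.move_spec hA hT.ne_zero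
  rw [hmv] at h2 h3
  have huL := Data.lev_lt h1
  have hagt : P.agt u < P.n := by
    unfold Data.Legal at h3
    rw [if_neg (by omega), if_neg (by omega), if_neg (by omega)] at h3
    exact h3.2.2.2
  have hpw : 2 ^ (P.lev u + 1) ≤ 2 ^ P.L := Nat.pow_le_pow_right (by norm_num) huL
  rw [pow_succ] at hpw
  have hp0 : 0 < 2 ^ P.lev u := by positivity
  have hDX : (P.D + 1) * (2 ^ P.lev u * 2) ≤ 2 ^ X := (Nat.mul_le_mul_left _ hpw).trans hLX
  have hmvX : mv < 2 ^ X := by nlinarith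
  have hkD : 2 * P.k + 1 ≤ P.D := by unfold Data.D; nlinarith
  have htest : ∀ s'' : State, s'' 17 0 = mv → ((var 17 - lit P.k : Expr).eval s'' = 0 ↔ mv = P.k) := by
    intro s'' h
    simp only [eval_sub, eval_var, eval_lit, h]
    omega
  have hcr : s' 18 0 < (P.k + 1) * 2 ^ P.lev u := hT.credit_lt
  have hcr' : s' 18 0 + P.k * 2 ^ P.lev u < 2 ^ X := by
    have : (2 * P.k + 1) * 2 ^ P.lev u ≤ P.D * 2 ^ P.lev u := Nat.mul_le_mul_right _ hkD
    nlinarith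
  have hcr2 : (mv + 1) * 2 ^ P.lev u - 1 < 2 ^ X := by
    have : (mv + 1) * 2 ^ P.lev u ≤ P.D * 2 ^ P.lev u := Nat.mul_le_mul_right _ h2
    have : P.D * 2 ^ P.lev u < 2 ^ X := by nlinarith
    omega
  have he20 : (Expr.cond (var 17 - lit P.k) (var 17) (lit 0)).eval s' =
      if mv = P.k then 0 else mv := by
    rw [Expr.eval_cond]
    simp only [htest s' h17, eval_var, eval_lit, h17]
  refine (Runs.set_seq (T := 6 * P.m + 4) ?_ ?_).mono le_rfl fun _ h => h
  · rw [he20]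
    split_ifs <;> omega
  rw [he20, eval_lit]
  set s₁ := s'.write 20 0 (if mv = P.k then 0 else mv) with hs₁
  have hag₁ : State.Agree [1, 9, 12, 16, 17, 18, 19, 20] s s₁ := hag.write (by simp) _ _
  have hst₁ := hs.of_agree hag₁ (by simp)
  have he19 : (Expr.cond (var 17 - lit P.k)
        ((var 17 + lit 1) * .get 6 (Expr.levE P.k (var 16)) - lit 1)
        (var 18 + lit P.k * .get 6 (Expr.levE P.k (var 16)))).eval s₁ =
      if mv = P.k then s' 18 0 + P.k * 2 ^ P.lev u else (mv + 1) * 2 ^ P.lev u - 1 := by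
    have h17' : s₁ 17 0 = mv := by rw [hs₁, State.write_of_ne (by norm_num), h17]
    have h16' : s₁ 16 0 = u := by rw [hs₁, State.write_of_ne (by norm_num), hu]
    have h18' : s₁ 18 0 = s' 18 0 := by rw [hs₁, State.write_of_ne (by norm_num)]
    rw [Expr.eval_cond]
    simp only [show mv - P.k = 0 ↔ mv = P.k by omega, eval_var, eval_lit, h17', eval_add, eval_sub,
      eval_mul, eval_get, hst₁.eval_levE, h16', hst₁.two _ huL, h18']
  refine (Runs.set_seq (T := 6 * P.m + 3) ?_ ?_).mono le_rfl fun _ h => h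
  · rw [he19]
    split_ifs <;> omega
  rw [he19, eval_lit]
  set s₂ := s₁.write 19 0 (if mv = P.k then s' 18 0 + P.k * 2 ^ P.lev u
    else (mv + 1) * 2 ^ P.lev u - 1) with hs₂
  have hag₂ : State.Agree [1, 9, 12, 16, 17, 18, 19, 20] s s₂ := hag₁.write (by simp) _ _
  have hst₂ := hs.of_agree hag₂ (by simp)
  have h16₂ : s₂ 16 0 = u := by simp [hs₂, hs₁, State.write_of_ne, hu]
  have h17₂ : s₂ 17 0 = mv := by simp [hs₂, hs₁, State.write_of_ne, h17]
  have h20₂ : s₂ 20 0 = if mv = P.k then 0 else mv := by simp [hs₂, hs₁, State.write_of_ne]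
  have h19₂ : s₂ 19 0 = if mv = P.k then s' 18 0 + P.k * 2 ^ P.lev u
    else (mv + 1) * 2 ^ P.lev u - 1 := by simp [hs₂]
  have h1₂ : s₂ 1 = s' 1 := by simp [hs₂, hs₁, State.write_of_ne]
  have h9₂ : s₂ 9 = s' 9 := by simp [hs₂, hs₁, State.write_of_ne]
  have h18₂ : s₂ 18 0 = s' 18 0 := by simp [hs₂, hs₁, State.write_of_ne]
  have h5₂ : s₂ 5 = s 5 := hag₂ 5 (by simp)
  have h19X : s₂ 19 0 < 2 ^ X := by
    rw [h19₂]
    split_ifs <;> omega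
  refine (Runs.seq (runs_pass hst₂ h16₂ huL h17₂ h20₂ hmX
    (by rw [h5₂]; exact (hord _ hagt).trans hnX) h19X) (T' := 1) ?_).mono (by omega) fun _ h => h
  rintro s₃ ⟨hag₃, Q, hQ, h1₃, h9₃, hsum, hmax⟩
  have h17₃ : s₃ 17 0 = mv := by rw [hag₃ 17 (by simp), h17₂]
  have h18₃ : s₃ 18 0 = s' 18 0 := by rw [hag₃ 18 (by simp), h18₂]
  have he18 : (Expr.cond (var 17 - lit P.k) (var 18) (var 19)).eval s₃ =
      if mv = P.k then s₃ 19 0 else s' 18 0 := by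
    rw [Expr.eval_cond]
    simp only [htest s₃ h17₃, eval_var, h18₃]
  have hQF : Q ⊆ free P s' := fun j hj => by
    have := hQ j hj
    simp only [free, Finset.mem_filter, Finset.mem_range]
    exact ⟨this.1, h9₂ ▸ this.2.1⟩
  refine Runs.set ?_ ?_
  · rw [he18]
    split_ifs <;> omega
  rw [he18, eval_lit]
  have hag₄ : State.Agree [1, 9, 12, 16, 17, 18, 19, 20] s s₃ := hag₂.trans (hag₃.mono (by simp))
  refine ⟨hag₄.write (by simp) _ _, ?_, ?_, ?_, ?_⟩
  · rw [State.write_of_ne (by norm_num), hag₃ 16 (by simp), h16₂]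
  · rw [State.write_of_ne (by norm_num), h17₃]
  · intro j
    rw [State.write_of_ne (by norm_num), h1₃]
    simp only
    split_ifs
    · rw [h5₂]; exact hord _ hagt
    · rw [h1₂]; exact hx j
  · have hfree : free P (s₃.write 18 0 (if mv = P.k then s₃ 19 0 else s' 18 0)) =
        free P s' \ Q := by
      ext j
      simp only [free, Finset.mem_filter, Finset.mem_sdiff, State.write_of_ne, ne_eq,
        Nat.reduceEqDiff, not_false_eq_true, h9₃, h9₂]
      by_cases hj : j ∈ Q <;> simp [hj]
    rw [hfree, State.write_of_ne (by norm_num), h1₃, h1₂, h5₂, State.write_same,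
      Function.update_self]
    refine hT.take hA hk hmv hmvk hQF (fun j hj => (hQ j hj).2.2) (hsum.trans h19₂) ?_
    intro j hj h6 h7 h8
    simp only [free, Finset.mem_filter, Finset.mem_range] at hj
    exact hmax j hj.1 (h9₂ ▸ hj.2) h6 h7 h8

theorem runs_move {X u : ℕ} {P : Data} (hk : 8 ≤ P.k) {s s' : State} (hs : Holds P s)
    (hA : P.IsTable (s 8)) (hord : ∀ i < P.n, s 5 i < P.n) (hmX : P.m < 2 ^ X) (hnX : P.n < 2 ^ X)
    (hLX : (P.D + 1) * 2 ^ P.L ≤ 2 ^ X) (hNX : P.NS < 2 ^ X) (h : Following P s s')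
    (hu : s' 16 0 = u) (hmv : s 8 u % P.D ≠ 0) :
    Runs X (Prog.move P.k) s' (6 * P.m + 8) (fun s'' => Following P s s'' ∧
      s'' 16 0 = P.next u (s 8 u % P.D) ∧ s'' 16 0 < P.NS) := by
  have hag := h.1
  have hT := h.2.2
  rw [hu] at hT
  obtain ⟨h1, h2, h3, -, h4⟩ := Data.move_spec hA hT.ne_zero
  obtain ⟨mv, hmvd⟩ : ∃ mv, s 8 u % P.D = mv := ⟨_, rfl⟩
  rw [hmvd] at hmv h2 h3 h4 ⊢
  have hnext : P.next u mv < P.NS := by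
    by_contra hcon
    have := (h4 hmv).1
    rw [hA.2 _ (by omega), Nat.zero_div] at this
    exact lt_irrefl _ this
  have hmvX : mv < 2 ^ X := by
    have : 0 < 2 ^ P.L := by positivity
    nlinarith
  have he17 : (Expr.moveE P.k).eval s' = mv := by
    simp only [Expr.moveE, Expr.eval_mod, eval_get, eval_var, hu, hag 8 (by simp)]
    exact hmvd
  refine (Runs.set_seq (T := 6 * P.m + 7) (by rw [he17]; exact hmvX) ?_).mono le_rfl fun _ h => h
  rw [he17, eval_lit]
  set s₁ := s'.write 17 0 mv with hs₁
  have hag₁ : State.Agree [1, 9, 12, 16, 17, 18, 19, 20] s s₁ := hag.write (by simp) _ _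
  have h1₁ : s₁ 1 = s' 1 := by simp [hs₁, State.write_of_ne]
  have h17₁ : s₁ 17 0 = mv := by simp [hs₁]
  have h16₁ : s₁ 16 0 = u := by simp [hs₁, State.write_of_ne, hu]
  have hfree : free P s₁ = free P s' := by simp [free, hs₁, State.write_of_ne]
  have h18₁ : s₁ 18 0 = s' 18 0 := by simp [hs₁, State.write_of_ne]
  have hF : Following P s s₁ := ⟨hag₁, h1₁ ▸ h.2.1, by rw [hfree, h1₁, h18₁, h16₁]; exact hT⟩
  refine (Runs.seq (T := 6 * P.m + 6) (T' := 1) (R := fun s'' =>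
      State.Agree [1, 9, 12, 16, 17, 18, 19, 20] s s'' ∧ s'' 16 0 = u ∧ s'' 17 0 = mv ∧
        (∀ j, s'' 1 j < P.n) ∧
        P.Track (s 8) (s 5) (free P s'') (s'' 1) (s'' 18 0) (P.next u mv)) ?_ ?_).mono (by omega)
        fun _ h => h
  · refine Runs.ite (T := 6 * P.m + 5) (fun he => ?_) fun he => ?_
    · simp only [Expr.eval_le, eval_lit, eval_var, h17₁, ne_eq, ite_eq_right_iff, one_ne_zero,
        imp_false, not_not] at he
      exact runs_take hk hs hA hord hmX hnX hLX hF h16₁ h17₁ hmvd he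
    · simp only [Expr.eval_le, eval_lit, eval_var, h17₁, ite_eq_right_iff, one_ne_zero,
        imp_false] at he
      refine (Runs.set ?_ ⟨hag₁.write (by simp) _ _, ?_, ?_, ?_, ?_⟩).mono (by omega) fun _ h => h
      · rw [eval_lit]; positivity
      · rw [State.write_of_ne (by norm_num), h16₁]
      · rw [State.write_of_ne (by norm_num), h17₁]
      · rw [State.write_of_ne (by norm_num)]; exact hF.2.1
      · have hf : free P (s₁.write 18 ((lit 0 : Expr).eval s₁) ((lit 0 : Expr).eval s₁)) =
            free P s' := by
          rw [← hfree]
          simp [free, State.write_of_ne]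
        rw [hf, State.write_of_ne (by norm_num), h1₁, State.write_same, eval_lit,
          Function.update_self]
        -- Moves other than 0, 1, 2 are legal only from `k` on, so a nonzero move below `k` serves
        -- the agent or changes the level; both reset the credit.
        have hmv12 : mv = 1 ∨ mv = 2 := by
          unfold Data.Legal at h3
          by_contra hcon
          rw [if_neg hmv, if_neg (by tauto), if_neg (by tauto)] at h3
          exact he h3.1
        rcases hmv12 with rfl | rfl
        · exact hT.serve hA hk hmvd
        · exact hT.up hA hk hmvd
  · rintro s₂ ⟨hag₂, h16₂, h17₂, hx₂, hT₂⟩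
    have he16 : (Expr.nextE P.k (var 16) (var 17)).eval s₂ = P.next u mv := by
      have := (hs.of_agree hag₂ (by simp)).eval_nextE (var 16) (var 17) hk
      simp only [eval_var, h16₂, h17₂] at this
      exact this h2 h3
    refine Runs.set (by rw [he16]; omega) ?_
    rw [he16, eval_lit]
    refine ⟨⟨hag₂.write (by simp) _ _, ?_, ?_⟩, ?_, ?_⟩
    · rw [State.write_of_ne (by norm_num)]; exact hx₂
    · have hf : free P (s₂.write 16 0 (P.next u mv)) = free P s₂ := by
        simp [free, State.write_of_ne]
      rw [hf, State.write_of_ne (by norm_num), State.write_of_ne (by norm_num), State.write_same,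
        Function.update_self]
      exact hT₂
    · rw [State.write_same, Function.update_self]
    · rw [State.write_same, Function.update_self]
      exact hnext

/-- The state code increases with every move and stays below `NS`, so `NS - s 16 0` is a measure for
the loop. -/
theorem runs_follow {X : ℕ} {P : Data} (hk : 8 ≤ P.k) {s : State} (hs : Holds P s)
    (hA : P.IsTable (s 8)) (hord : ∀ i < P.n, s 5 i < P.n) (hn : 0 < P.n) (hmX : P.m < 2 ^ X)
    (hnX : P.n < 2 ^ X) (hLX : (P.D + 1) * 2 ^ P.L ≤ 2 ^ X) (hNX : P.NS < 2 ^ X)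
    (h1 : ∀ j, s 1 j = 0) (h9 : ∀ j, s 9 j = 0) (h18 : s 18 0 = 0) :
    Runs X (Prog.follow P.k) s (P.NS * (6 * P.m + 9) + 2) (fun s' => (∀ j, s' 1 j < P.n) ∧
      (s 8 0 ≠ 0 → ∃ a e : ℕ → ℕ,
        s 8 0 / P.D = 1 + ∑ i ∈ Finset.range P.n, P.gain (a i) i (e i) ∧
        ∀ i < P.n, P.k ^ 2 ≤ 2 * e i ∧ e i * 2 ^ a i * (P.k - 3) ≤
          (∑ j ∈ (Finset.range P.m).filter (fun j => s' 1 j = s 5 i), P.b j) * P.k)) := by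
  refine (Runs.set_seq (T := P.NS * (6 * P.m + 9) + 1) (by rw [eval_lit]; positivity) ?_).mono
    le_rfl fun _ h => h
  rw [eval_lit]
  set s₁ := s.write 16 0 0 with hs₁
  have hag₁ : State.Agree [1, 9, 12, 16, 17, 18, 19, 20] s s₁ :=
    (State.Agree.refl _ s).write (by simp) _ _
  have hx : ∀ j, s₁ 1 j < P.n := fun j => by rw [hs₁, State.write_of_ne (by norm_num), h1]; exact hn
  have h16₁ : s₁ 16 0 = 0 := by simp [hs₁]
  -- If no path is feasible the loop ends at once and every good stays with agent 0, which is still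
  -- an allocation.
  by_cases h0 : s 8 0 = 0
  · refine ⟨s₁, 1, .loop_false ?_, by omega, hx, fun h => absurd h0 h⟩
    simp [Expr.moveE, h16₁, hag₁ 8 (by simp), h0]
  · have hT : P.Track (s 8) (s 5) (free P s₁) (s₁ 1) (s₁ 18 0) (s₁ 16 0) := by
      have hf : free P s₁ = Finset.range P.m := by
        simp [free, hs₁, State.write_of_ne, h9]
      have h18₁ : s₁ 18 0 = 0 := by rw [hs₁, State.write_of_ne (by norm_num), h18]
      rw [hf, h18₁, h16₁]
      exact Data.Track.start hA hk h0 _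
    have he : ∀ s', Following P s s' → (Expr.moveE P.k).eval s' = s 8 (s' 16 0) % P.D := by
      intro s' h
      simp only [Expr.moveE, Expr.eval_mod, eval_get, eval_var, h.1 8 (by simp)]
      rfl
    have key := Runs.loop (X := X) (s := s₁) (e := Expr.moveE P.k) (p := Prog.move P.k)
      (T := 6 * P.m + 8) (Following P s) (fun s' => P.NS - s' 16 0) ?_ ⟨hag₁, hx, hT⟩
    · refine key.mono ?_ ?_
      · simp only [h16₁, Nat.sub_zero]
        exact le_rfl
      · rintro s' ⟨h2, h3⟩
        rw [he s' h2] at h3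
        refine ⟨h2.2.1, fun _ => ?_⟩
        obtain ⟨a, e, h4, h5⟩ := h2.2.2.finish hA h3
        refine ⟨a, e, h4, fun i hi => ⟨(h5 i hi).1, (h5 i hi).2.trans ?_⟩⟩
        refine Nat.mul_le_mul_right _ (Finset.sum_le_sum_of_subset fun j hj => ?_)
        simp only [Finset.mem_filter] at hj ⊢
        exact ⟨hj.1, hj.2.2⟩
    · intro s' h2 h3
      rw [he s' h2] at h3
      refine (runs_move hk hs hA hord hmX hnX hLX hNX h2 rfl h3).mono le_rfl ?_
      rintro s'' ⟨h4, h5, h6⟩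
      obtain ⟨h7, h8, -⟩ := Data.move_spec hA h2.2.2.ne_zero
      have := Data.lt_next (s := s' 16 0) h3 h8
      exact ⟨h4, by omega⟩

end Phases

end NashWelfare

namespace NashWelfare

/-! ### The whole program -/

section Phases

open NashWelfare.Expr (lit var eval_lit eval_var eval_get eval_add eval_mul eval_div eval_sub)

/-- The algorithm for instances with at least one good. -/
def Prog.main (k : ℕ) : Prog :=
  .seq (.scale (lit 2) Expr.mE (2 * k ^ 2) 2)
    (.seq (.scale (lit 2 + lit 2 * Expr.mE) Expr.nE 1 3)
      (.seq .total (.seq .levels (.seq (.counts k) (.seq (.powers k) (.seq .ranks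
        (.seq (.table k) (.follow k))))))))

/-- The algorithm. -/
def Prog.solve (k : ℕ) : Prog := .ite Expr.mE (.main k) .skip

theorem getD_pairs {n : ℕ} (f g : Fin n → ℕ) (j : Fin n) :
    ((List.ofFn fun j => [f j, g j]).flatten.getD (2 * j) 0 = f j) ∧
      ((List.ofFn fun j => [f j, g j]).flatten.getD (2 * j + 1) 0 = g j) := by
  induction n with
  | zero => exact j.elim0
  | succ n ih =>
    rw [List.ofFn_succ, List.flatten_cons]
    refine Fin.cases ?_ (fun i => ?_) j
    · simp
    · have := ih (fun j => f j.succ) (fun j => g j.succ) i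
      simp only [Fin.val_succ]
      rw [show 2 * ((i : ℕ) + 1) = 2 * i + 1 + 1 by ring]
      simpa using this

theorem length_pairs {n : ℕ} (f g : Fin n → ℕ) :
    (List.ofFn fun j => [f j, g j]).flatten.length = 2 * n := by
  induction n with
  | zero => simp
  | succ n ih =>
    rw [List.ofFn_succ, List.flatten_cons, List.length_append, ih]
    simp
    ring

namespace Inst

variable (I : Inst)

/-- The numerator of the value of good `j`. -/
def valueNum (j : ℕ) : ℕ := if h : j < I.m then (I.value ⟨j, h⟩).num else 0
/-- The denominator of the value of good `j`. -/
def valueDen (j : ℕ) : ℕ := if h : j < I.m then (I.value ⟨j, h⟩).den else 1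
/-- The numerator of the weight of agent `i`. -/
def weightNum (i : ℕ) : ℕ := if h : i < I.n then (I.weight ⟨i, h⟩).num else 0
/-- The denominator of the weight of agent `i`. -/
def weightDen (i : ℕ) : ℕ := if h : i < I.n then (I.weight ⟨i, h⟩).den else 1
/-- The common denominator of the values. -/
def valueScale : ℕ := ∏ j ∈ Finset.range I.m, I.valueDen j
/-- The common denominator of the weights. -/
def weightScale : ℕ := ∏ i ∈ Finset.range I.n, I.weightDen i
/-- The size of good `j` as an integer. -/
def sizeOf (k j : ℕ) : ℕ := 2 * k ^ 2 * I.valueNum j * (I.valueScale / I.valueDen j)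
/-- The weight of agent `i` as an integer. -/
def intWeight (i : ℕ) : ℕ := 1 * I.weightNum i * (I.weightScale / I.weightDen i)
/-- The total size of the goods. -/
def totalSize (k : ℕ) : ℕ := ∑ j ∈ Finset.range I.m, I.sizeOf k j

/-- The data of the dynamic program, for a given order of the agents. -/
def data (k : ℕ) (ord : ℕ → ℕ) : Data where
  k := k
  m := I.m
  n := I.n
  L := Nat.size (I.totalSize k)
  b := I.sizeOf k
  w := fun i => I.intWeight (ord i)

theorem init_zero (a i : ℕ) (h : a ≠ 0) : I.init a i = 0 := if_neg h

theorem init_m : I.init 0 1 = I.m := rfl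

theorem input_eq : I.input = I.n :: I.m ::
    ((List.ofFn fun j => [(I.value j).num, (I.value j).den]).flatten ++
      (List.ofFn fun i => [(I.weight i).num, (I.weight i).den]).flatten) := by
  simp [input]

theorem init_value {j : ℕ} (hj : j < I.m) :
    I.init 0 (2 + 2 * j) = I.valueNum j ∧ I.init 0 (2 + 2 * j + 1) = I.valueDen j := by
  have h := getD_pairs (fun j => (I.value j).num) (fun j => (I.value j).den) ⟨j, hj⟩
  have hl := length_pairs (fun j => (I.value j).num) (fun j => (I.value j).den)
  simp only at h
  unfold init valueNum valueDen
  rw [if_pos rfl, if_pos rfl, input_eq, dif_pos hj, dif_pos hj, ← h.1, ← h.2]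
  rw [show 2 + 2 * j = 2 * j + 1 + 1 by ring, show 2 * j + 1 + 1 + 1 = (2 * j + 1) + 1 + 1 by ring]
  simp only [List.getD_cons_succ]
  exact ⟨List.getD_append _ _ _ _ (by omega), List.getD_append _ _ _ _ (by omega)⟩

theorem init_weight {i : ℕ} (hi : i < I.n) :
    I.init 0 (2 + 2 * I.m + 2 * i) = I.weightNum i ∧
      I.init 0 (2 + 2 * I.m + 2 * i + 1) = I.weightDen i := by
  have h := getD_pairs (fun i => (I.weight i).num) (fun i => (I.weight i).den) ⟨i, hi⟩
  have hl := length_pairs (fun j => (I.value j).num) (fun j => (I.value j).den)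
  simp only at h
  unfold init weightNum weightDen
  rw [if_pos rfl, if_pos rfl, input_eq, dif_pos hi, dif_pos hi, ← h.1, ← h.2]
  rw [show 2 + 2 * I.m + 2 * i = 2 * I.m + 2 * i + 1 + 1 by ring,
    show 2 * I.m + 2 * i + 1 + 1 + 1 = (2 * I.m + 2 * i + 1) + 1 + 1 by ring]
  simp only [List.getD_cons_succ]
  rw [List.getD_append_right _ _ _ _ (by omega), List.getD_append_right _ _ _ _ (by omega), hl,
    Nat.add_sub_cancel_left, show 2 * I.m + 2 * i + 1 - 2 * I.m = 2 * i + 1 by omega]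
  exact ⟨rfl, rfl⟩

theorem valueDen_pos (j : ℕ) : 0 < I.valueDen j := by
  unfold valueDen
  split_ifs
  · exact NNRat.den_pos _
  · exact one_pos

theorem weightDen_pos (i : ℕ) : 0 < I.weightDen i := by
  unfold weightDen
  split_ifs
  · exact NNRat.den_pos _
  · exact one_pos

/-- All numbers that occur in the computation have at most `X` bits. -/
structure FitsIn (k X : ℕ) : Prop where
  n_lt : I.n < 2 ^ X
  m_lt : I.m < 2 ^ X
  valueScale_lt : I.valueScale < 2 ^ X
  weightScale_lt : I.weightScale < 2 ^ X
  intWeight_lt : ∀ i < I.n, I.intWeight i < 2 ^ X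
  totalSize_lt : I.totalSize k < 2 ^ X
  width_lt : ∀ ord, (I.data k ord).W < 2 ^ X
  states_lt : ∀ ord, (I.data k ord).NS < 2 ^ X
  two_pow_le : ∀ ord, ((I.data k ord).D + 1) * 2 ^ (I.data k ord).L ≤ 2 ^ X
  table_le : ∃ G, ∀ ord : ℕ → ℕ, (∀ i < I.n, ord i < I.n) →
    (∀ ℓ < (I.data k ord).L, ∀ i < I.n, ∀ N ≤ (I.data k ord).D, (I.data k ord).gain ℓ i N ≤ G) ∧
      (2 + (I.data k ord).NS * G) * (I.data k ord).D ≤ 2 ^ X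

end Inst

theorem rankOf_lt {n : ℕ} {w : ℕ → ℕ} {i : ℕ} (hi : i < n) : rankOf n w i < n := by
  have h : ((Finset.range n).filter fun j => rankKey n w j < rankKey n w i) ⊂
      Finset.range n := by
    refine ⟨Finset.filter_subset _ _, fun h => ?_⟩
    have := h (Finset.mem_range.2 hi)
    simp at this
  simpa [rankOf] using Finset.card_lt_card h

theorem exists_rank {n : ℕ} {w : ℕ → ℕ} {r : ℕ} (hr : r < n) : ∃ i < n, rankOf n w i = r := by
  obtain ⟨i, hi, h⟩ := Finset.surj_on_of_inj_on_of_card_le (s := Finset.range n)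
    (t := Finset.range n) (fun i _ => rankOf n w i)
    (fun i hi => Finset.mem_range.2 (rankOf_lt (Finset.mem_range.1 hi)))
    (fun i j hi hj h => rankOf_inj (Finset.mem_range.1 hi) (Finset.mem_range.1 hj) h) le_rfl r
    (Finset.mem_range.2 hr)
  exact ⟨i, Finset.mem_range.1 hi, h.symm⟩

/-- The number of steps of the algorithm. -/
def stepBound (P : Data) : ℕ :=
  (6 * P.m + 5) + (6 * P.n + 5) + (3 * P.m + 2) + (3 * P.L + 2) + (P.L * P.D * (3 * P.m + 4) + 2) +
    (3 * P.D + 3) + (P.n * (3 * P.n + 5) + 2) + (P.NS * (3 * P.D + 5) + 2) +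
    (P.NS * (6 * P.m + 9) + 2)

/-- The order of the agents is known only after ranking, when it is read from array 5. The step
bound may use `id` instead, because all sizes except the weights are independent of the order. -/
theorem runs_main {k X : ℕ} (hk : 8 ≤ k) (I : Inst) (hX : I.FitsIn k X) :
    Runs X (Prog.main k) I.init (stepBound (I.data k id)) (fun s => (∀ j, s 1 j < I.n) ∧
      ∃ ord : ℕ → ℕ, (∀ i < I.n, ord (rankOf I.n I.intWeight i) = i) ∧
      ∃ A : ℕ → ℕ, (I.data k ord).IsTable A ∧ (A 0 ≠ 0 → ∃ a e : ℕ → ℕ,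
        A 0 / (2 * k ^ 2) = 1 + ∑ i ∈ Finset.range I.n, (I.data k ord).gain (a i) i (e i) ∧
        ∀ i < I.n, k ^ 2 ≤ 2 * e i ∧ e i * 2 ^ a i * (k - 3) ≤
          (∑ j ∈ (Finset.range I.m).filter (fun j => s 1 j = ord i), I.sizeOf k j) * k)) := by
  have hD0 : 0 < 2 * k ^ 2 := by positivity
  have hDX : 2 * k ^ 2 < 2 ^ X := by
    have h1 := hX.two_pow_le id
    have h2 : (I.data k id).D = 2 * k ^ 2 := rfl
    have h3 : 0 < 2 ^ (I.data k id).L := by positivity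
    rw [h2] at h1
    nlinarith
  have hLX : 2 ^ Nat.size (I.totalSize k) < 2 ^ X := by
    have h1 := hX.two_pow_le id
    have h2 : (I.data k id).D = 2 * k ^ 2 := rfl
    have h3 : (I.data k id).L = Nat.size (I.totalSize k) := rfl
    have h4 : 0 < 2 ^ (I.data k id).L := by positivity
    rw [h2] at h1
    rw [← h3]
    nlinarith
  have hLDX : (I.data k id).L * (I.data k id).D < 2 ^ X := by
    refine lt_of_le_of_lt ?_ (hX.states_lt id)
    unfold Data.NS
    have h1 := Data.W_pos (P := I.data k id)
    calc (I.data k id).L * (I.data k id).D = (I.data k id).L * 1 * (I.data k id).D * 1 := by ring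
      _ ≤ _ := by gcongr <;> omega
  have hsize : ∀ j < I.m, I.sizeOf k j < 2 ^ X := fun j hj =>
    (Finset.single_le_sum (f := I.sizeOf k) (fun _ _ => Nat.zero_le _)
      (Finset.mem_range.2 hj)).trans_lt hX.totalSize_lt
  have e1 : (I.data k id).m = I.m := rfl
  have e2 : (I.data k id).n = I.n := rfl
  refine (Runs.seq (runs_scale (off₀ := 2) (num := I.valueNum) (den := I.valueDen) (by norm_num)
    (by norm_num) (by norm_num) (fun _ _ => rfl) (N := I.m) (fun s' h => ?_)
    (fun j hj => (I.init_value hj).1) (fun j hj => (I.init_value hj).2)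
    (fun j _ => I.valueDen_pos j) hX.m_lt hX.valueScale_lt hsize)
    (T' := stepBound (I.data k id) - (6 * I.m + 5)) ?_).mono ?_ fun _ h => h
  · simp only [Expr.mE, eval_get, eval_lit, h]; rfl
  swap
  · simp only [stepBound, e1, e2]
    omega
  rintro s₁ ⟨hag₁, h2₁⟩
  have h0₁ : s₁ 0 = I.init 0 := hag₁ 0 (by simp)
  refine (Runs.seq (runs_scale (off₀ := 2 + 2 * I.m) (num := I.weightNum) (den := I.weightDen)
    (by norm_num) (by norm_num) (by norm_num) (fun s' h => ?_) (N := I.n) (fun s' h => ?_)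
    (fun i hi => by rw [h0₁]; exact (I.init_weight hi).1)
    (fun i hi => by rw [h0₁]; exact (I.init_weight hi).2)
    (fun j _ => I.weightDen_pos j) hX.n_lt hX.weightScale_lt hX.intWeight_lt)
    (T' := stepBound (I.data k id) - (6 * I.m + 5) - (6 * I.n + 5)) ?_).mono ?_ fun _ h => h
  · simp only [Expr.mE, eval_get, eval_lit, eval_add, eval_mul, h, h0₁]; rfl
  · simp only [Expr.nE, eval_get, eval_lit, h, h0₁]; rfl
  swap
  · simp only [stepBound, e1, e2]
    omega
  rintro s₂ ⟨hag₂, h3₂⟩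
  have h0₂ : s₂ 0 = I.init 0 := by rw [hag₂ 0 (by simp), h0₁]
  have h2₂ : ∀ j < I.m, s₂ 2 j = I.sizeOf k j := fun j hj => by
    rw [hag₂ 2 (by simp), h2₁]
    exact if_pos hj
  have h3₂' : ∀ i < I.n, s₂ 3 i = I.intWeight i := fun i hi => by
    rw [h3₂]
    exact if_pos hi
  have hz₂ : ∀ a i, a ∉ [0, 2, 3, 11, 12] → s₂ a i = 0 := fun a i ha => by
    simp only [List.mem_cons, not_or] at ha
    rw [hag₂ a (by simp; tauto), hag₁ a (by simp; tauto), I.init_zero _ _ ha.1]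
  clear hag₁ hag₂ h2₁ h3₂ h0₁ s₁
  refine (Runs.seq (runs_total (m := I.m) (b := I.sizeOf k) (by rw [h0₂]; rfl) h2₂
    (hz₂ _ _ (by simp)) hX.m_lt hX.totalSize_lt)
    (T' := stepBound (I.data k id) - (6 * I.m + 5) - (6 * I.n + 5) - (3 * I.m + 2)) ?_).mono
    ?_ fun _ h => h
  swap
  · simp only [stepBound, e1, e2]
    omega
  rintro s₃ ⟨hag₃, h14₃⟩
  have h0₃ : s₃ 0 = I.init 0 := by rw [hag₃ 0 (by simp), h0₂]
  have hL₃ : Nat.size (s₃ 14 0) = (I.data k id).L := by rw [h14₃]; rfl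
  refine (Runs.seq (runs_levels (s := s₃) (by rw [hag₃ 15 (by simp)]; exact hz₂ _ _ (by simp))
    (by rw [h14₃]; exact hLX)) (T' := ((I.data k id).L * (I.data k id).D * (3 * I.m + 4) + 2) +
    ((3 * (I.data k id).D + 3) + ((I.n * (3 * I.n + 5) + 2) +
      (((I.data k id).NS * (3 * (I.data k id).D + 5) + 2) +
        ((I.data k id).NS * (6 * I.m + 9) + 2))))) ?_).mono ?_ fun _ h => h
  swap
  · rw [hL₃]
    simp only [stepBound, e1, e2]
    omega
  rw [hL₃]
  rintro s₄ ⟨hag₄, h15₄, h6₄⟩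
  have hag₄' : State.Agree [12, 14, 6, 15] s₂ s₄ :=
    (hag₃.mono (by simp)).trans (hag₄.mono (by simp))
  refine Runs.seq (runs_counts (P := I.data k id) hk (by rw [hag₄' 0 (by simp), h0₂]; rfl) h15₄
    (fun j hj => by rw [hag₄' 2 (by simp)]; exact h2₂ j hj) h6₄
    (fun t => by rw [hag₄' 7 (by simp)]; exact hz₂ _ _ (by simp)) hX.m_lt hLDX) ?_
  rintro s₅ ⟨hag₅, h7₅⟩
  refine Runs.seq (runs_powers (P := I.data k id)
    (by rw [hag₅ 0 (by simp), hag₄' 0 (by simp), h0₂]; rfl) hDX (hX.width_lt id)) ?_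
  rintro s₆ ⟨hag₆, h10₆⟩
  have hag₆' : State.Agree [12, 14, 6, 15, 7, 13, 10] s₂ s₆ :=
    ((hag₄'.mono (by simp)).trans (hag₅.mono (by simp))).trans (hag₆.mono (by simp))
  refine Runs.seq (runs_ranks (n := I.n) (w := I.intWeight) (by rw [hag₆' 0 (by simp), h0₂]; rfl)
    (fun i hi => by rw [hag₆' 3 (by simp)]; exact h3₂' i hi)
    (fun t => by rw [hag₆' 4 (by simp)]; exact hz₂ _ _ (by simp)) hX.n_lt) ?_
  rintro s₇ ⟨hag₇, h5₇⟩
  have hag₇' : State.Agree [12, 14, 6, 15, 7, 13, 10, 4, 5] s₂ s₇ :=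
    (hag₆'.mono (by simp)).trans (hag₇.mono (by simp))
  have hord : ∀ r < I.n, s₇ 5 r < I.n := by
    intro r hr
    obtain ⟨i, hi, rfl⟩ := exists_rank (w := I.intWeight) hr
    rw [h5₇ i hi]
    exact hi
  have hH : Holds (I.data k (s₇ 5)) s₇ := by
    constructor
    · rw [hag₇' 0 (by simp), h0₂]; rfl
    · rw [hag₇' 0 (by simp), h0₂]; rfl
    · rw [hag₇ 10 (by simp)]; exact h10₆
    · rw [hag₇ 15 (by simp), hag₆ 15 (by simp), hag₅ 15 (by simp)]; exact h15₄
    · rw [hag₇ 7 (by simp), hag₆ 7 (by simp)]; exact h7₅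
    · intro i hi
      rw [hag₇' 3 (by simp)]
      exact h3₂' _ (hord i hi)
    · rw [hag₇' 2 (by simp)]; exact h2₂
    · rw [hag₇ 6 (by simp), hag₆ 6 (by simp), hag₅ 6 (by simp)]
      exact fun ℓ hℓ => h6₄ ℓ (le_of_lt hℓ)
  obtain ⟨G, hG⟩ := hX.table_le
  refine Runs.seq (runs_table (P := I.data k (s₇ 5)) hk hH
    (fun u => by rw [hag₇' 8 (by simp)]; exact hz₂ _ _ (by simp)) (hG _ hord).1 (hG _ hord).2
    (hX.states_lt _)) ?_
  rintro s₈ ⟨hag₈, hA, -⟩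
  have h5₈ : s₈ 5 = s₇ 5 := hag₈ 5 (by simp)
  have hz₈ : ∀ a ∈ [1, 9, 18], ∀ i, s₈ a i = 0 := by
    intro a ha i
    simp only [List.mem_cons, List.not_mem_nil, or_false] at ha
    rcases ha with rfl | rfl | rfl
    all_goals
      rw [hag₈ _ (by simp), hag₇' _ (by simp)]
      exact hz₂ _ _ (by simp)
  refine (runs_follow (P := I.data k (s₇ 5)) hk (hH.of_agree hag₈ (by simp)) hA
    (by rw [h5₈]; exact hord) I.n_pos hX.m_lt hX.n_lt (hX.two_pow_le _) (hX.states_lt _)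
    (hz₈ 1 (by simp)) (hz₈ 9 (by simp)) (hz₈ 18 (by simp) 0)).mono le_rfl ?_
  rintro s₉ ⟨h1₉, h9⟩
  rw [h5₈] at h9
  exact ⟨h1₉, s₇ 5, h5₇, s₈ 8, hA, h9⟩

end Phases

end NashWelfare

namespace NashWelfare

/-! ### The size of the program -/

theorem log_two_pow_le (c k : ℕ) : Nat.log 2 (c ^ k) ≤ c * k :=
  calc Nat.log 2 (c ^ k) ≤ Nat.log 2 (2 ^ (c * k)) := by
        rw [pow_mul]
        exact Nat.log_mono_right (Nat.pow_le_pow_left c.lt_two_pow_self.le _)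
    _ = c * k := Nat.log_pow (by norm_num) _

namespace Expr

theorem nodes_digitE (k : ℕ) (S M : Expr) :
    (digitE k S M).nodes = 4 * S.nodes + 2 * M.nodes + 33 := by
  simp [digitE, conE, widthE, classesE, radixE, mE]
  ring

theorem nodes_levE (k : ℕ) (S : Expr) : (levE k S).nodes = S.nodes + 10 := by
  simp [levE, widthE, classesE, nE]

theorem nodes_agtE (k : ℕ) (S : Expr) : (agtE k S).nodes = 2 * S.nodes + 21 := by
  simp [agtE, widthE, classesE, nE]
  ring

theorem nodes_upE_le (k : ℕ) (S : Expr) (c : ℕ) :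
    (upE k S c).nodes ≤ (4 * S.nodes + 38) * (k + 2) + 8 * S.nodes + 91 := by
  have h1 := nodes_sum_le (fun d => lit (k + d) * digitE k S (lit (k + d))) (List.range (k + 2))
    (4 * S.nodes + 37) fun d _ => by
      simp only [nodes_mul, nodes_lit, nodes_digitE]
      omega
  rw [List.length_range, mul_comm, show 4 * S.nodes + 37 + 1 = 4 * S.nodes + 38 by ring] at h1
  have h2 : radixE.nodes = 6 := by simp [radixE, mE]
  unfold upE
  rw [nodes_min, nodes_sub, nodes_lit, h2]
  generalize (4 * S.nodes + 38) * (k + 2) = t at h1 ⊢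
  split_ifs
  · rw [nodes_lit]; omega
  · rw [nodes_div, nodes_lit]; omega
  · simp only [nodes_add, nodes_digitE, nodes_lit]; omega
  · simp only [nodes_get, nodes_add, nodes_mul, nodes_levE, classesE, nodes_lit]; omega

theorem nodes_encodeUpE_le (k : ℕ) (S : Expr) : (encodeUpE k S).nodes ≤
    2 * k ^ 2 * ((4 * S.nodes + 38) * (k + 2) + 8 * S.nodes + 95) + 1 := by
  have h := nodes_sum_le (fun c => upE k S c * get 10 (lit c)) (List.range (2 * k ^ 2))
    ((4 * S.nodes + 38) * (k + 2) + 8 * S.nodes + 94) fun c _ => by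
      have := nodes_upE_le k S c
      simp only [nodes_mul, nodes_lit, nodes_get]
      omega
  rwa [List.length_range] at h

theorem nodes_gainE_le (k : ℕ) (S : Expr) :
    (gainE k S).nodes ≤ (2 * k ^ 2 + 1) * (4 * S.nodes + 34) + 3 * S.nodes + 38 := by
  have h1 : (nomE k S).nodes = 2 * S.nodes + 11 := by
    simp [nomE, widthE, classesE]; ring
  have h3 := nodes_sum_le (fun c => eq (nomE k S) (lit c) * lit (Nat.log 2 (c ^ k)))
    (List.range (2 * k ^ 2 + 1)) (4 * S.nodes + 33) fun c _ => by
      simp only [nodes_mul, nodes_lit, nodes_eq, h1]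
      omega
  rw [List.length_range, show 4 * S.nodes + 33 + 1 = 4 * S.nodes + 34 by ring] at h3
  unfold gainE lookup
  simp only [nodes_mul, nodes_get, nodes_add, nodes_lit, nodes_levE, nodes_agtE]
  omega

/-- The cubic term comes from re-encoding a vector when the level changes: `2k²` digits, each with
an expression of size `O(k)` at most. -/
theorem nodes_nextE_le {k : ℕ} (hk : 8 ≤ k) (a : ℕ) :
    (nextE k (var 16) (var a)).nodes ≤ 150 * k ^ 3 + 500 := by
  have h1 := nodes_encodeUpE_le k (var 16)
  have h2 : 2 * k ^ 2 * ((4 * (var 16).nodes + 38) * (k + 2) + 8 * (var 16).nodes + 95) + 1 ≤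
      150 * k ^ 3 + 1 := by
    rw [nodes_var]
    have : 8 * k ^ 2 ≤ k ^ 3 := by rw [pow_succ k 2, mul_comm]; gcongr
    nlinarith
  simp only [nextE, codeE, conE, agtE, levE, widthE, classesE, nE, nodes_cond, nodes_eq, nodes_add,
    nodes_mul, nodes_sub, nodes_div, nodes_mod, nodes_get, nodes_lit, nodes_var]
  omega

theorem nodes_entryE_le {k : ℕ} (hk : 8 ≤ k) :
    (entryE k (var 16) (var 12)).nodes ≤ 1000 * k ^ 3 - 100 := by
  have h1 := nodes_nextE_le hk 12
  have h2 := nodes_gainE_le k (var 16)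
  have h3 : (2 * k ^ 2 + 1) * (4 * (var 16).nodes + 34) + 3 * (var 16).nodes + 38 ≤
      11 * k ^ 3 + 100 := by
    rw [nodes_var]
    have : 8 * k ^ 2 ≤ k ^ 3 := by rw [pow_succ k 2, mul_comm]; gcongr
    nlinarith
  have h4 : (legalE k (var 16) (var 12)).nodes ≤ 1000 := by
    simp only [legalE, digitE, nomE, conE, agtE, levE, widthE, classesE, radixE, mE, nE, nodes_cond,
      nodes_eq, nodes_le, nodes_add, nodes_mul, nodes_div, nodes_mod, nodes_get,
      nodes_lit, nodes_var]
    norm_num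
  have h5 : 512 ≤ k ^ 3 := by
    calc 512 = 8 ^ 3 := by norm_num
      _ ≤ k ^ 3 := by gcongr
  simp only [entryE, classesE, nodes_cond, nodes_eq, nodes_le, nodes_add, nodes_mul, nodes_div,
    nodes_get, nodes_lit, nodes_var]
  omega

section Literals

variable {k M : ℕ} (hk : 8 ≤ k) (hM : 2 * k ^ 3 < M) {S T : Expr}
include hk hM

/-- The threshold `2k³` is dictated by the tabulated logarithms: `⌊log₂ N^k⌋ ≤ Nk` with `N ≤ 2k²`.
-/
theorem literal_bounds : 2 < M ∧ k < M ∧ k ^ 2 < M ∧ 2 * k < M ∧ 2 * k ^ 2 < M ∧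
    2 * k ^ 2 + 1 < M := by
  have h1 : 8 * k ^ 2 ≤ k ^ 3 := by rw [pow_succ k 2, mul_comm]; gcongr
  have h2 : 8 * k ≤ k ^ 2 := by rw [sq]; gcongr
  omega

theorem litsBelow_digitE (hS : S.LitsBelow M) (hT : T.LitsBelow M) :
    (digitE k S T).LitsBelow M := by
  obtain ⟨h2, -, -, -, h5, -⟩ := literal_bounds hk hM
  simp [digitE, conE, widthE, classesE, radixE, mE, hS, hT, h5]
  omega

theorem litsBelow_levE (hS : S.LitsBelow M) : (levE k S).LitsBelow M := by
  obtain ⟨h2, -, -, -, h5, h6⟩ := literal_bounds hk hM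
  simp [levE, widthE, classesE, nE, hS, h5, h6]
  omega

theorem litsBelow_agtE (hS : S.LitsBelow M) : (agtE k S).LitsBelow M := by
  obtain ⟨h2, -, -, -, h5, h6⟩ := literal_bounds hk hM
  simp [agtE, widthE, classesE, nE, hS, h5, h6]
  omega

theorem litsBelow_nomE (hS : S.LitsBelow M) : (nomE k S).LitsBelow M := by
  obtain ⟨h2, -, -, -, h5, h6⟩ := literal_bounds hk hM
  simp [nomE, widthE, classesE, hS, h5, h6]

theorem litsBelow_conE (hS : S.LitsBelow M) : (conE k S).LitsBelow M := by
  obtain ⟨h2, -, -, -, h5, h6⟩ := literal_bounds hk hM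
  simp [conE, widthE, classesE, hS, h5]

theorem litsBelow_upE (hS : S.LitsBelow M) {c : ℕ} (hc : c < 2 * k ^ 2) :
    (upE k S c).LitsBelow M := by
  obtain ⟨h2, h3, h4, h5, h6, h7⟩ := literal_bounds hk hM
  have h8 : 8 * k ≤ k ^ 2 := by rw [sq]; gcongr
  have hd : ∀ d, d < M → (digitE k S (lit d)).LitsBelow M := fun d hd =>
    litsBelow_digitE hk hM hS hd
  unfold upE
  rw [litsBelow_min]
  constructor
  · simp only [radixE, mE, litsBelow_sub, litsBelow_add, litsBelow_mul, litsBelow_get,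
      litsBelow_lit]
    omega
  · split_ifs
    · rw [litsBelow_lit]; omega
    · rw [litsBelow_div]
      refine ⟨litsBelow_sum M (by omega) _ _ fun d hd' => ?_, h5⟩
      rw [List.mem_range] at hd'
      exact ⟨show k + d < M by omega, hd _ (by omega)⟩
    · exact ⟨hd _ (by omega), hd _ (by omega)⟩
    · simp only [classesE, litsBelow_get, litsBelow_add, litsBelow_mul, litsBelow_lit]
      exact ⟨⟨⟨litsBelow_levE hk hM hS, by omega⟩, h6⟩, by omega⟩

theorem litsBelow_encodeUpE (hS : S.LitsBelow M) : (encodeUpE k S).LitsBelow M := by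
  obtain ⟨h2, h3, h4, h5, h6, h7⟩ := literal_bounds hk hM
  refine litsBelow_sum M (by omega) _ _ fun c hc => ?_
  rw [List.mem_range] at hc
  exact ⟨litsBelow_upE hk hM hS hc, show c < M by omega⟩

theorem litsBelow_gainE (hS : S.LitsBelow M) : (gainE k S).LitsBelow M := by
  obtain ⟨h2, h3, h4, h5, h6, h7⟩ := literal_bounds hk hM
  simp only [gainE, litsBelow_mul, litsBelow_add, litsBelow_get, litsBelow_lit]
  refine ⟨litsBelow_agtE hk hM hS, ⟨h3, litsBelow_levE hk hM hS⟩,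
    litsBelow_sum M (by omega) _ _ fun c hc => ?_⟩
  rw [List.mem_range] at hc
  have h8 : Nat.log 2 (c ^ k) ≤ 2 * k ^ 3 := by
    calc Nat.log 2 (c ^ k) ≤ c * k := log_two_pow_le c k
      _ ≤ 2 * k ^ 2 * k := by gcongr; omega
      _ = 2 * k ^ 3 := by ring
  simp only [litsBelow_mul, litsBelow_eq, litsBelow_lit]
  exact ⟨⟨by omega, litsBelow_nomE hk hM hS, by omega⟩, by omega⟩

theorem litsBelow_legalE (hS : S.LitsBelow M) (hT : T.LitsBelow M) :
    (legalE k S T).LitsBelow M := by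
  obtain ⟨h2, h3, h4, h5, h6, h7⟩ := literal_bounds hk hM
  have := litsBelow_agtE hk hM hS
  have := litsBelow_levE hk hM hS
  have := litsBelow_nomE hk hM hS
  have := litsBelow_digitE hk hM hS hT
  have h8 : 1 < M := by omega
  have h9 : 0 < M := by omega
  simp [legalE, nE, classesE, *]

theorem litsBelow_nextE (hS : S.LitsBelow M) (hT : T.LitsBelow M) :
    (nextE k S T).LitsBelow M := by
  obtain ⟨h2, h3, h4, h5, h6, h7⟩ := literal_bounds hk hM
  have := litsBelow_agtE hk hM hS
  have := litsBelow_levE hk hM hS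
  have := litsBelow_conE hk hM hS
  have := litsBelow_encodeUpE hk hM hS
  have h8 : 1 < M := by omega
  have h9 : 0 < M := by omega
  simp [nextE, codeE, widthE, nE, classesE, *]

theorem litsBelow_entryE (hS : S.LitsBelow M) (hT : T.LitsBelow M) :
    (entryE k S T).LitsBelow M := by
  obtain ⟨h2, h3, h4, h5, h6, h7⟩ := literal_bounds hk hM
  have := litsBelow_legalE hk hM hS hT
  have := litsBelow_nextE hk hM hS hT
  have := litsBelow_gainE hk hM hS
  have h8 : 1 < M := by omega
  have h9 : 0 < M := by omega
  simp [entryE, classesE, *]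

end Literals

end Expr

theorem Prog.fits_solve {k X : ℕ} (hk : 8 ≤ k) (hX : 2 * k ^ 3 < 2 ^ X) :
    (Prog.solve k).Fits (2000 * k ^ 3) X := by
  obtain ⟨h2, h3, h4, h5, h6, h7⟩ := Expr.literal_bounds hk hX
  have hX1 : 1 ≤ X := by
    by_contra h
    obtain rfl : X = 0 := by omega
    omega
  have hZ : 2000 ≤ 2000 * k ^ 3 := by
    have : 8 ^ 3 ≤ k ^ 3 := by gcongr
    omega
  have hlev := Expr.litsBelow_levE hk hX (S := .var 16) (by simp)
  have hagt := Expr.litsBelow_agtE hk hX (S := .var 16) (by simp)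
  have hnext := Expr.litsBelow_nextE hk hX (S := .var 16) (T := .var 17) (by simp) (by simp)
  have hentry := Expr.litsBelow_entryE hk hX (S := .var 16) (T := .var 12) (by simp) (by simp)
  have hnext' := Expr.nodes_nextE_le hk 17
  have hentry' := Expr.nodes_entryE_le hk
  have hX0 : X ≠ 0 := by omega
  have hnum : ∀ c, c ≤ 2000 → c ≤ 2000 * k ^ 3 := fun c hc => hc.trans hZ
  have hnext2 : (Expr.nextE k (.var 16) (.var 17)).nodes ≤ 2000 * k ^ 3 := by omega
  have hentry2 : (Expr.max (.get 8 (.var 16)) (Expr.entryE k (.var 16) (.var 12))).nodes ≤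
      2000 * k ^ 3 := by
    simp only [Expr.nodes_max, Expr.nodes_get, Expr.nodes_var]
    omega
  clear hnext' hentry' hZ
  generalize 2000 * k ^ 3 = Z at *
  refine ⟨?_, ⟨?_, ?_, ?_, ?_, ?_, ?_, ?_, ?_, ?_⟩, trivial⟩
  · exact ⟨hnum _ (by simp [Expr.mE]), by simp [Expr.mE, hX0]⟩
  · simp only [Prog.scale, Prog.count, Prog.Fits, Expr.Fits]
    simp [Expr.mE, h2, h6, hX0, hnum]
  · simp only [Prog.scale, Prog.count, Prog.Fits, Expr.Fits]
    simp [Expr.mE, Expr.nE, h2, hX0, hnum]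
  · simp only [Prog.total, Prog.count, Prog.Fits, Expr.Fits]
    simp [Expr.mE, hX0, hnum]
  · simp only [Prog.levels, Prog.Fits, Expr.Fits]
    simp [h2, hX0, hnum]
  · simp only [Prog.counts, Prog.count, Prog.Fits, Expr.Fits]
    simp [Expr.mE, Expr.classesE, h6, hX0, hnum]
  · simp only [Prog.powers, Prog.count, Prog.Fits, Expr.Fits]
    simp [Expr.mE, Expr.classesE, Expr.radixE, h2, h6, hX0, hnum]
  · simp only [Prog.ranks, Prog.count, Prog.Fits, Expr.Fits]
    simp [Expr.nE, hX0, hnum]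
  · simp only [Prog.table, Prog.count, Prog.Fits, Expr.Fits]
    simp only [hentry2]
    simp [Expr.nE, Expr.classesE, Expr.statesE, Expr.widthE, hentry, h6, h7, hX0, hnum]
  · simp only [Prog.follow, Prog.move, Prog.take, Prog.pass, Prog.count, Prog.Fits, Expr.Fits]
    simp only [hnext2]
    simp [Expr.mE, Expr.moveE, Expr.currentClassE, Expr.classesE, Expr.nodes_levE,
      Expr.nodes_agtE, hlev, hagt, hnext, h3, h6, hX0, hnum]

end NashWelfare

namespace NashWelfare

/-! ### The size of the numbers and the running time -/

namespace Inst

variable (I : Inst)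

theorem size_eq : I.size = bitLen I.n + bitLen I.m +
    ∑ j : Fin I.m, (bitLen (I.value j).num + bitLen (I.value j).den) +
    ∑ i : Fin I.n, (bitLen (I.weight i).num + bitLen (I.weight i).den) := by
  have key : ∀ (N : ℕ) (f g : Fin N → ℕ),
      ((List.ofFn fun j => [f j, g j]).flatten.map bitLen).sum =
        ∑ j, (bitLen (f j) + bitLen (g j)) := by
    intro N f g
    induction N with
    | zero => simp
    | succ N ih =>
      rw [List.ofFn_succ, List.flatten_cons, List.map_append, List.sum_append, Fin.sum_univ_succ, ih]
      simp
  unfold size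
  rw [input_eq, List.map_cons, List.map_cons, List.map_append, List.sum_cons, List.sum_cons,
    List.sum_append, key, key]
  ring

theorem two_mul_add_le_size : 2 * I.m + 2 * I.n + 2 ≤ I.size := by
  have h1 : ∑ j : Fin I.m, 2 ≤
      ∑ j : Fin I.m, (bitLen (I.value j).num + bitLen (I.value j).den) :=
    Finset.sum_le_sum fun j _ => by unfold bitLen; omega
  have h2 : ∑ j : Fin I.n, 2 ≤
      ∑ i : Fin I.n, (bitLen (I.weight i).num + bitLen (I.weight i).den) :=
    Finset.sum_le_sum fun j _ => by unfold bitLen; omega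
  rw [Finset.sum_const, Finset.card_univ, Fintype.card_fin, smul_eq_mul] at h1 h2
  have h3 := I.size_eq
  have h4 : 1 ≤ bitLen I.n := by unfold bitLen; omega
  have h5 : 1 ≤ bitLen I.m := by unfold bitLen; omega
  omega

theorem lt_two_pow_size {c : ℕ} (hc : c ∈ I.input) : c < 2 ^ I.size := by
  have h : bitLen c ≤ I.size :=
    List.single_le_sum (fun _ _ => Nat.zero_le _) _ (List.mem_map_of_mem hc)
  exact Nat.size_le.1 ((Nat.le_succ _).trans h)

theorem init_below {X : ℕ} (hX : I.size ≤ X) : I.init.Below X := by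
  intro a i
  unfold init
  split_ifs
  · rcases lt_or_ge i I.input.length with h | h
    · rw [List.getD_eq_getElem _ _ h]
      exact (I.lt_two_pow_size (List.getElem_mem h)).trans_le
        (Nat.pow_le_pow_right (by norm_num) hX)
    · rw [List.getD_eq_default _ _ h]
      positivity
  · positivity

theorem valueNum_lt (j : ℕ) : I.valueNum j < 2 ^ I.size := by
  unfold valueNum
  split_ifs
  · refine I.lt_two_pow_size ?_
    rw [input_eq]
    refine List.mem_cons_of_mem _ (List.mem_cons_of_mem _ (List.mem_append_left _ ?_))
    exact List.mem_flatten_of_mem (List.mem_ofFn.2 ⟨_, rfl⟩) List.mem_cons_self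
  · positivity

theorem weightNum_lt (i : ℕ) : I.weightNum i < 2 ^ I.size := by
  unfold weightNum
  split_ifs
  · refine I.lt_two_pow_size ?_
    rw [input_eq]
    refine List.mem_cons_of_mem _ (List.mem_cons_of_mem _ (List.mem_append_right _ ?_))
    exact List.mem_flatten_of_mem (List.mem_ofFn.2 ⟨_, rfl⟩) List.mem_cons_self
  · positivity

/-- The bit length of a product is at most the sum of the bit lengths of its factors, so even the
product of all denominators has only `I.size` bits or so. -/
theorem valueScale_le : I.valueScale ≤ 2 ^ I.size := by
  have h : ∀ j : Fin I.m, I.valueDen j = (I.value j).den := fun j => dif_pos j.2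
  unfold valueScale
  rw [Finset.prod_range]
  calc ∏ j : Fin I.m, I.valueDen j ≤ ∏ j : Fin I.m, 2 ^ bitLen (I.value j).den :=
        Finset.prod_le_prod' fun j _ => by
          rw [h]
          exact (Nat.size_le.1 (Nat.le_succ _)).le
    _ = 2 ^ ∑ j : Fin I.m, bitLen (I.value j).den := Finset.prod_pow_eq_pow_sum _ _ _
    _ ≤ 2 ^ I.size := by
      refine Nat.pow_le_pow_right (by norm_num) ?_
      rw [size_eq, Finset.sum_add_distrib]
      omega

theorem weightScale_le : I.weightScale ≤ 2 ^ I.size := by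
  have h : ∀ j : Fin I.n, I.weightDen j = (I.weight j).den := fun j => dif_pos j.2
  unfold weightScale
  rw [Finset.prod_range]
  calc ∏ j : Fin I.n, I.weightDen j ≤ ∏ j : Fin I.n, 2 ^ bitLen (I.weight j).den :=
        Finset.prod_le_prod' fun j _ => by
          rw [h]
          exact (Nat.size_le.1 (Nat.le_succ _)).le
    _ = 2 ^ ∑ j : Fin I.n, bitLen (I.weight j).den := Finset.prod_pow_eq_pow_sum _ _ _
    _ ≤ 2 ^ I.size := by
      refine Nat.pow_le_pow_right (by norm_num) ?_
      rw [size_eq, Finset.sum_add_distrib (s := (Finset.univ : Finset (Fin I.n)))]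
      omega

theorem intWeight_le (i : ℕ) : I.intWeight i ≤ 2 ^ (2 * I.size) := by
  unfold intWeight
  rw [one_mul, two_mul, pow_add]
  exact Nat.mul_le_mul (I.weightNum_lt i).le ((Nat.div_le_self _ _).trans I.weightScale_le)

theorem totalSize_lt (k : ℕ) : I.totalSize k < 2 ^ (3 * I.size + 2 * k ^ 2 + 1) := by
  have h1 : ∀ j ∈ Finset.range I.m, I.sizeOf k j ≤ 2 ^ (2 * I.size + 2 * k ^ 2) := fun j _ => by
    unfold sizeOf
    rw [show 2 * I.size + 2 * k ^ 2 = 2 * k ^ 2 + I.size + I.size by ring, pow_add, pow_add]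
    exact Nat.mul_le_mul (Nat.mul_le_mul Nat.lt_two_pow_self.le (I.valueNum_lt j).le)
      ((Nat.div_le_self _ _).trans I.valueScale_le)
  have h2 := Finset.sum_le_card_nsmul _ _ _ h1
  rw [Finset.card_range, smul_eq_mul] at h2
  have h3 : I.m < 2 ^ I.size := lt_of_le_of_lt (by have := I.two_mul_add_le_size; omega)
    Nat.lt_two_pow_self
  calc I.totalSize k ≤ I.m * 2 ^ (2 * I.size + 2 * k ^ 2) := h2
    _ ≤ 2 ^ I.size * 2 ^ (2 * I.size + 2 * k ^ 2) := by gcongr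
    _ = 2 ^ (3 * I.size + 2 * k ^ 2) := by rw [← pow_add]; congr 1; ring
    _ < _ := Nat.pow_lt_pow_right (by norm_num) (by omega)

theorem levels_le (k : ℕ) (ord : ℕ → ℕ) :
    (I.data k ord).L ≤ 3 * I.size + 2 * k ^ 2 + 1 := Nat.size_le.2 (I.totalSize_lt k)

theorem width_le (k : ℕ) (ord : ℕ → ℕ) : (I.data k ord).W ≤ 2 ^ (I.size * (2 * k ^ 2)) := by
  unfold Data.W
  rw [pow_mul]
  refine Nat.pow_le_pow_left (le_trans ?_ Nat.lt_two_pow_self.le) _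
  have := I.two_mul_add_le_size
  simp only [Data.B, data]
  omega

theorem states_le (k : ℕ) (ord : ℕ → ℕ) :
    (I.data k ord).NS ≤ 2 ^ (4 * I.size + 4 * k ^ 2 + 2 + I.size * (2 * k ^ 2)) := by
  have h1 : (I.data k ord).n = I.n := rfl
  have h2 : (I.data k ord).D = 2 * k ^ 2 := rfl
  have h3 := I.two_mul_add_le_size
  unfold Data.NS
  rw [show 4 * I.size + 4 * k ^ 2 + 2 + I.size * (2 * k ^ 2) =
    (3 * I.size + 2 * k ^ 2 + 1) + I.size + (2 * k ^ 2 + 1) + I.size * (2 * k ^ 2) by ring,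
    pow_add, pow_add, pow_add, h1, h2]
  refine Nat.mul_le_mul (Nat.mul_le_mul (Nat.mul_le_mul ((I.levels_le k ord).trans ?_) ?_) ?_)
    (I.width_le k ord)
  · exact Nat.lt_two_pow_self.le
  · exact le_trans (by omega) Nat.lt_two_pow_self.le
  · exact Nat.lt_two_pow_self.le

theorem gain_le {k : ℕ} {ord : ℕ → ℕ} {ℓ i N : ℕ} (hℓ : ℓ < (I.data k ord).L)
    (hN : N ≤ (I.data k ord).D) :
    (I.data k ord).gain ℓ i N ≤ 2 ^ (5 * I.size + k + 4 * k ^ 2 + 1) := by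
  have h1 := (hℓ.le.trans (I.levels_le k ord))
  have h2 : (I.data k ord).D = 2 * k ^ 2 := rfl
  unfold Data.gain
  calc _ ≤ 2 ^ (2 * I.size) * (k * ℓ + N * k) :=
        Nat.mul_le_mul (I.intWeight_le _) (Nat.add_le_add_left (log_two_pow_le N k) _)
    _ = 2 ^ (2 * I.size) * (k * (ℓ + N)) := by ring
    _ ≤ 2 ^ (2 * I.size) * (2 ^ k * 2 ^ (3 * I.size + 4 * k ^ 2 + 1)) := by
      gcongr
      · exact Nat.lt_two_pow_self.le
      · exact le_trans (by omega) Nat.lt_two_pow_self.le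
    _ = _ := by
      rw [← pow_add, ← pow_add]
      congr 1
      ring

/-- A bound on the number of bits of all numbers in the computation. -/
def bits (k : ℕ) : ℕ := (I.size + 9) * (2 * k ^ 2 + 9)

theorem fitsIn_bits {k : ℕ} (hk : 8 ≤ k) : I.FitsIn k (I.bits k) := by
  have hs := I.two_mul_add_le_size
  have hkk : 8 * k ≤ k ^ 2 := by rw [sq]; gcongr
  have hbits : I.bits k = I.size * (2 * k ^ 2) + 9 * I.size + 18 * k ^ 2 + 81 := by
    unfold bits
    ring
  have hle : ∀ {a e : ℕ}, a ≤ 2 ^ e → e < I.bits k → a < 2 ^ I.bits k := fun h1 h2 =>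
    h1.trans_lt (Nat.pow_lt_pow_right (by norm_num) h2)
  have hpow : ∀ {a e : ℕ}, a ≤ e → a ≤ 2 ^ e := fun h => h.trans Nat.lt_two_pow_self.le
  constructor
  · exact hle (hpow (e := I.size) (by omega)) (by omega)
  · exact hle (hpow (e := I.size) (by omega)) (by omega)
  · exact hle I.valueScale_le (by omega)
  · exact hle I.weightScale_le (by omega)
  · exact fun i _ => hle (I.intWeight_le i) (by omega)
  · exact hle (I.totalSize_lt k).le (by omega)
  · exact fun ord => hle (I.width_le k ord) (by omega)
  · exact fun ord => hle (I.states_le k ord) (by omega)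
  · intro ord
    have h1 := I.levels_le k ord
    have h2 : (I.data k ord).D = 2 * k ^ 2 := rfl
    calc ((I.data k ord).D + 1) * 2 ^ (I.data k ord).L
        ≤ 2 ^ (2 * k ^ 2 + 1) * 2 ^ (3 * I.size + 2 * k ^ 2 + 1) := by
          gcongr
          · rw [h2]
            exact Nat.lt_two_pow_self.le
          · norm_num
      _ ≤ 2 ^ I.bits k := by
          rw [← pow_add]
          exact Nat.pow_le_pow_right (by norm_num) (by omega)
  · refine ⟨2 ^ (5 * I.size + k + 4 * k ^ 2 + 1), fun ord _ =>
      ⟨fun ℓ hℓ i _ N hN => I.gain_le hℓ hN, ?_⟩⟩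
    have h2 : (I.data k ord).D = 2 * k ^ 2 := rfl
    have h3 := I.states_le k ord
    set e := 9 * I.size + k + 8 * k ^ 2 + 3 + I.size * (2 * k ^ 2) with he
    have h4 : (I.data k ord).NS * 2 ^ (5 * I.size + k + 4 * k ^ 2 + 1) ≤ 2 ^ e := by
      calc _ ≤ 2 ^ (4 * I.size + 4 * k ^ 2 + 2 + I.size * (2 * k ^ 2)) *
            2 ^ (5 * I.size + k + 4 * k ^ 2 + 1) := by gcongr
        _ = 2 ^ e := by
          rw [← pow_add, he]
          congr 1
          ring
    have h5 : 2 ≤ 2 ^ e := Nat.le_self_pow (by omega) 2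
    calc (2 + (I.data k ord).NS * 2 ^ (5 * I.size + k + 4 * k ^ 2 + 1)) * (I.data k ord).D
        ≤ 2 ^ (e + 1) * 2 ^ (2 * k ^ 2) := by
          rw [h2, pow_succ 2 e]
          exact Nat.mul_le_mul (by omega) Nat.lt_two_pow_self.le
      _ ≤ 2 ^ I.bits k := by
          rw [← pow_add]
          exact Nat.pow_le_pow_right (by norm_num) (by omega)

/-- The states dominate: about `L n D W` of them, with `O(D)` steps each for the table and at most
`O(m)` each for the path. All parameters except `W` are below the bit bound. -/
theorem stepBound_le {k : ℕ} (hk : 8 ≤ k) :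
    stepBound (I.data k id) + 1 ≤ 20 * I.bits k ^ 4 * (I.data k id).W := by
  have hs := I.two_mul_add_le_size
  have hkk : 8 * k ≤ k ^ 2 := by rw [sq]; gcongr
  have hbits : I.bits k = I.size * (2 * k ^ 2) + 9 * I.size + 18 * k ^ 2 + 81 := by
    unfold bits
    ring
  have h1 : (I.data k id).n = I.n := rfl
  have h2 : (I.data k id).D = 2 * k ^ 2 := rfl
  have h3 : (I.data k id).m = I.m := rfl
  have h4 := I.levels_le k id
  have hW : 1 ≤ (I.data k id).W := Data.W_pos
  unfold stepBound Data.NS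
  rw [h1, h2, h3]
  set X := I.bits k
  set W := (I.data k id).W
  set L := (I.data k id).L
  have hm : I.m + 9 ≤ X := by omega
  have hn : I.n + 9 ≤ X := by omega
  have hL : L + 9 ≤ X := by omega
  have hD : 2 * k ^ 2 + 9 ≤ X := by omega
  generalize 2 * k ^ 2 = D at hD
  generalize I.m = m at hm
  generalize I.n = n at hn
  have hX : 9 ≤ X := by omega
  have hXX : 9 * X ≤ X ^ 2 := by rw [sq]; gcongr
  have hX3 : 9 * X ^ 2 ≤ X ^ 3 := by rw [pow_succ X 2, mul_comm]; gcongr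
  have hX4 : 9 * X ^ 3 ≤ X ^ 4 := by rw [pow_succ X 3, mul_comm]; gcongr
  have hX4W : X ^ 4 * 1 ≤ X ^ 4 * W := by gcongr
  have e1 : L * D * (3 * m + 4) ≤ X * X * (3 * X) := by gcongr <;> omega
  have e2 : n * (3 * n + 5) ≤ X * (3 * X) := by gcongr <;> omega
  have e3 : L * (n + 1) * (D + 1) * W * (3 * D + 5) ≤ X * X * X * W * (3 * X) := by
    gcongr <;> omega
  have e4 : L * (n + 1) * (D + 1) * W * (6 * m + 9) ≤ X * X * X * W * (6 * X) := by
    gcongr <;> omega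
  have r1 : X * X * (3 * X) = 3 * X ^ 3 := by ring
  have r2 : X * (3 * X) = 3 * X ^ 2 := by ring
  have r3 : X * X * X * W * (3 * X) = 3 * (X ^ 4 * W) := by ring
  have r4 : X * X * X * W * (6 * X) = 6 * (X ^ 4 * W) := by ring
  have r5 : 20 * X ^ 4 * W = 20 * (X ^ 4 * W) := by ring
  rw [r1] at e1
  rw [r2] at e2
  rw [r3] at e3
  rw [r4] at e4
  rw [r5]
  omega

end Inst

theorem stepCost_le {Z X : ℕ} (hZ : 1 ≤ Z) (hX : 1 ≤ X) : stepCost Z X ≤ 32 * Z ^ 3 * X ^ 2 := by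
  have h : 1 ≤ X * Z := Nat.mul_pos hX hZ
  calc stepCost Z X ≤ 8 * Z * (X * Z + X * Z) ^ 2 := by unfold stepCost; gcongr
    _ = _ := by ring

/-- The constant in the bound on the running time. -/
def timeConst : ℕ := 20 * 32 * 2000 ^ 3 * 12 ^ 6

/-- Apart from the width `W`, the cost is polynomial in the input size and in `k`. There are 9
powers of `k` from the program size `Z³` and 12 from the six powers of the bit bound. -/
theorem time_le {k : ℕ} (hk : 8 ≤ k) (I : Inst) (hm : 0 < I.m) :
    (stepBound (I.data k id) + 1) * stepCost (2000 * k ^ 3) (I.bits k) ≤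
      timeConst * I.size ^ 6 * (I.m + 1) ^ (25 * k ^ 2) := by
  have hs := I.two_mul_add_le_size
  have hn := I.n_pos
  have hkk : 8 * k ≤ k ^ 2 := by rw [sq]; gcongr
  have hX : I.bits k ≤ 12 * I.size * k ^ 2 := by
    calc I.bits k ≤ (4 * I.size) * (3 * k ^ 2) := by
          unfold Inst.bits
          gcongr <;> omega
      _ = _ := by ring
  have hX1 : 1 ≤ I.bits k := by
    unfold Inst.bits
    exact Nat.mul_pos (by omega) (by omega)
  -- Since `m ≥ 1`, the radix `2m + 2` is at most `(m+1)²`.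
  have hW : (I.data k id).W ≤ (I.m + 1) ^ (4 * k ^ 2) := by
    have h : (I.data k id).W = (2 * I.m + 2) ^ (2 * k ^ 2) := rfl
    rw [h, show 4 * k ^ 2 = 2 * (2 * k ^ 2) by ring, pow_mul (I.m + 1)]
    refine Nat.pow_le_pow_left ?_ _
    nlinarith
  -- The powers of `k` cannot go into the absolute constant, but `m + 1 ≥ 2` lets them be absorbed
  -- into the exponent.
  have hkm : k ^ 21 ≤ (I.m + 1) ^ (21 * k ^ 2) := by
    calc k ^ 21 ≤ (2 ^ k) ^ 21 := Nat.pow_le_pow_left Nat.lt_two_pow_self.le _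
      _ = 2 ^ (21 * k) := by rw [← pow_mul, mul_comm]
      _ ≤ 2 ^ (21 * k ^ 2) := Nat.pow_le_pow_right (by norm_num) (by omega)
      _ ≤ _ := Nat.pow_le_pow_left (by omega) _
  calc (stepBound (I.data k id) + 1) * stepCost (2000 * k ^ 3) (I.bits k)
      ≤ (20 * I.bits k ^ 4 * (I.data k id).W) * (32 * (2000 * k ^ 3) ^ 3 * I.bits k ^ 2) :=
        Nat.mul_le_mul (I.stepBound_le hk) (stepCost_le (Nat.mul_pos (by norm_num) (pow_pos (by omega) 3)) hX1)
    _ = 20 * 32 * 2000 ^ 3 * k ^ 9 * I.bits k ^ 6 * (I.data k id).W := by ring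
    _ ≤ 20 * 32 * 2000 ^ 3 * k ^ 9 * (12 * I.size * k ^ 2) ^ 6 * (I.m + 1) ^ (4 * k ^ 2) := by
      gcongr
    _ = timeConst * I.size ^ 6 * (k ^ 21 * (I.m + 1) ^ (4 * k ^ 2)) := by unfold timeConst; ring
    _ ≤ timeConst * I.size ^ 6 * ((I.m + 1) ^ (21 * k ^ 2) * (I.m + 1) ^ (4 * k ^ 2)) := by gcongr
    _ = _ := by
      rw [← pow_add]
      congr 2
      ring

theorem exec_solve {k : ℕ} (hk : 8 ≤ k) (I : Inst) (hm : 0 < I.m) :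
    ∃ s t, Exec (Prog.solve k) I.init s t ∧
      t ≤ timeConst * I.size ^ 6 * (I.m + 1) ^ (25 * k ^ 2) ∧ (∀ j, s 1 j < I.n) ∧
      ∃ ord : ℕ → ℕ, (∀ i < I.n, ord (rankOf I.n I.intWeight i) = i) ∧
      ∃ A : ℕ → ℕ, (I.data k ord).IsTable A ∧ (A 0 ≠ 0 → ∃ a e : ℕ → ℕ,
        A 0 / (2 * k ^ 2) = 1 + ∑ i ∈ Finset.range I.n, (I.data k ord).gain (a i) i (e i) ∧
        ∀ i < I.n, k ^ 2 ≤ 2 * e i ∧ e i * 2 ^ a i * (k - 3) ≤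
          (∑ j ∈ (Finset.range I.m).filter (fun j => s 1 j = ord i), I.sizeOf k j) * k) := by
  have hrun : Runs (I.bits k) (Prog.solve k) I.init (stepBound (I.data k id) + 1) _ :=
    Runs.ite (fun _ => runs_main hk I (I.fitsIn_bits hk)) fun h => by
      simp only [Expr.mE, Expr.eval_get, Expr.eval_lit, I.init_m] at h
      omega
  obtain ⟨s, t, hst, ht, hs⟩ := hrun
  have hX1 : I.size + 1 ≤ I.bits k ∧ 2 * k ^ 2 + k ≤ I.bits k := by
    have hkk : 8 * k ≤ k ^ 2 := by rw [sq]; gcongr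
    have : I.bits k = I.size * (2 * k ^ 2) + 9 * I.size + 18 * k ^ 2 + 81 := by
      unfold Inst.bits
      ring
    omega
  have hlit : 2 * k ^ 3 < 2 ^ I.bits k := by
    calc 2 * k ^ 3 = 2 * k ^ 2 * k := by ring
      _ < 2 ^ (2 * k ^ 2) * 2 ^ k := Nat.mul_lt_mul'' Nat.lt_two_pow_self Nat.lt_two_pow_self
      _ ≤ 2 ^ I.bits k := by
        rw [← pow_add]
        exact Nat.pow_le_pow_right (by norm_num) hX1.2
  obtain ⟨-, t', ht', he⟩ := hst.exec (Nat.mul_pos (by norm_num) (pow_pos (by omega) 3)) (by omega)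
    (Prog.fits_solve hk hlit) (I.init_below (by omega))
  exact ⟨s, t', he, (ht'.trans (Nat.mul_le_mul_right _ ht)).trans (time_le hk I hm), hs⟩

/-- Without goods the factor `(m+1)^…` is 1 and leaves no room for constants depending on `k`, so
the program must stop after the first test, whose cost does not depend on `k`. -/
theorem exec_solve_of_eq_zero (k : ℕ) (I : Inst) (hm : I.m = 0) :
    Exec (Prog.solve k) I.init I.init 7 := by
  have h : Expr.mE.eval I.init = 0 := by
    simp only [Expr.mE, Expr.eval_get, Expr.eval_lit, I.init_m, hm]
  have := Exec.ite_false (p := Prog.main k) h (Exec.skip I.init)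
  have hc : Expr.mE.cost I.init = 5 := by
    have h1 : I.init 0 1 = 0 := by rw [I.init_m, hm]
    simp [Expr.mE, Expr.cost, Expr.eval, h1, bitLen, Nat.size]
  rw [h, hc] at this
  exact this

end NashWelfare

namespace NashWelfare

/-! ### The value of the dynamic program -/

namespace Data

variable {P : Data}

/-- The table accounts for every assignment of the goods with increasing loads, if every good of
positive size is large at level `0`. -/
theorem exists_gain_le {A : ℕ → ℕ} (hA : P.IsTable A) (hk : 8 ≤ P.k) (hn : 0 < P.n)
    (hL : ∑ j ∈ Finset.range P.m, P.b j < 2 ^ P.L)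
    (hb : ∀ j < P.m, P.b j = 0 ∨ P.D ≤ P.b j) {y : ℕ → ℕ} (hy : ∀ i < P.n, 0 < P.load y i)
    (hmono : ∀ i i', i ≤ i' → i' < P.n → P.load y i ≤ P.load y i') :
    ∃ lv N : ℕ → ℕ, 1 + ∑ i ∈ Finset.range P.n, P.gain (lv i) i (N i) ≤ A 0 / P.D ∧
      ∀ i < P.n, 0 < N i ∧ (P.k - 4) * P.load y i ≤ N i * 2 ^ lv i * P.k := by
  have hk2 : 0 < P.k ^ 2 := by positivity
  have hD : P.D = 2 * P.k ^ 2 := rfl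
  have hload : ∀ i < P.n, P.D ≤ P.load y i := by
    intro i hi
    obtain ⟨j, hj, hj'⟩ := Finset.exists_ne_zero_of_sum_ne_zero (hy i hi).ne'
    have hjm : j < P.m := Finset.mem_range.1 (Finset.mem_filter.1 hj).1
    exact ((hb j hjm).resolve_left hj').trans
      (Finset.single_le_sum (f := P.b) (fun _ _ => Nat.zero_le _) hj)
  -- The unique level with `k² 2^ℓ ≤ load < 2k² 2^ℓ`. It exists because a positive load is at least
  -- `D`.
  set lv : ℕ → ℕ := fun i => Nat.log 2 (P.load y i / P.k ^ 2) with hlv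
  have hlo : ∀ i < P.n, P.k ^ 2 * 2 ^ lv i ≤ P.load y i := by
    intro i hi
    have h1 := hload i hi
    have h2 : P.load y i / P.k ^ 2 ≠ 0 := (Nat.div_pos (by omega) hk2).ne'
    exact (Nat.mul_le_mul_left _ (Nat.pow_log_le_self 2 h2)).trans (Nat.mul_div_le _ _)
  have hhi : ∀ i < P.n, P.load y i < P.D * 2 ^ lv i := by
    intro i _
    have h1 := Nat.lt_pow_succ_log_self (b := 2) (by norm_num) (P.load y i / P.k ^ 2)
    rw [Nat.div_lt_iff_lt_mul hk2, pow_succ] at h1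
    rw [hD]
    exact h1.trans_eq (by ring)
  have hlvL : ∀ i < P.n, lv i < P.L := by
    intro i hi
    refine (Nat.pow_lt_pow_iff_right (a := 2) (by norm_num)).1 (lt_of_le_of_lt ?_ hL)
    calc 2 ^ lv i ≤ P.k ^ 2 * 2 ^ lv i := Nat.le_mul_of_pos_left _ hk2
      _ ≤ P.load y i := hlo i hi
      _ ≤ _ := Finset.sum_le_sum_of_subset (Finset.filter_subset _ _)
  -- At level 0 a good either has size 0 or class at least `D`, so the zero vector already leaves
  -- room for everything.
  have hroom : P.Room (P.late y 0) 0 (fun _ => 0) := by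
    have hc : ∀ j ∈ P.late y 0, P.b j = 0 ∨ P.D ≤ P.b j := fun j hj =>
      hb j (Finset.mem_range.1 (Finset.mem_filter.1 hj).1)
    constructor
    · intro c h1 h2
      rw [Nat.le_zero, Finset.card_eq_zero, Finset.filter_eq_empty_iff]
      intro j hj h3
      have := hc j hj
      simp only [cls, pow_zero, Nat.div_one] at h3
      omega
    · rw [Finset.sum_eq_zero]
      · simp
      · intro j hj
        rw [Finset.mem_filter] at hj
        have h1 := hc j hj.1
        have h2 := hj.2
        simp only [cls, pow_zero, Nat.div_one] at h2
        have h3 : P.k ≤ P.k ^ 2 := Nat.le_self_pow two_ne_zero _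
        omega
  have h := path_le_val hA hk (y := y) (lv := lv)
    (fun i i' h h' => Nat.log_mono_right (Nat.div_le_div_right (hmono i i' h h'))) hlvL hlo hhi _ 0 0
    (fun _ => 0) le_rfl ((Nat.zero_le _).trans_lt (hlvL 0 hn)) (Nat.zero_le _) (fun _ => B_pos)
    (fun _ => Nat.zero_le _) hroom
  refine ⟨lv, fun i => P.nominal y (lv i) i, ?_, fun i hi => ⟨?_, ?_⟩⟩
  · simpa [code, encode] using h
  · have := sq_le_nominal hk (hhi i hi) (hlo i hi)
    exact Nat.pos_of_ne_zero fun h0 => by simp only [h0] at this; omega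
  · exact le_nominal_mul hk (hhi i hi) (hlo i hi)

/-- With its converse `log_le_gain`, this places `k w log₂(N 2^ℓ)` between the gain and the gain
plus `w`: taking the `k`-th power before rounding divides the error in the logarithm by `k`. -/
theorem gain_le_log {ℓ i N : ℕ} (hN : 0 < N) :
    (P.gain ℓ i N : ℝ) * Real.log 2 ≤ P.w i * (P.k * Real.log (N * 2 ^ ℓ)) := by
  have h2 : 0 < Real.log 2 := Real.log_pos (by norm_num)
  have h1 : (Nat.log 2 (N ^ P.k) : ℝ) * Real.log 2 ≤ P.k * Real.log N := by
    have h := Real.natLog_le_logb (N ^ P.k) 2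
    rw [Real.logb, Nat.cast_ofNat, le_div_iff₀ h2] at h
    rwa [Nat.cast_pow, Real.log_pow] at h
  have hN' : (0 : ℝ) < N := Nat.cast_pos.2 hN
  rw [Real.log_mul hN'.ne' (by positivity), Real.log_pow]
  unfold gain
  push_cast
  calc _ = P.w i * (P.k * ℓ * Real.log 2 + Nat.log 2 (N ^ P.k) * Real.log 2) := by ring
    _ ≤ P.w i * (P.k * ℓ * Real.log 2 + P.k * Real.log N) := by gcongr
    _ = _ := by ring

theorem log_le_gain {ℓ i N : ℕ} (hN : 0 < N) :
    P.w i * (P.k * Real.log (N * 2 ^ ℓ)) ≤ (P.gain ℓ i N + P.w i : ℝ) * Real.log 2 := by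
  have h2 : 0 < Real.log 2 := Real.log_pos (by norm_num)
  have hN' : (0 : ℝ) < N := Nat.cast_pos.2 hN
  have h1 : P.k * Real.log N ≤ ((Nat.log 2 (N ^ P.k) : ℝ) + 1) * Real.log 2 := by
    have h := (Nat.lt_pow_succ_log_self (b := 2) (by norm_num) (N ^ P.k)).le
    have h' : ((N ^ P.k : ℕ) : ℝ) ≤ ((2 ^ (Nat.log 2 (N ^ P.k)).succ : ℕ) : ℝ) := by exact_mod_cast h
    have h'' := Real.log_le_log (by positivity) h'
    push_cast at h''
    rw [Real.log_pow, Real.log_pow] at h''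
    push_cast at h''
    exact h''
  rw [Real.log_mul hN'.ne' (by positivity), Real.log_pow]
  unfold gain
  push_cast
  calc _ = P.w i * (P.k * Real.log N + P.k * ℓ * Real.log 2) := by ring
    _ ≤ P.w i * (((Nat.log 2 (N ^ P.k) : ℝ) + 1) * Real.log 2 + P.k * ℓ * Real.log 2) := by gcongr
    _ = _ := by ring

/-- The loss that the algorithm makes with accuracy `k`. -/
noncomputable def ratio (k : ℕ) : ℝ := (1 - 4 / k) * (1 - 3 / k) * (1 - 1 / k)

/-- If the gains of `x` are not less than those of `y`, up to rounding, then the same holds for the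
weighted logarithms of the loads. -/
theorem sum_log_le (hk : 8 ≤ P.k) {lv N a e : ℕ → ℕ} {u v : ℕ → ℝ}
    (h : ∑ i ∈ Finset.range P.n, P.gain (lv i) i (N i) ≤
      ∑ i ∈ Finset.range P.n, P.gain (a i) i (e i))
    (hN : ∀ i < P.n, 0 < N i) (hu : ∀ i < P.n, 0 < u i)
    (he : ∀ i < P.n, 0 < e i)
    (huN : ∀ i < P.n, (P.k - 4) * u i ≤ N i * 2 ^ lv i * P.k)
    (hev : ∀ i < P.n, e i * 2 ^ a i * (P.k - 3) ≤ v i * P.k) :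
    ∑ i ∈ Finset.range P.n, P.w i * (Real.log (u i) + Real.log (ratio P.k)) ≤
      ∑ i ∈ Finset.range P.n, P.w i * Real.log (v i) := by
  have hk' : (8 : ℝ) ≤ P.k := by exact_mod_cast hk
  have hk0 : (0 : ℝ) < P.k := by linarith
  have h4 : (0 : ℝ) < 1 - 4 / P.k := by
    rw [sub_pos, div_lt_one hk0]; linarith
  have h3 : (0 : ℝ) < 1 - 3 / P.k := by
    rw [sub_pos, div_lt_one hk0]; linarith
  have h1 : (0 : ℝ) < 1 - 1 / P.k := by
    rw [sub_pos, div_lt_one hk0]; linarith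
  -- The factor `1 - 1/k` pays for the rounding of logarithms: `log(1 - t) ≤ -t` and `log 2 ≤ 1`
  -- give `1 - 1/k ≤ 2^(-1/k)`.
  have hl1 : Real.log (1 - 1 / P.k) ≤ - (Real.log 2 / P.k) := by
    have h5 := Real.log_le_sub_one_of_pos h1
    have h6 : Real.log 2 / P.k ≤ 1 / P.k := by
      gcongr
      linarith [Real.log_two_lt_d9]
    linarith
  have hlow : ∑ i ∈ Finset.range P.n, (P.w i : ℝ) * (P.k * Real.log (N i * 2 ^ lv i)) ≤
      ∑ i ∈ Finset.range P.n, (P.w i * (P.k * Real.log (e i * 2 ^ a i)) + P.w i * Real.log 2) := by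
    have h' : (∑ i ∈ Finset.range P.n, (P.gain (lv i) i (N i) : ℝ)) ≤
        ∑ i ∈ Finset.range P.n, (P.gain (a i) i (e i) : ℝ) := by exact_mod_cast h
    have hlog2 : 0 ≤ Real.log 2 := Real.log_nonneg (by norm_num)
    calc _ ≤ ∑ i ∈ Finset.range P.n, (P.gain (lv i) i (N i) + P.w i : ℝ) * Real.log 2 :=
          Finset.sum_le_sum fun i hi => log_le_gain (hN i (Finset.mem_range.1 hi))
      _ = (∑ i ∈ Finset.range P.n, (P.gain (lv i) i (N i) : ℝ)) * Real.log 2 +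
          ∑ i ∈ Finset.range P.n, P.w i * Real.log 2 := by
        rw [Finset.sum_mul, ← Finset.sum_add_distrib]
        exact Finset.sum_congr rfl fun i _ => by ring
      _ ≤ (∑ i ∈ Finset.range P.n, (P.gain (a i) i (e i) : ℝ)) * Real.log 2 +
          ∑ i ∈ Finset.range P.n, P.w i * Real.log 2 := by gcongr
      _ ≤ _ := by
        rw [Finset.sum_mul, ← Finset.sum_add_distrib]
        exact Finset.sum_le_sum fun i hi =>
          add_le_add_left (gain_le_log (he i (Finset.mem_range.1 hi))) _
  refine le_of_mul_le_mul_left (a := (P.k : ℝ)) ?_ hk0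
  rw [Finset.mul_sum, Finset.mul_sum]
  have hy : ∀ i ∈ Finset.range P.n, P.k * ((P.w i : ℝ) * (Real.log (u i) + Real.log (ratio P.k))) ≤
      P.w i * (P.k * Real.log (N i * 2 ^ lv i)) +
        P.k * (P.w i * (Real.log (1 - 3 / P.k) + Real.log (1 - 1 / P.k))) := by
    intro i hi
    rw [Finset.mem_range] at hi
    have h5 : (1 - 4 / P.k) * u i ≤ N i * 2 ^ lv i := by
      have := huN i hi
      rw [← div_le_iff₀ hk0] at this
      refine le_trans (le_of_eq ?_) this
      field_simp
    have h6 := Real.log_le_log (mul_pos h4 (hu i hi)) h5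
    rw [Real.log_mul h4.ne' (hu i hi).ne'] at h6
    unfold ratio
    rw [Real.log_mul (mul_pos h4 h3).ne' h1.ne', Real.log_mul h4.ne' h3.ne']
    have h7 : (0 : ℝ) ≤ P.k * P.w i := by positivity
    nlinarith
  have hx : ∀ i ∈ Finset.range P.n, (P.w i : ℝ) * (P.k * Real.log (e i * 2 ^ a i)) +
      P.k * (P.w i * Real.log (1 - 3 / P.k)) ≤ P.k * (P.w i * Real.log (v i)) := by
    intro i hi
    rw [Finset.mem_range] at hi
    have he' : (0 : ℝ) < e i * 2 ^ a i := mul_pos (Nat.cast_pos.2 (he i hi)) (by positivity)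
    have h5 : e i * 2 ^ a i * (1 - 3 / P.k) ≤ v i := by
      have := hev i hi
      rw [← div_le_iff₀ hk0] at this
      refine le_trans (le_of_eq ?_) this
      field_simp
    have h6 := Real.log_le_log (mul_pos he' h3) h5
    rw [Real.log_mul he'.ne' h3.ne'] at h6
    have h7 : (0 : ℝ) ≤ P.k * P.w i := by positivity
    nlinarith
  have hr : ∀ i ∈ Finset.range P.n, P.w i * Real.log 2 +
      P.k * (P.w i * Real.log (1 - 1 / P.k)) ≤ 0 := by
    intro i _
    have h5 : P.k * Real.log (1 - 1 / P.k) ≤ - Real.log 2 := by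
      calc _ ≤ P.k * (- (Real.log 2 / P.k)) := by gcongr
        _ = _ := by field_simp
    have h7 : (0 : ℝ) ≤ P.w i := by positivity
    nlinarith
  have s1 := Finset.sum_le_sum hy
  have s2 := Finset.sum_le_sum hx
  have s3 := Finset.sum_le_sum hr
  simp only [mul_add, Finset.sum_add_distrib, Finset.sum_const_zero] at s1 s2 s3 hlow ⊢
  linarith

/-- The first-order losses add up to `4 + 3 + 1 = 8`, and the higher-order terms help for `k ≥ 8`.
-/
theorem le_ratio {k : ℕ} (hk : 8 ≤ k) : 1 - 8 / k ≤ ratio k := by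
  have hk' : (8 : ℝ) ≤ k := by exact_mod_cast hk
  unfold ratio
  have h : (8 : ℝ) / k = 8 * (1 / k) := by ring
  have h4 : (4 : ℝ) / k = 4 * (1 / k) := by ring
  have h3 : (3 : ℝ) / k = 3 * (1 / k) := by ring
  rw [h, h3, h4]
  have h1 : (0 : ℝ) ≤ 1 / k := by positivity
  have h2 : (1 : ℝ) / k ≤ 1 / 8 := by gcongr
  generalize (1 : ℝ) / k = t at *
  nlinarith [mul_nonneg h1 h1, mul_nonneg (mul_nonneg h1 h1) h1]

end Data
end NashWelfare

namespace NashWelfare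

/-! ### Comparison with an arbitrary allocation -/

theorem le_of_rankOf_le {n : ℕ} {w : ℕ → ℕ} {i i' : ℕ} (hi' : i' < n)
    (h : rankOf n w i ≤ rankOf n w i') : w i ≤ w i' := by
  by_contra hw
  refine absurd (rankOf_lt_rankOf (n := n) (w := w) (i := i') (j := i) hi' ?_) (by omega)
  unfold rankKey
  have : (w i' + 1) * n ≤ w i * n := Nat.mul_le_mul_right _ (by omega)
  nlinarith

namespace Inst

variable (I : Inst)

/-- The total size of the goods that `z` gives to agent `i`. -/
def loadOf (k : ℕ) (z : ℕ → ℕ) (i : ℕ) : ℕ :=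
  ∑ j ∈ (Finset.range I.m).filter (fun j => z j = i), I.sizeOf k j

/-- The table only competes with allocations whose loads increase with the weights. For arbitrary
`y` the bundles are first permuted into that order, which by the rearrangement inequality does not
lower the weighted sum of logarithms. -/
theorem sum_log_loadOf_le {k : ℕ} (hk : 8 ≤ k) {x ord A : ℕ → ℕ}
    (hord : ∀ i < I.n, ord (rankOf I.n I.intWeight i) = i) (hA : (I.data k ord).IsTable A)
    (hx : A 0 ≠ 0 → ∃ a e : ℕ → ℕ,
      A 0 / (2 * k ^ 2) = 1 + ∑ i ∈ Finset.range I.n, (I.data k ord).gain (a i) i (e i) ∧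
        ∀ i < I.n, k ^ 2 ≤ 2 * e i ∧ e i * 2 ^ a i * (k - 3) ≤ I.loadOf k x (ord i) * k)
    {y : ℕ → ℕ} (hy : ∀ j < I.m, y j < I.n) (hpos : ∀ i < I.n, 0 < I.loadOf k y i) :
    (∀ i < I.n, 0 < I.loadOf k x i) ∧
      ∑ i ∈ Finset.range I.n,
          I.intWeight i * (Real.log (I.loadOf k y i) + Real.log (Data.ratio k)) ≤
        ∑ i ∈ Finset.range I.n, I.intWeight i * Real.log (I.loadOf k x i) := by
  have hrank : ∀ r < I.n, ord r < I.n ∧ rankOf I.n I.intWeight (ord r) = r := by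
    intro r hr
    obtain ⟨i, hi, rfl⟩ := exists_rank (w := I.intWeight) hr
    rw [hord i hi]
    exact ⟨hi, rfl⟩
  have hsum : ∀ g : ℕ → ℝ, ∑ r ∈ Finset.range I.n, g (ord r) = ∑ i ∈ Finset.range I.n, g i :=
    fun g => Finset.sum_nbij' ord (rankOf I.n I.intWeight)
      (fun r hr => Finset.mem_range.2 (hrank r (Finset.mem_range.1 hr)).1)
      (fun i hi => Finset.mem_range.2 (rankOf_lt (Finset.mem_range.1 hi)))
      (fun r hr => (hrank r (Finset.mem_range.1 hr)).2)
      (fun i hi => hord i (Finset.mem_range.1 hi)) fun _ _ => rfl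
  let f : Fin I.n → ℕ := fun r => I.loadOf k y (ord r)
  let σ := Tuple.sort f
  have hσ : Monotone (f ∘ σ) := Tuple.monotone_sort f
  -- The bundle of the agent with rank `σ r` goes to rank `r`; `y'` names agents by rank, as the
  -- dynamic program does.
  let y' : ℕ → ℕ := fun j =>
    if h : rankOf I.n I.intWeight (y j) < I.n then σ.symm ⟨_, h⟩ else 0
  have hy' : ∀ r : Fin I.n, (I.data k ord).load y' r = f (σ r) := by
    intro r
    refine Finset.sum_congr (Finset.filter_congr fun j hj => ?_) fun _ _ => rfl
    have hj' := hy j (Finset.mem_range.1 hj)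
    have h1 : y' j = σ.symm ⟨_, rankOf_lt (w := I.intWeight) hj'⟩ := dif_pos (rankOf_lt hj')
    rw [h1, ← Fin.ext_iff, Equiv.symm_apply_eq, Fin.ext_iff]
    constructor
    · intro h
      rw [← h, hord _ hj']
    · intro h
      simp only [h]
      exact (hrank _ (σ r).2).2
  have hb : ∀ j < I.m, I.sizeOf k j = 0 ∨ 2 * k ^ 2 ≤ I.sizeOf k j := fun j _ => by
    unfold sizeOf
    rw [mul_assoc]
    rcases Nat.eq_zero_or_pos (I.valueNum j * (I.valueScale / I.valueDen j)) with h | h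
    · exact Or.inl (by rw [h, mul_zero])
    · exact Or.inr (Nat.le_mul_of_pos_right _ h)
  have hload : ∀ r < I.n, 0 < (I.data k ord).load y' r := fun r hr => by
    rw [hy' ⟨r, hr⟩]
    exact hpos _ (hrank _ (σ _).2).1
  have hmono : ∀ r r', r ≤ r' → r' < I.n →
      (I.data k ord).load y' r ≤ (I.data k ord).load y' r' := fun r r' h h' => by
    rw [hy' ⟨r, h.trans_lt h'⟩, hy' ⟨r', h'⟩]
    exact hσ (show (⟨r, _⟩ : Fin I.n) ≤ ⟨r', _⟩ from h)
  obtain ⟨lv, N, h1, h2⟩ := Data.exists_gain_le hA hk I.n_pos (Nat.lt_size_self _) hb hload hmono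
  obtain ⟨a, e, h3, h4⟩ := hx (by
    rintro h0
    rw [h0, Nat.zero_div] at h1
    omega)
  change 1 + ∑ i ∈ Finset.range I.n, _ ≤ A 0 / (2 * k ^ 2) at h1
  rw [h3, Nat.add_le_add_iff_left] at h1
  have he : ∀ i < I.n, 0 < e i := fun i hi => by
    have := (h4 i hi).1
    have : 0 < k ^ 2 := by positivity
    omega
  have hxpos : ∀ i < I.n, 0 < I.loadOf k x i := by
    intro i hi
    have h5 := (h4 _ (rankOf_lt (w := I.intWeight) hi)).2
    rw [hord i hi] at h5
    refine Nat.pos_of_mul_pos_right (b := k) (lt_of_lt_of_le ?_ h5)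
    exact Nat.mul_pos (Nat.mul_pos (he _ (rankOf_lt hi)) (by positivity)) (by omega)
  refine ⟨hxpos, ?_⟩
  have key := Data.sum_log_le (P := I.data k ord) hk (u := fun r => (I.data k ord).load y' r)
    (v := fun r => I.loadOf k x (ord r)) h1 (fun i hi => (h2 i hi).1)
    (fun r hr => Nat.cast_pos.2 (hload r hr)) he (fun r hr => ?_) (fun r hr => ?_)
  rotate_left
  · have h5 := (h2 r hr).2
    have h6 : ((k - 4 : ℕ) : ℝ) = k - 4 := by
      rw [Nat.cast_sub (show 4 ≤ k by omega)]
      norm_num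
    change ((k : ℝ) - 4) * _ ≤ _
    rw [← h6]
    exact_mod_cast h5
  · have h5 := (h4 r hr).2
    have h6 : ((k - 3 : ℕ) : ℝ) = k - 3 := by
      rw [Nat.cast_sub (show 3 ≤ k by omega)]
      norm_num
    change _ * ((k : ℝ) - 3) ≤ _
    rw [← h6]
    exact_mod_cast h5
  change ∑ r ∈ Finset.range I.n, (I.intWeight (ord r) : ℝ) * _ ≤
    ∑ r ∈ Finset.range I.n, (I.intWeight (ord r) : ℝ) * _ at key
  rw [hsum fun i => I.intWeight i * Real.log (I.loadOf k x i)] at key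
  refine le_trans ?_ key
  rw [← hsum fun i => I.intWeight i * (Real.log (I.loadOf k y i) + Real.log (Data.ratio k))]
  simp only [mul_add, Finset.sum_add_distrib]
  refine add_le_add_left ?_ _
  rw [Finset.sum_range, Finset.sum_range]
  -- Both weights and sorted log-loads increase with the rank, so any other matching has a smaller
  -- or equal sum.
  have hvary : Monovary (fun r : Fin I.n => (I.intWeight (ord r) : ℝ))
      (fun r => Real.log (f (σ r))) := by
    refine Monotone.monovary (fun r r' h => ?_) fun r r' h => ?_
    · refine Nat.cast_le.2 (le_of_rankOf_le (hrank r' r'.2).1 ?_)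
      rw [(hrank r r.2).2, (hrank r' r'.2).2]
      exact h
    · exact Real.log_le_log (Nat.cast_pos.2 (hpos _ (hrank _ (σ r).2).1)) (Nat.cast_le.2 (hσ h))
  have := hvary.sum_mul_comp_perm_le_sum_mul (σ := σ.symm)
  simp only [Equiv.apply_symm_apply] at this
  simpa only [hy'] using this

theorem sizeOf_eq (k : ℕ) (j : Fin I.m) :
    (I.sizeOf k j : ℝ) = 2 * k ^ 2 * I.valueScale * I.value j := by
  have h1 : I.valueDen j ∣ I.valueScale :=
    Finset.dvd_prod_of_mem _ (Finset.mem_range.2 j.2)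
  have h2 : (I.valueDen j : ℝ) ≠ 0 := Nat.cast_ne_zero.2 (I.valueDen_pos j).ne'
  have h3 : I.valueNum j = (I.value j).num := dif_pos j.2
  have h4 : I.valueDen j = (I.value j).den := dif_pos j.2
  unfold sizeOf
  rw [Nat.cast_mul, Nat.cast_div h1 h2, NNRat.cast_def, ← h3, ← h4]
  push_cast
  ring

theorem intWeight_eq (i : Fin I.n) :
    (I.intWeight i : ℝ) = I.weightScale * I.realWeight i := by
  have h1 : I.weightDen i ∣ I.weightScale :=
    Finset.dvd_prod_of_mem _ (Finset.mem_range.2 i.2)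
  have h2 : (I.weightDen i : ℝ) ≠ 0 := Nat.cast_ne_zero.2 (I.weightDen_pos i).ne'
  have h3 : I.weightNum i = (I.weight i).num := dif_pos i.2
  have h4 : I.weightDen i = (I.weight i).den := dif_pos i.2
  unfold intWeight realWeight
  rw [Nat.cast_mul, Nat.cast_div h1 h2, NNRat.cast_def, ← h3, ← h4]
  push_cast
  ring

theorem loadOf_eq (k : ℕ) {z : ℕ → ℕ} {x : Allocation I.n I.m} (h : ∀ j : Fin I.m, z j = x j)
    (i : Fin I.n) :
    (I.loadOf k z i : ℝ) = 2 * k ^ 2 * I.valueScale * I.valuation i (bundle x i) := by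
  unfold loadOf valuation bundle
  rw [Finset.sum_filter, Finset.sum_range, Nat.cast_sum, Finset.sum_filter, Finset.mul_sum]
  refine Finset.sum_congr rfl fun j _ => ?_
  rw [h j]
  by_cases hj : x j = i
  · rw [if_pos hj, if_pos (congrArg Fin.val hj), sizeOf_eq]
  · rw [if_neg hj, if_neg fun h' => hj (Fin.ext h')]
    simp

theorem valuation_nonneg (i : Fin I.n) (S : Finset (Fin I.m)) : 0 ≤ I.valuation i S :=
  Finset.sum_nonneg fun _ _ => NNRat.cast_nonneg _

theorem realWeight_pos (i : Fin I.n) : 0 < I.realWeight i :=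
  NNRat.cast_pos.2 (I.weight_pos i)

theorem sum_realWeight_pos : 0 < ∑ i, I.realWeight i :=
  Finset.sum_pos (fun i _ => I.realWeight_pos i) ⟨⟨0, I.n_pos⟩, Finset.mem_univ _⟩

theorem nashWelfare_nonneg (x : Allocation I.n I.m) :
    0 ≤ nashWelfare I.valuation I.realWeight x :=
  Real.rpow_nonneg (Finset.prod_nonneg fun _ _ => Real.rpow_nonneg (I.valuation_nonneg _ _) _) _

theorem nashWelfare_eq_zero {x : Allocation I.n I.m} {i : Fin I.n}
    (h : I.valuation i (bundle x i) = 0) : nashWelfare I.valuation I.realWeight x = 0 := by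
  unfold nashWelfare
  rw [Finset.prod_eq_zero (Finset.mem_univ i), Real.zero_rpow]
  · exact (one_div_pos.2 I.sum_realWeight_pos).ne'
  · rw [h, Real.zero_rpow (I.realWeight_pos i).ne']

theorem nashWelfare_eq_exp {x : Allocation I.n I.m}
    (h : ∀ i, 0 < I.valuation i (bundle x i)) :
    nashWelfare I.valuation I.realWeight x =
      Real.exp ((∑ i, I.realWeight i * Real.log (I.valuation i (bundle x i))) /
        ∑ i, I.realWeight i) := by
  have h1 : ∏ i, I.valuation i (bundle x i) ^ I.realWeight i =
      Real.exp (∑ i, I.realWeight i * Real.log (I.valuation i (bundle x i))) := by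
    rw [Real.exp_sum]
    exact Finset.prod_congr rfl fun i _ => by rw [Real.rpow_def_of_pos (h i), mul_comm]
  unfold nashWelfare
  rw [h1, ← Real.exp_mul, mul_one_div]

theorem mul_nashWelfare_le {ρ : ℝ} (hρ : 0 < ρ) {x y : Allocation I.n I.m}
    (hx : ∀ i, 0 < I.valuation i (bundle x i)) (hy : ∀ i, 0 < I.valuation i (bundle y i))
    (h : ∑ i, I.realWeight i * (Real.log (I.valuation i (bundle y i)) + Real.log ρ) ≤
      ∑ i, I.realWeight i * Real.log (I.valuation i (bundle x i))) :
    ρ * nashWelfare I.valuation I.realWeight y ≤ nashWelfare I.valuation I.realWeight x := by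
  have hs := I.sum_realWeight_pos
  rw [I.nashWelfare_eq_exp hx, I.nashWelfare_eq_exp hy]
  nth_rw 1 [← Real.exp_log hρ]
  rw [← Real.exp_add, Real.exp_le_exp, le_div_iff₀ hs, add_mul, div_mul_cancel₀ _ hs.ne']
  simp only [mul_add, Finset.sum_add_distrib, ← Finset.sum_mul] at h
  linarith

/-- If some bundle of `y` is worthless, its Nash welfare is 0. Otherwise logarithms turn the claim
into a comparison of weighted sums. Here `k ≥ 9` makes `ratio k` positive. -/
theorem isApprox_of_table {k : ℕ} (hk : 9 ≤ k) {x ord A : ℕ → ℕ} {x' : Allocation I.n I.m}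
    (hxx : ∀ j : Fin I.m, x j = x' j)
    (hord : ∀ i < I.n, ord (rankOf I.n I.intWeight i) = i) (hA : (I.data k ord).IsTable A)
    (hx : A 0 ≠ 0 → ∃ a e : ℕ → ℕ,
      A 0 / (2 * k ^ 2) = 1 + ∑ i ∈ Finset.range I.n, (I.data k ord).gain (a i) i (e i) ∧
        ∀ i < I.n, k ^ 2 ≤ 2 * e i ∧ e i * 2 ^ a i * (k - 3) ≤ I.loadOf k x (ord i) * k) :
    IsApprox I.valuation I.realWeight (1 - 8 / k) x' := by
  intro y
  have hk' : (9 : ℝ) ≤ k := by exact_mod_cast hk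
  have hρ : 0 < Data.ratio k := by
    refine lt_of_lt_of_le ?_ (Data.le_ratio (by omega))
    rw [sub_pos, div_lt_one (by linarith)]
    linarith
  by_cases hy : ∃ i, I.valuation i (bundle y i) = 0
  · obtain ⟨i, hi⟩ := hy
    rw [I.nashWelfare_eq_zero hi, mul_zero]
    exact I.nashWelfare_nonneg x'
  push Not at hy
  have hy0 : ∀ i, 0 < I.valuation i (bundle y i) := fun i =>
    (I.valuation_nonneg _ _).lt_of_ne (hy i).symm
  refine (mul_le_mul_of_nonneg_right (Data.le_ratio (by omega)) (I.nashWelfare_nonneg y)).trans ?_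
  let z : ℕ → ℕ := fun j => if h : j < I.m then y ⟨j, h⟩ else 0
  have hz : ∀ j : Fin I.m, z j = y j := fun j => dif_pos j.2
  have hvs : (0 : ℝ) < I.valueScale :=
    Nat.cast_pos.2 (Finset.prod_pos fun j _ => I.valueDen_pos j)
  have hws : (0 : ℝ) < I.weightScale :=
    Nat.cast_pos.2 (Finset.prod_pos fun j _ => I.weightDen_pos j)
  have hc : (0 : ℝ) < 2 * k ^ 2 * I.valueScale := by positivity
  obtain ⟨h1, h2⟩ := I.sum_log_loadOf_le (by omega) hord hA hx (y := z)
    (fun j hj => by rw [hz ⟨j, hj⟩]; exact (y _).2) (fun i hi => by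
      rw [← Nat.cast_pos (α := ℝ), I.loadOf_eq k hz ⟨i, hi⟩]
      exact mul_pos hc (hy0 _))
  have hx0 : ∀ i, 0 < I.valuation i (bundle x' i) := fun i => by
    have := h1 i i.2
    rw [← Nat.cast_pos (α := ℝ), I.loadOf_eq k hxx i] at this
    exact pos_of_mul_pos_right this hc.le
  refine I.mul_nashWelfare_le hρ hx0 hy0 ?_
  rw [Finset.sum_range, Finset.sum_range] at h2
  simp only [I.loadOf_eq k hz, I.loadOf_eq k hxx, intWeight_eq,
    Real.log_mul hc.ne' (hx0 _).ne', Real.log_mul hc.ne' (hy0 _).ne'] at h2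
  -- Scaling the values shifts all logarithms by one constant, which cancels; the scale of the
  -- weights is a common positive factor.
  generalize Real.log (2 * k ^ 2 * I.valueScale) = c at h2
  simp only [mul_assoc, ← Finset.mul_sum] at h2
  have h3 := le_of_mul_le_mul_left h2 hws
  simp only [mul_add, Finset.sum_add_distrib] at h3 ⊢
  linarith

end Inst

end NashWelfare

theorem theorem1 :
    ∃ K : ℕ, ∀ ε : ℝ, 0 < ε → ε < 1 →
      ∃ p : NashWelfare.Prog, ∀ I : NashWelfare.Inst,
        NashWelfare.SolvesWithin p I ε
          ((K : ℝ) * (I.size : ℝ) ^ K * ((I.m : ℝ) + 1) ^ ((K : ℝ) / ε ^ 2)) := by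
  -- The bound `2025 = 25 * 9²` comes from the exponent `25k²` and `kε ≤ 9`.
  obtain ⟨K, hK, hK'⟩ : ∃ K : ℕ, NashWelfare.timeConst ≤ K ∧ 2025 ≤ K :=
    ⟨NashWelfare.timeConst, le_rfl, by norm_num [NashWelfare.timeConst]⟩
  refine ⟨K, fun ε h0 h1 => ?_⟩
  -- The accuracy is `⌈8/ε⌉`, so `8/k ≤ ε`, while `ε < 1` gives `k ≥ 9` and `kε < 8 + ε`.
  obtain ⟨k, hkl, hku⟩ : ∃ k : ℕ, 8 / ε ≤ k ∧ (k : ℝ) < 8 / ε + 1 :=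
    ⟨⌈8 / ε⌉₊, Nat.le_ceil _, Nat.ceil_lt_add_one (by positivity)⟩
  have hk8 : (8 : ℝ) < k := lt_of_lt_of_le (by rw [lt_div_iff₀ h0]; linarith) hkl
  have hk : 9 ≤ k := by exact_mod_cast hk8
  have hε : (8 : ℝ) / k ≤ ε := by
    rw [div_le_iff₀ h0] at hkl
    rw [div_le_iff₀ (by linarith)]
    linarith
  have hkε : 25 * (k : ℝ) ^ 2 ≤ K / ε ^ 2 := by
    have h2 : (k : ℝ) * ε ≤ 9 := by
      have h3 := mul_lt_mul_of_pos_right hku h0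
      rw [add_mul, div_mul_cancel₀ _ h0.ne'] at h3
      linarith
    have h3 : (2025 : ℝ) ≤ K := by exact_mod_cast hK'
    rw [le_div_iff₀ (by positivity)]
    have h4 : ((k : ℝ) * ε) ^ 2 ≤ 9 ^ 2 := by gcongr
    calc 25 * (k : ℝ) ^ 2 * ε ^ 2 = 25 * (k * ε) ^ 2 := by ring
      _ ≤ 25 * 9 ^ 2 := by gcongr
      _ ≤ K := by linarith
  refine ⟨.solve k, fun I => ?_⟩
  have hz : (1 : ℝ) ≤ I.size := by
    have := I.two_mul_add_le_size
    exact_mod_cast (by omega : 1 ≤ I.size)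
  have hm1 : (1 : ℝ) ≤ I.m + 1 := by linarith [(Nat.cast_nonneg I.m : (0 : ℝ) ≤ I.m)]
  -- With no goods there is a single allocation, so any output is optimal.
  rcases Nat.eq_zero_or_pos I.m with hm | hm
  · have hx : ∀ x y : NashWelfare.Allocation I.n I.m, x = y := fun x y =>
      funext fun j => absurd j.2 (by omega)
    let x : NashWelfare.Allocation I.n I.m := fun _ => ⟨0, I.n_pos⟩
    refine ⟨_, 7, x, NashWelfare.exec_solve_of_eq_zero k I hm, ?_,
      fun j => absurd j.2 (by omega), fun y => ?_⟩
    · have h3 : (2025 : ℝ) ≤ K := by exact_mod_cast hK'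
      rw [hm, Nat.cast_zero, zero_add, Real.one_rpow, mul_one]
      have := one_le_pow₀ (n := K) hz
      push_cast
      nlinarith
    · rw [hx y x]
      exact mul_le_of_le_one_left (I.nashWelfare_nonneg x) (by linarith)
  · obtain ⟨s, t, hs, ht, hlt, ord, hord, A, hA, hA0⟩ :=
      NashWelfare.exec_solve (k := k) (by omega) I hm
    refine ⟨s, t, fun j => ⟨s 1 j, hlt j⟩, hs, ?_, fun j => rfl, fun y => ?_⟩
    · calc (t : ℝ) ≤ ((NashWelfare.timeConst * I.size ^ 6 * (I.m + 1) ^ (25 * k ^ 2) : ℕ) : ℝ) :=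
            Nat.cast_le.2 ht
        _ = (NashWelfare.timeConst : ℝ) * (I.size : ℝ) ^ 6 *
            ((I.m : ℝ) + 1) ^ (25 * (k : ℝ) ^ 2) := by
          rw [show (25 * (k : ℝ) ^ 2) = ((25 * k ^ 2 : ℕ) : ℝ) by push_cast; ring,
            Real.rpow_natCast]
          push_cast
          ring
        _ ≤ _ := by
          gcongr
          omega
    · refine le_trans ?_ (I.isApprox_of_table hk (x := s 1) (fun j => rfl) hord hA hA0 y)
      exact mul_le_mul_of_nonneg_right (by linarith) (I.nashWelfare_nonneg y)
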